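/- A foliation of degree $N$ on $\mathbb P^2(\mathbb C)$ is the class, up to a nonzero constant, of a $1$-form $\omega=a\,dX+b\,dY+c\,dZ$ on $\mathbb C^3$ whose coefficients are homogeneous polynomials of degree $N+1$ without common component and satisfy $aX+bY+cZ=0$; the set $\mathscr F(2;2)$ of foliations of degree $2$ (quadratic foliations) is thus an open subset of a projective space $\mathbb P^{14}(\mathbb C)$, and $\mathrm{Aut}(\mathbb P^2(\mathbb C))=\mathrm{PGL}_3(\mathbb C)$ acts on it. For $\mathcal F\in\mathscr F(2;2)$ let $\mathcal O(\mathcal F)$ be its orbit, $\mathrm{Iso}(\mathcal F)\subset\mathrm{PGL}_3(\mathbb C)$ its stabilizer (isotropy group), and $\mathfrak{iso}(\mathcal F)\subset\mathfrak{sl}_3(\mathbb C)$ the Lie algebra of $\mathrm{Iso}(\mathcal F)$, that is, the set of the $A$ with $\exp(tA)\in\mathrm{Iso}(\mathcal F)$ for all $t\in\mathbb C$. Let $\mathcal F_1$ and $\mathcal F_5$ be the quadratic foliations given in the affine chart $Z=1$ by $$\omega_1=x^2dx+y^2(x\,dy-y\,dx),\qquad \omega_5=x^2dy+y^2(x\,dy-y\,dx).$$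 **Proposition.** (a) If $\mathcal F\in\mathscr F(2;2)$ and $\dim\mathfrak{iso}(\mathcal F)=2$, then $\mathcal F$ is, up to an automorphism of $\mathbb P^2(\mathbb C)$, equal to $\mathcal F_1$ or to $\mathcal F_5$. (b) $\mathcal O(\mathcal F_1)$ and $\mathcal O(\mathcal F_5)$ are distinct, and they are exactly the orbits of dimension $6$ in $\mathscr F(2;2)$ (dimension as an algebraic variety). (c) $\mathcal O(\mathcal F_1)$ and $\mathcal O(\mathcal F_5)$ are closed in $\mathscr F(2;2)$ (for the usual topology). (d) $\mathrm{Iso}(\mathcal F_1)$ is the set of all compositions of an automorphism $(x,y)\mapsto(\alpha^3x,\alpha^2y)$ with an automorphism $(x,y)\mapsto\left(\frac{x}{1+\beta x},\frac{y}{1+\beta x}\right)$, and $\mathrm{Iso}(\mathcal F_5)$ is the set of all compositions of an automorphism $(x,y)\mapsto(\alpha^2x,\alpha y)$ with an automorphism $(x,y)\mapsto\left(\frac{x}{1+\beta y},\frac{y}{1+\beta y}\right)$, where $\alpha\in\mathbb C^*$ and $\beta\in\mathbb C$; that is, $$\mathrm{Iso}(\mathcal F_1)=\{(\alpha^3X:\alpha^2Y:Z+\beta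 X)\mid\alpha\in\mathbb C^*,\ \beta\in\mathbb C\},\qquad \mathrm{Iso}(\mathcal F_5)=\{(\alpha^2X:\alpha Y:Z+\beta Y)\mid\alpha\in\mathbb C^*,\ \beta\in\mathbb C\}.$$ (e) The groups $\mathrm{Iso}(\mathcal F_1)$ and $\mathrm{Iso}(\mathcal F_5)$ are not conjugate in $\mathrm{PGL}_3(\mathbb C)$. -/

import Mathlib

open MvPolynomial
open scoped LinearAlgebra.Projectivization MatrixGroups

noncomputable section

namespace P2Foliation

/-- Polynomial `1`-forms `a dX + b dY + c dZ` on `ℂ³`, written as the triple `(a, b, c)`. The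
variables `X`, `Y`, `Z` have the indices `0`, `1`, `2`. -/
abbrev PolyForm : Type := Fin 3 → MvPolynomial (Fin 3) ℂ

/-- The `1`-forms whose coefficients are homogeneous of degree `N + 1` and which satisfy
Euler's identity `a X + b Y + c Z = 0`. -/
def Form (N : ℕ) : Submodule ℂ PolyForm where
  carrier := {ω | (∀ i, (ω i).IsHomogeneous (N + 1)) ∧ ∑ i, ω i * X i = 0}
  zero_mem' := ⟨fun _ => isHomogeneous_zero _ _ _, by simp⟩
  add_mem' := by
    rintro a b ⟨ha, ha'⟩ ⟨hb, hb'⟩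
    exact ⟨fun i => (ha i).add (hb i), by simp [add_mul, Finset.sum_add_distrib, ha', hb']⟩
  smul_mem' := by
    rintro c a ⟨ha, ha'⟩
    refine ⟨fun i => ?_, ?_⟩
    · simpa [smul_eq_C_mul] using (ha i).C_mul c
    · simp [← Finset.smul_sum, ha']

/-- The three coefficients have no common component. -/
def NoCommonFactor (ω : PolyForm) : Prop :=
  ∀ d : MvPolynomial (Fin 3) ℂ, (∀ i, d ∣ ω i) → IsUnit d

/-! ### Linear changes of coordinates -/

/-- Substitution of the linear map `x ↦ A x` in a polynomial. -/
def subst (A : Matrix (Fin 3) (Fin 3) ℂ) :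
    MvPolynomial (Fin 3) ℂ →ₐ[ℂ] MvPolynomial (Fin 3) ℂ :=
  aeval fun k => ∑ l, C (A k l) * X l

/-- The pull-back `A^* ω` of a `1`-form by the linear map `x ↦ A x`. -/
def pull (A : Matrix (Fin 3) (Fin 3) ℂ) (ω : PolyForm) : PolyForm :=
  fun j => ∑ i, C (A i j) * subst A (ω i)

theorem subst_X (A : Matrix (Fin 3) (Fin 3) ℂ) (k : Fin 3) :
    subst A (X k) = ∑ l, C (A k l) * X l := by simp [subst]

theorem subst_C (A : Matrix (Fin 3) (Fin 3) ℂ) (c : ℂ) : subst A (C c) = C c := by simp [subst]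

theorem subst_subst (A B : Matrix (Fin 3) (Fin 3) ℂ) (p : MvPolynomial (Fin 3) ℂ) :
    subst A (subst B p) = subst (B * A) p := by
  have : (subst A).comp (subst B) = subst (B * A) := by
    ext1 k
    simp only [AlgHom.comp_apply, subst_X, map_sum, map_mul, subst_C, Finset.mul_sum,
      Matrix.mul_apply, Finset.sum_mul]
    rw [Finset.sum_comm]
    simp only [mul_assoc]
  exact DFunLike.congr_fun this p

theorem pull_pull (A B : Matrix (Fin 3) (Fin 3) ℂ) (ω : PolyForm) :
    pull A (pull B ω) = pull (B * A) ω := by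
  funext j
  simp only [pull, map_sum, map_mul, subst_C, subst_subst, Finset.mul_sum, Matrix.mul_apply,
    Finset.sum_mul]
  rw [Finset.sum_comm]
  refine Finset.sum_congr rfl fun i _ => Finset.sum_congr rfl fun k _ => ?_
  ring

theorem subst_one (p : MvPolynomial (Fin 3) ℂ) : subst 1 p = p := by
  have : subst 1 = AlgHom.id ℂ _ := by
    ext1 k
    simp [subst_X, Matrix.one_apply]
  rw [this]; rfl

theorem pull_one (ω : PolyForm) : pull 1 ω = ω := by
  funext j
  simp [pull, subst_one, Matrix.one_apply]

theorem pull_add (A : Matrix (Fin 3) (Fin 3) ℂ) (ω η : PolyForm) :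
    pull A (ω + η) = pull A ω + pull A η := by
  funext j
  simp [pull, mul_add, Finset.sum_add_distrib]

theorem pull_smul (A : Matrix (Fin 3) (Fin 3) ℂ) (c : ℂ) (ω : PolyForm) :
    pull A (c • ω) = c • pull A ω := by
  funext j
  simp [pull, Finset.smul_sum]

theorem pull_mem {N : ℕ} (A : Matrix (Fin 3) (Fin 3) ℂ) {ω : PolyForm} (h : ω ∈ Form N) :
    pull A ω ∈ Form N := by
  refine ⟨fun j => IsHomogeneous.sum _ _ _ fun i _ => ?_, ?_⟩
  · refine IsHomogeneous.C_mul ?_ _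
    have := (h.1 i).aeval (fun k => ∑ l, C (A k l) * X l)
      (n := 1) (fun k => IsHomogeneous.sum _ _ _ fun l _ => (isHomogeneous_X ℂ l).C_mul _)
    simpa [subst] using this
  · have := congrArg (subst A) h.2
    simp only [map_sum, map_mul, map_zero, subst_X, Finset.mul_sum] at this
    rw [Finset.sum_comm] at this
    simp only [pull, Finset.sum_mul]
    rw [← this]
    refine Finset.sum_congr rfl fun i _ => Finset.sum_congr rfl fun k _ => ?_
    ring

theorem noCommonFactor_pull {A B : Matrix (Fin 3) (Fin 3) ℂ} (h : A * B = 1) {ω : PolyForm}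
    (hω : NoCommonFactor ω) : NoCommonFactor (pull A ω) := by
  intro d hd
  have h1 : ∀ i, subst B d ∣ ω i := by
    intro i
    have : ω i = pull B (pull A ω) i := by rw [pull_pull, h, pull_one]
    rw [this]
    exact Finset.dvd_sum fun k _ => Dvd.dvd.mul_left (map_dvd (subst B) (hd k)) _
  have h2 := (hω _ h1).map (subst A)
  rwa [subst_subst, mul_eq_one_comm.mp h, subst_one] at h2

theorem noCommonFactor_smul {c : ℂ} (hc : c ≠ 0) {ω : PolyForm} :
    NoCommonFactor (c • ω) ↔ NoCommonFactor ω := by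
  have : ∀ (d p : MvPolynomial (Fin 3) ℂ), d ∣ c • p ↔ d ∣ p := by
    intro d p
    rw [smul_eq_C_mul]
    exact (((isUnit_iff_ne_zero.mpr hc).map C).dvd_mul_left)
  simp [NoCommonFactor, this]

/-- A linear change of coordinates `g` acts on forms by push-forward: `g • ω = (g⁻¹)^* ω`. -/
instance (N : ℕ) : DistribMulAction (GL (Fin 3) ℂ) (Form N) where
  smul g ω := ⟨pull (g⁻¹).val ω, pull_mem _ ω.2⟩
  one_smul ω := Subtype.ext (by
    change pull _ _ = _
    rw [inv_one, Units.val_one, pull_one])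
  mul_smul g h ω := Subtype.ext (by
    change pull _ _ = pull _ (pull _ _)
    rw [pull_pull, mul_inv_rev, Units.val_mul])
  smul_zero _ := Subtype.ext (by
    change pull _ (0 : PolyForm) = 0
    funext j
    simp [pull])
  smul_add _ ω η := Subtype.ext (pull_add _ _ _)

theorem coe_smul {N : ℕ} (g : GL (Fin 3) ℂ) (ω : Form N) :
    ((g • ω : Form N) : PolyForm) = pull (g⁻¹).val ω := rfl

instance (N : ℕ) : SMulCommClass (GL (Fin 3) ℂ) ℂ (Form N) where
  smul_comm g c ω := Subtype.ext (pull_smul _ c ω)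

/-! ### The space of foliations -/

/-- The space `ℱ(2; N)` of foliations of degree `N` on `ℙ²(ℂ)`: the classes, up to a nonzero
constant, of forms of degree `N + 1` satisfying Euler's identity and without common component. -/
def Foliation (N : ℕ) : Type := {p : ℙ ℂ (Form N) // NoCommonFactor (p.rep : PolyForm)}

theorem noCommonFactor_rep {N : ℕ} (ω : Form N) (hω : ω ≠ 0) :
    NoCommonFactor ((Projectivization.mk ℂ ω hω).rep : PolyForm) ↔
      NoCommonFactor (ω : PolyForm) := by
  obtain ⟨a, ha⟩ := Projectivization.exists_smul_eq_mk_rep ℂ ω hω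
  rw [← ha]
  exact noCommonFactor_smul a.ne_zero

theorem ne_zero_of_noCommonFactor {N : ℕ} {ω : Form N} (h : NoCommonFactor (ω : PolyForm)) :
    ω ≠ 0 := by
  rintro rfl
  exact not_isUnit_zero (h 0 (by simp))

theorem Foliation.eq_iff {N : ℕ} {F G : Foliation N} : F = G ↔ F.1 = G.1 :=
  ⟨fun h => h ▸ rfl, fun h => Subtype.ext h⟩

/-- The foliation defined by a form. -/
def Foliation.mk {N : ℕ} (ω : Form N) (h : NoCommonFactor (ω : PolyForm)) : Foliation N :=
  ⟨Projectivization.mk ℂ ω (ne_zero_of_noCommonFactor h), (noCommonFactor_rep _ _).mpr h⟩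

/-- The usual topology of the finite-dimensional space `Form N`: the topology of the convergence
of all coefficients. -/
instance (N : ℕ) : TopologicalSpace (Form N) :=
  TopologicalSpace.induced
    (fun ω (i : Fin 3) (m : Fin 3 →₀ ℕ) => coeff m ((ω : PolyForm) i)) inferInstance

/-- The usual (quotient) topology of the projective space of forms. -/
instance (N : ℕ) : TopologicalSpace (ℙ ℂ (Form N)) :=
  TopologicalSpace.coinduced (Projectivization.mk' ℂ) inferInstance

/-- The usual topology of `ℱ(2; N)`, as a subspace of the projective space of forms. -/
instance (N : ℕ) : TopologicalSpace (Foliation N) :=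
  instTopologicalSpaceSubtype

instance (N : ℕ) : MulAction (GL (Fin 3) ℂ) (Foliation N) where
  smul g F := ⟨g • F.1, by
    obtain ⟨p, hp⟩ := F
    induction p using Projectivization.ind with
    | h ω hω =>
      change NoCommonFactor ((g • Projectivization.mk ℂ ω hω : ℙ ℂ (Form N)).rep : PolyForm)
      rw [Projectivization.smul_mk, noCommonFactor_rep, coe_smul]
      exact noCommonFactor_pull (Units.inv_mul g) ((noCommonFactor_rep _ _).mp hp)⟩
  one_smul F := Subtype.ext (one_smul _ F.1)
  mul_smul g h F := Subtype.ext (mul_smul g h F.1)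

theorem Foliation.smul_val {N : ℕ} (g : GL (Fin 3) ℂ) (F : Foliation N) :
    (g • F).1 = g • F.1 := rfl

theorem subst_scalar {p : MvPolynomial (Fin 3) ℂ} {n : ℕ} (hp : p.IsHomogeneous n) (c : ℂ) :
    subst (Matrix.scalar (Fin 3) c) p = C (c ^ n) * p := by
  have h1 : ∀ k : Fin 3, ∑ l, C ((Matrix.scalar (Fin 3) c) k l) * X l
      = (C c * X k : MvPolynomial (Fin 3) ℂ) := by
    intro k
    simp [Matrix.scalar_apply, Matrix.diagonal_apply, apply_ite, ite_mul]
  rw [subst, funext h1]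
  conv_lhs => rw [p.as_sum]
  conv_rhs => rw [p.as_sum]
  rw [map_sum, Finset.mul_sum]
  refine Finset.sum_congr rfl fun m hm => ?_
  have hd : m.degree = n := by
    by_contra hne
    exact (mem_support_iff.mp hm) (hp.coeff_eq_zero hne)
  rw [aeval_monomial, monomial_eq, ← hd]
  rw [Finsupp.prod_fintype _ _ (fun _ => pow_zero _), Finsupp.prod_fintype _ _ (fun _ => pow_zero _)]
  simp only [mul_pow, Finset.prod_mul_distrib,
    Finsupp.degree_eq_sum, Finset.prod_pow_eq_pow_sum, map_pow, algebraMap_eq]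
  ring

/-- `Aut(ℙ²(ℂ)) = PGL(3, ℂ)` acts on `ℱ(2; N)`. -/
instance (N : ℕ) : MulAction PGL(3, ℂ) (Foliation N) :=
  Matrix.ProjGenLinGroup.mulActionOfGL fun u F => Subtype.ext (by
    rw [Foliation.smul_val]
    obtain ⟨p, hp⟩ := F
    induction p using Projectivization.ind with
    | h ω hω =>
      rw [Projectivization.smul_mk, Projectivization.mk_eq_mk_iff']
      refine ⟨(u⁻¹ : ℂˣ).val ^ (N + 2), Subtype.ext ?_⟩
      rw [coe_smul]
      funext j
      have h1 : ((Matrix.GeneralLinearGroup.scalar (Fin 3) u)⁻¹).val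
          = Matrix.scalar (Fin 3) (u⁻¹ : ℂˣ).val := by
        rw [← map_inv]; rfl
      rw [h1]
      simp only [pull, subst_scalar (ω.2.1 _)]
      simp [Matrix.scalar_apply, Matrix.diagonal_apply, apply_ite, ite_mul, smul_eq_C_mul,
        -inv_pow]
      ring)

theorem mk_smul_eq_iff {N : ℕ} (g : GL (Fin 3) ℂ) (ω : Form N) (h : NoCommonFactor (ω : PolyForm)) :
    (Matrix.ProjGenLinGroup.mk g : PGL(3, ℂ)) • Foliation.mk ω h = Foliation.mk ω h ↔
      ∃ c : ℂ, pull (g⁻¹).val ω = c • (ω : PolyForm) := by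
  change g • Foliation.mk ω h = Foliation.mk ω h ↔ _
  rw [Foliation.eq_iff, Foliation.smul_val]
  change g • Projectivization.mk ℂ ω _ = Projectivization.mk ℂ ω _ ↔ _
  rw [Projectivization.smul_mk, Projectivization.mk_eq_mk_iff']
  refine exists_congr fun c => ?_
  rw [Subtype.ext_iff, coe_smul]
  exact eq_comm

/-- The orbit `𝒪(F)` of a foliation under `Aut(ℙ²(ℂ))`. -/
abbrev Orbit {N : ℕ} (F : Foliation N) : Set (Foliation N) := MulAction.orbit PGL(3, ℂ) F

/-- The isotropy group of a foliation: the automorphisms of `ℙ²(ℂ)` which preserve it. -/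
abbrev Iso {N : ℕ} (F : Foliation N) : Subgroup PGL(3, ℂ) := MulAction.stabilizer PGL(3, ℂ) F

/-! ### Symmetries -/

/-- The automorphism `exp A` of `ℂ³`. -/
def expGL (A : Matrix (Fin 3) (Fin 3) ℂ) : GL (Fin 3) ℂ where
  val := NormedSpace.exp A
  inv := NormedSpace.exp (-A)
  val_inv := by
    rw [← Matrix.exp_add_of_commute _ _ (Commute.neg_right (Commute.refl A)), add_neg_cancel,
      NormedSpace.exp_zero]
  inv_val := by
    rw [← Matrix.exp_add_of_commute _ _ (Commute.neg_left (Commute.refl A)), neg_add_cancel,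
      NormedSpace.exp_zero]

/-- The global vector fields of `ℙ²(ℂ)` are identified with the trace-free matrices `A` (the field
induced by the linear field `x ↦ A x` of `ℂ³`). It is a symmetry of `F` if its flow preserves
`F` at all times. -/
def IsSymmetry {N : ℕ} (F : Foliation N) (A : Matrix (Fin 3) (Fin 3) ℂ) : Prop :=
  ∀ t : ℂ, Matrix.ProjGenLinGroup.mk (expGL (t • A)) ∈ Iso F

/-- The derivation of polynomials along the linear field `x ↦ A x`. -/
def linDer (A : Matrix (Fin 3) (Fin 3) ℂ) :
    Derivation ℂ (MvPolynomial (Fin 3) ℂ) (MvPolynomial (Fin 3) ℂ) :=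
  mkDerivation ℂ fun k => ∑ l, C (A k l) * X l

/-- The Lie derivative of a form along the linear field `x ↦ A x`. -/
def lieDer (A : Matrix (Fin 3) (Fin 3) ℂ) (ω : PolyForm) : PolyForm :=
  fun j => ∑ i, C (A i j) * ω i + linDer A (ω j)

theorem linDer_X (A : Matrix (Fin 3) (Fin 3) ℂ) (k : Fin 3) :
    linDer A (X k) = ∑ l, C (A k l) * X l := by simp [linDer, mkDerivation_X]

theorem linDer_C_mul (A : Matrix (Fin 3) (Fin 3) ℂ) (c : ℂ) (p : MvPolynomial (Fin 3) ℂ) :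
    linDer A (C c * p) = C c * linDer A p := by
  rw [← smul_eq_C_mul, ← smul_eq_C_mul, Derivation.map_smul]

theorem linDer_add (A B : Matrix (Fin 3) (Fin 3) ℂ) : linDer (A + B) = linDer A + linDer B := by
  ext1 k
  simp [linDer_X, add_mul, Finset.sum_add_distrib]

theorem linDer_smul (c : ℂ) (A : Matrix (Fin 3) (Fin 3) ℂ) : linDer (c • A) = c • linDer A := by
  ext1 k
  simp [linDer_X, Finset.mul_sum, smul_eq_C_mul, mul_assoc]

theorem linDer_lie (A B : Matrix (Fin 3) (Fin 3) ℂ) : linDer ⁅A, B⁆ = ⁅linDer B, linDer A⁆ := by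
  have key : ∀ (A B : Matrix (Fin 3) (Fin 3) ℂ) (k : Fin 3),
      linDer B (linDer A (X k)) = ∑ l, C ((A * B) k l) * X l := by
    intro A B k
    simp only [linDer_X, map_sum, linDer_C_mul, Matrix.mul_apply, Finset.sum_mul, Finset.mul_sum,
      map_mul]
    rw [Finset.sum_comm]
    simp only [mul_assoc]
  ext1 k
  rw [Derivation.commutator_apply, key, key, linDer_X, ← Finset.sum_sub_distrib]
  simp [Ring.lie_def, sub_mul]

theorem lieDer_lie (A B : Matrix (Fin 3) (Fin 3) ℂ) (ω : PolyForm) :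
    lieDer ⁅A, B⁆ ω = lieDer B (lieDer A ω) - lieDer A (lieDer B ω) := by
  funext j
  simp only [lieDer, Pi.sub_apply, linDer_lie, Derivation.commutator_apply]
  simp only [Ring.lie_def,
    Matrix.sub_apply, Matrix.mul_apply, Fin.sum_univ_three, map_add, linDer_C_mul, map_sub, map_mul]
  ring

theorem lieDer_smul_right (A : Matrix (Fin 3) (Fin 3) ℂ) (c : ℂ) (ω : PolyForm) :
    lieDer A (c • ω) = c • lieDer A ω := by
  funext j
  simp [lieDer, Finset.smul_sum]

/-- The entries of `exp (t A)` are differentiable in `t`. -/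
theorem hasDerivAt_exp_entry (A : Matrix (Fin 3) (Fin 3) ℂ) (t : ℂ) (i j : Fin 3) :
    HasDerivAt (fun t : ℂ => (NormedSpace.exp (t • A) : Matrix (Fin 3) (Fin 3) ℂ) i j)
      ((A * NormedSpace.exp (t • A)) i j) t := by
  open scoped Matrix.Norms.Operator in
  have h := hasDerivAt_exp_smul_const' (𝕂 := ℂ) A t
  have h2 := (hasDerivAt_pi.mp h) i
  exact (hasDerivAt_pi.mp h2) j

theorem hasDerivAt_eval {A : Matrix (Fin 3) (Fin 3) ℂ} {w : ℂ → Fin 3 → ℂ} {t : ℂ}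
    (hw : ∀ k, HasDerivAt (fun s => w s k) (∑ l, A k l * w t l) t) (p : MvPolynomial (Fin 3) ℂ) :
    HasDerivAt (fun s => eval (w s) p) (eval (w t) (linDer A p)) t := by
  induction p using MvPolynomial.induction_on with
  | C a => simpa using hasDerivAt_const t a
  | add p q hp hq => simpa [Pi.add_def] using hp.add hq
  | mul_X p k hp =>
    have := hp.mul (hw k)
    simp only [map_mul, eval_X, Derivation.leibniz, map_add, smul_eq_mul, linDer_X, map_sum, eval_C]
    exact this.congr_deriv (by ring)

theorem eval_subst (A : Matrix (Fin 3) (Fin 3) ℂ) (p : MvPolynomial (Fin 3) ℂ) (v : Fin 3 → ℂ) :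
    eval v (subst A p) = eval (A.mulVec v) p := by
  have : (aeval v : MvPolynomial (Fin 3) ℂ →ₐ[ℂ] ℂ).comp (subst A) = aeval (A.mulVec v) := by
    ext1 k
    simp [subst_X, Matrix.mulVec, dotProduct]
  simpa [aeval_eq_eval] using DFunLike.congr_fun this p

theorem hasDerivAt_pull (A : Matrix (Fin 3) (Fin 3) ℂ) (ω : PolyForm) (v : Fin 3 → ℂ) (j : Fin 3)
    (t : ℂ) :
    HasDerivAt (fun t : ℂ => eval v (pull (NormedSpace.exp (t • A)) ω j))
      (eval v (pull (NormedSpace.exp (t • A)) (lieDer A ω) j)) t := by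
  have hw : ∀ k, HasDerivAt
      (fun s : ℂ => (NormedSpace.exp (s • A) : Matrix (Fin 3) (Fin 3) ℂ).mulVec v k)
      (∑ l, A k l * (NormedSpace.exp (t • A) : Matrix (Fin 3) (Fin 3) ℂ).mulVec v l) t := by
    intro k
    have := HasDerivAt.fun_sum (u := Finset.univ)
      (fun l _ => (hasDerivAt_exp_entry A t k l).mul_const (v l))
    simp only [Matrix.mulVec, dotProduct]
    refine this.congr_deriv ?_
    simp only [Matrix.mul_apply, Fin.sum_univ_three]
    ring
  have := HasDerivAt.fun_sum (u := Finset.univ)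
    (fun i _ => (hasDerivAt_exp_entry A t i j).mul (hasDerivAt_eval hw (ω i)))
  simp only [pull, map_sum, map_mul, eval_C, eval_subst]
  refine this.congr_deriv ?_
  simp only [lieDer, Matrix.mul_apply, Fin.sum_univ_three, map_add, map_mul, eval_C]
  ring

theorem expGL_inv (A : Matrix (Fin 3) (Fin 3) ℂ) : (expGL A)⁻¹.val = NormedSpace.exp (-A) := rfl

theorem Foliation.exists_eq_mk {N : ℕ} (F : Foliation N) :
    ∃ (ω : Form N) (h : NoCommonFactor (ω : PolyForm)), F = Foliation.mk ω h := by
  obtain ⟨p, hp⟩ := F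
  exact ⟨p.rep, hp, Subtype.ext p.mk_rep.symm⟩

/-- Infinitesimal characterization of the symmetries. -/
theorem isSymmetry_iff {N : ℕ} (ω : Form N) (h : NoCommonFactor (ω : PolyForm))
    (A : Matrix (Fin 3) (Fin 3) ℂ) :
    IsSymmetry (Foliation.mk ω h) A ↔ ∃ c : ℂ, lieDer A ω = c • (ω : PolyForm) := by
  have h0 : IsSymmetry (Foliation.mk ω h) A ↔
      ∀ t : ℂ, ∃ c : ℂ, pull (NormedSpace.exp (t • A)) ω = c • (ω : PolyForm) := by
    simp only [IsSymmetry, Iso, MulAction.mem_stabilizer_iff, mk_smul_eq_iff, expGL_inv]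
    refine ⟨fun H t => ?_, fun H t => ?_⟩
    · simpa using H (-t)
    · simpa using H (-t)
  have e0 : ∀ η : PolyForm, pull (NormedSpace.exp ((0 : ℂ) • A)) η = η := by
    intro η
    rw [zero_smul, NormedSpace.exp_zero, pull_one]
  rw [h0]
  constructor
  · intro H
    obtain ⟨i, hi⟩ : ∃ i, (ω : PolyForm) i ≠ 0 := by
      by_contra! hz
      exact not_isUnit_zero (h 0 fun i => by rw [hz i])
    obtain ⟨u, hu⟩ : ∃ u, eval u ((ω : PolyForm) i) ≠ 0 := by
      by_contra! hz
      exact hi (MvPolynomial.funext fun u => by rw [hz u, map_zero])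
    refine ⟨eval u (lieDer A ω i) / eval u ((ω : PolyForm) i), ?_⟩
    funext j
    refine MvPolynomial.funext fun v => ?_
    have d1 := (hasDerivAt_pull A ω v j 0).mul_const (eval u ((ω : PolyForm) i))
    have d2 := (hasDerivAt_pull A ω u i 0).mul_const (eval v ((ω : PolyForm) j))
    have hfun : (fun t : ℂ => eval v (pull (NormedSpace.exp (t • A)) ω j) *
          eval u ((ω : PolyForm) i)) =
        fun t : ℂ => eval u (pull (NormedSpace.exp (t • A)) ω i) * eval v ((ω : PolyForm) j) := by
      funext t
      obtain ⟨c, hc⟩ := H t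
      rw [hc]
      simp only [Pi.smul_apply, smul_eval]
      ring
    rw [hfun] at d1
    have := d1.unique d2
    rw [e0] at this
    rw [Pi.smul_apply, smul_eval, div_mul_eq_mul_div, eq_div_iff hu, this]
  · rintro ⟨c, hc⟩ t
    refine ⟨Complex.exp (c * t), ?_⟩
    funext j
    refine MvPolynomial.funext fun v => ?_
    have d : ∀ s : ℂ, HasDerivAt (fun s : ℂ => eval v (pull (NormedSpace.exp (s • A)) ω j) *
        Complex.exp (-(c * s))) 0 s := by
      intro s
      have h1 := hasDerivAt_pull A ω v j s
      rw [hc, pull_smul, Pi.smul_apply, smul_eval] at h1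
      have h2 : HasDerivAt (fun s : ℂ => Complex.exp (-(c * s)))
          (Complex.exp (-(c * s)) * (-(c * 1))) s :=
        (((hasDerivAt_id s).const_mul c).neg).cexp
      exact (h1.mul h2).congr_deriv (by ring)
    have hconst := is_const_of_deriv_eq_zero (fun s => (d s).differentiableAt)
      (fun s => (d s).deriv) t 0
    simp only [e0, mul_zero, neg_zero, Complex.exp_zero, mul_one] at hconst
    rw [Pi.smul_apply, smul_eval, ← hconst, mul_comm, mul_assoc, ← Complex.exp_add]
    simp

/-- The Lie algebra `𝔦𝔰𝔬(F)` of the isotropy group: the symmetries of `F` in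
`𝔰𝔩(3, ℂ)`, the Lie algebra of `PGL(3, ℂ)`. -/
def isoAlgebra {N : ℕ} (F : Foliation N) :
    LieSubalgebra ℂ (LieAlgebra.SpecialLinear.sl (Fin 3) ℂ) where
  carrier := {A | IsSymmetry F A.val}
  zero_mem' := by
    obtain ⟨ω, h, rfl⟩ := F.exists_eq_mk
    refine (isSymmetry_iff ω h _).mpr ⟨0, ?_⟩
    have := linDer_smul 0 0
    funext j
    simp only [zero_smul] at this
    simp [lieDer, this]
  add_mem' := by
    obtain ⟨ω, h, rfl⟩ := F.exists_eq_mk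
    intro A B hA hB
    obtain ⟨a, ha⟩ := (isSymmetry_iff ω h _).mp hA
    obtain ⟨b, hb⟩ := (isSymmetry_iff ω h _).mp hB
    refine (isSymmetry_iff ω h _).mpr ⟨a + b, ?_⟩
    rw [add_smul, ← ha, ← hb]
    funext j
    simp [lieDer, linDer_add, add_mul, Finset.sum_add_distrib]
    ring
  smul_mem' := by
    obtain ⟨ω, h, rfl⟩ := F.exists_eq_mk
    intro c A hA
    obtain ⟨a, ha⟩ := (isSymmetry_iff ω h _).mp hA
    refine (isSymmetry_iff ω h _).mpr ⟨c * a, ?_⟩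
    rw [mul_smul, ← ha]
    funext j
    simp [lieDer, linDer_smul, Finset.smul_sum, smul_eq_C_mul, mul_assoc]
  lie_mem' := by
    obtain ⟨ω, h, rfl⟩ := F.exists_eq_mk
    intro A B hA hB
    obtain ⟨a, ha⟩ := (isSymmetry_iff ω h _).mp hA
    obtain ⟨b, hb⟩ := (isSymmetry_iff ω h _).mp hB
    refine (isSymmetry_iff ω h _).mpr ⟨0, ?_⟩
    change lieDer ⁅A.val, B.val⁆ ω = _
    rw [lieDer_lie, ha, hb, lieDer_smul_right, lieDer_smul_right, ha, hb, smul_comm, sub_self,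
      zero_smul]

/-! ### Dimension of a subset of a projective space -/

section Dimension

variable {V : Type*} [AddCommGroup V] [Module ℂ V]

/-- The affine cone (without its vertex) over a subset of a projective space. -/
def cone (S : Set (ℙ ℂ V)) : Set V := {v | ∃ h : v ≠ 0, Projectivization.mk ℂ v h ∈ S}

/-- The homogeneous coordinate ring of (the Zariski closure of) a subset of a projective space:
the ring of functions on its cone generated by the linear forms. -/
def coordRing (S : Set (ℙ ℂ V)) : Subalgebra ℂ (cone S → ℂ) :=
  Algebra.adjoin ℂ (Set.range fun (f : Module.Dual ℂ V) (v : cone S) => f v)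

/-- `S` has dimension `d` as an algebraic variety: its homogeneous coordinate ring has
transcendence degree `d + 1`. -/
def HasDim (S : Set (ℙ ℂ V)) (d : ℕ) : Prop := Algebra.trdeg ℂ (coordRing S) = d + 1

end Dimension

/-- The orbit `𝒪(F)`, as a locally closed subvariety of the projective space of forms, has
dimension `d`. -/
def OrbitHasDim {N : ℕ} (F : Foliation N) (d : ℕ) : Prop :=
  HasDim ((fun G : Foliation N => G.1) '' Orbit F) d

/-! ### The two models -/

/-- The form `dX`, `dY` or `dZ`. -/
def dX (i : Fin 3) : PolyForm := Pi.single i 1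

/-- `X² (Z dX - X dZ) + Y² (X dY - Y dX)`, whose expression in the affine chart `Z = 1` is
`x² dx + y² (x dy - y dx)`. -/
def form₁ : PolyForm :=
  (X 0 ^ 2 : MvPolynomial (Fin 3) ℂ) • ((X 2 : MvPolynomial (Fin 3) ℂ) • dX 0
      - (X 0 : MvPolynomial (Fin 3) ℂ) • dX 2)
    + (X 1 ^ 2 : MvPolynomial (Fin 3) ℂ) • ((X 0 : MvPolynomial (Fin 3) ℂ) • dX 1
      - (X 1 : MvPolynomial (Fin 3) ℂ) • dX 0)

/-- `X² (Z dY - Y dZ) + Y² (X dY - Y dX)`, whose expression in the affine chart `Z = 1` is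
`x² dy + y² (x dy - y dx)`. -/
def form₅ : PolyForm :=
  (X 0 ^ 2 : MvPolynomial (Fin 3) ℂ) • ((X 2 : MvPolynomial (Fin 3) ℂ) • dX 1
      - (X 1 : MvPolynomial (Fin 3) ℂ) • dX 2)
    + (X 1 ^ 2 : MvPolynomial (Fin 3) ℂ) • ((X 0 : MvPolynomial (Fin 3) ℂ) • dX 1
      - (X 1 : MvPolynomial (Fin 3) ℂ) • dX 0)

theorem form₁_eq : form₁ = ![X 0 ^ 2 * X 2 - X 1 ^ 3, X 0 * X 1 ^ 2, - X 0 ^ 3] := by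
  funext i
  fin_cases i <;> simp [form₁, dX] <;> ring

theorem form₅_eq : form₅ = ![- X 1 ^ 3, X 0 ^ 2 * X 2 + X 0 * X 1 ^ 2, - (X 0 ^ 2 * X 1)] := by
  funext i
  fin_cases i <;> simp [form₅, dX] <;> ring

theorem isHomogeneous_X_pow (i : Fin 3) (n : ℕ) :
    (X i ^ n : MvPolynomial (Fin 3) ℂ).IsHomogeneous n := by
  simpa using (isHomogeneous_X ℂ i).pow n

theorem form₁_mem : form₁ ∈ Form 2 := by
  rw [form₁_eq]
  refine ⟨fun i => ?_, by simp [Fin.sum_univ_three]; ring⟩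
  fin_cases i
  · exact ((isHomogeneous_X_pow 0 2).mul (isHomogeneous_X ℂ 2)).sub (isHomogeneous_X_pow 1 3)
  · exact (isHomogeneous_X ℂ 0).mul (isHomogeneous_X_pow 1 2)
  · exact (isHomogeneous_X_pow 0 3).neg

theorem form₅_mem : form₅ ∈ Form 2 := by
  rw [form₅_eq]
  refine ⟨fun i => ?_, by simp [Fin.sum_univ_three]; ring⟩
  fin_cases i
  · exact (isHomogeneous_X_pow 1 3).neg
  · exact ((isHomogeneous_X_pow 0 2).mul (isHomogeneous_X ℂ 2)).add
      ((isHomogeneous_X ℂ 0).mul (isHomogeneous_X_pow 1 2))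
  · exact ((isHomogeneous_X_pow 0 2).mul (isHomogeneous_X ℂ 1)).neg

/-- A divisor of `X i ^ n` and of a polynomial not divisible by `X i` is a unit. -/
theorem isUnit_of_dvd {d p : MvPolynomial (Fin 3) ℂ} {i : Fin 3} {n : ℕ} (h1 : d ∣ X i ^ n)
    (h2 : d ∣ p) (h3 : ¬ X i ∣ p) : IsUnit d := by
  obtain ⟨m, -, hm⟩ := (dvd_prime_pow (X_prime (R := ℂ) (i := i)) n).mp h1
  rcases Nat.eq_zero_or_pos m with rfl | hpos
  · simpa using hm.isUnit_iff.mpr (by simp)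
  · exact absurd (((dvd_pow_self _ hpos.ne').trans hm.symm.dvd).trans h2) h3

theorem not_X_dvd {p : MvPolynomial (Fin 3) ℂ} {i : Fin 3} (v : Fin 3 → ℂ) (hv : v i = 0)
    (hp : eval v p ≠ 0) : ¬ X i ∣ p := by
  rintro ⟨q, rfl⟩
  simp [hv] at hp

theorem form₁_noCommonFactor : NoCommonFactor form₁ := by
  intro d hd
  rw [form₁_eq] at hd
  refine isUnit_of_dvd (i := 0) (n := 3) (dvd_neg.mp (hd 2)) (hd 0) (not_X_dvd ![0, 1, 0] rfl ?_)
  simp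

theorem form₅_noCommonFactor : NoCommonFactor form₅ := by
  intro d hd
  rw [form₅_eq] at hd
  refine isUnit_of_dvd (i := 1) (n := 3) (dvd_neg.mp (hd 0)) (hd 1) (not_X_dvd ![1, 0, 1] rfl ?_)
  simp

/-- The foliation `ℱ₁`. -/
def F₁ : Foliation 2 := Foliation.mk ⟨form₁, form₁_mem⟩ form₁_noCommonFactor

/-- The foliation `ℱ₅`. -/
def F₅ : Foliation 2 := Foliation.mk ⟨form₅, form₅_mem⟩ form₅_noCommonFactor

/-- The automorphism of `ℙ²(ℂ)` with an invertible matrix. -/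
def aut (A : Matrix (Fin 3) (Fin 3) ℂ) (h : A.det ≠ 0) : PGL(3, ℂ) :=
  Matrix.ProjGenLinGroup.mk (Matrix.GeneralLinearGroup.mkOfDetNeZero A h)

/-- The automorphism `(X : Y : Z) ↦ (a X : b Y : Z)`, that is `(x, y) ↦ (a x, b y)`. -/
def diagAut (a b : ℂˣ) : PGL(3, ℂ) :=
  aut !![a.val, 0, 0; 0, b.val, 0; 0, 0, 1] (by simp [Matrix.det_fin_three])

/-- The automorphism `(X : Y : Z) ↦ (X : Y : Z + β X)`, that is
`(x, y) ↦ (x / (1 + β x), y / (1 + β x))`. -/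
def shearX (β : ℂ) : PGL(3, ℂ) :=
  aut !![1, 0, 0; 0, 1, 0; β, 0, 1] (by simp [Matrix.det_fin_three])

/-- The automorphism `(X : Y : Z) ↦ (X : Y : Z + β Y)`, that is
`(x, y) ↦ (x / (1 + β y), y / (1 + β y))`. -/
def shearY (β : ℂ) : PGL(3, ℂ) :=
  aut !![1, 0, 0; 0, 1, 0; 0, β, 1] (by simp [Matrix.det_fin_three])

end P2Foliation

end

/-! Write L_B for the Lie derivative along the linear field of B. Since L_1 ω = 4 ω, a symmetry A
with L_A ω = c ω becomes, after subtraction of c/4, a matrix that kills ω. So the isotropy algebra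
may be replaced by the annihilator of ω in 𝔤𝔩(3, ℂ). Scalar matrices multiply forms by all nonzero
constants, hence the cone over an orbit is the GL(3)-orbit of ω, and its dimension is 9 minus that
of the annihilator. Orbits of dimension 6 thus correspond to annihilators of dimension 2.

Classification (`classification`). An annihilator of dimension at least 2 contains a nonzero
nilpotent matrix or two independent commuting ones. A commuting pair either has a combination that
is scalar plus nilpotent, and the scalar then vanishes because this combination acts on forms with
4c as only eigenvalue, or it is simultaneously diagonalizable. The diagonal case is impossible
(`not_diagonal_pair`): all monomials of ω would have one common weight, and a coordinate would
divide ω. A regular nilpotent leaves an annihilator of dimension at most 1. A nilpotent of square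
zero makes ω equal to q (Z dX - X dZ) + s (X dY - Y dX) with q, s binary quadratic forms in X, Y; a
further symmetry forces q to have a double root (`binaryForm_cases`), and the position of this root,
together with the shape of s, leads to one of the two models.

Dimension. The map A ↦ A^* ω has differential B ↦ L_B ω at the identity, so by submersivity the
coordinate ring of the cone has at least 9 - dim (annihilator) algebraically independent elements.
For the two models the stabilizer brings a general matrix to a normal form with 7 free entries, so
the transcendence degree is at most 7.

Isotropy. An automorphism preserving the foliation normalizes the annihilator, which is spanned by a
nilpotent and by diag(-3, 1, 9), respectively diag(-3, 1, 5). This fixes the shape of its matrix.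
Characteristic polynomials show that the two groups are not conjugate, so the orbits differ.

Closedness. The ratio tr(B²) : (tr B)² is 13 : 7 on the first annihilator and 35 : 9 on the second,
wherever it is defined. Being killed by a plane of matrices on which the corresponding quadratic
form vanishes is a closed condition, since planes form a compact family. By the classification it
cuts out exactly one of the two orbits. -/

namespace P2Foliation

noncomputable section

/-! ### Coordinates on the space of quadratic foliations -/

/-- The cubic form in three variables with prescribed coefficients. -/
def cubic (c : Fin 10 → ℂ) : MvPolynomial (Fin 3) ℂ :=
  C (c 0) * X 0 ^ 3 + C (c 1) * X 0 ^ 2 * X 1 + C (c 2) * X 0 ^ 2 * X 2 + C (c 3) * X 0 * X 1 ^ 2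
    + C (c 4) * X 0 * X 1 * X 2 + C (c 5) * X 0 * X 2 ^ 2 + C (c 6) * X 1 ^ 3
    + C (c 7) * X 1 ^ 2 * X 2 + C (c 8) * X 1 * X 2 ^ 2 + C (c 9) * X 2 ^ 3

theorem monomial_fin_three (m : Fin 3 →₀ ℕ) (c : ℂ) :
    monomial m c = C c * X 0 ^ m 0 * X 1 ^ m 1 * X 2 ^ m 2 := by
  rw [monomial_eq, Finsupp.prod_fintype _ _ fun _ => pow_zero _, Fin.prod_univ_three]
  ring

theorem exists_eq_cubic {p : MvPolynomial (Fin 3) ℂ} (hp : p.IsHomogeneous 3) :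
    ∃ c, p = cubic c := by
  have key : ∀ m : Fin 3 →₀ ℕ, m.degree = 3 → ∀ a : ℂ, ∃ c, monomial m a = cubic c := by
    intro m hm a
    rw [Finsupp.degree_eq_sum, Fin.sum_univ_three] at hm
    have h0 : m 0 ≤ 3 := by omega
    have h1 : m 1 ≤ 3 := by omega
    have h2 : m 2 ≤ 3 := by omega
    rw [monomial_fin_three]
    generalize m 0 = i at *
    generalize m 1 = j at *
    generalize m 2 = k at *
    interval_cases i <;> interval_cases j <;> interval_cases k <;> first | omega | skip
    all_goals first
      | (refine ⟨Pi.single 0 a, ?_⟩; simp [cubic]; done)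
      | (refine ⟨Pi.single 1 a, ?_⟩; simp [cubic]; done)
      | (refine ⟨Pi.single 2 a, ?_⟩; simp [cubic]; done)
      | (refine ⟨Pi.single 3 a, ?_⟩; simp [cubic]; done)
      | (refine ⟨Pi.single 4 a, ?_⟩; simp [cubic]; done)
      | (refine ⟨Pi.single 5 a, ?_⟩; simp [cubic]; done)
      | (refine ⟨Pi.single 6 a, ?_⟩; simp [cubic]; done)
      | (refine ⟨Pi.single 7 a, ?_⟩; simp [cubic]; done)
      | (refine ⟨Pi.single 8 a, ?_⟩; simp [cubic]; done)
      | (refine ⟨Pi.single 9 a, ?_⟩; simp [cubic])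
  rw [p.as_sum]
  have : ∀ s ⊆ p.support, ∃ c, ∑ m ∈ s, monomial m (coeff m p) = cubic c := by
    intro s
    induction s using Finset.induction_on with
    | empty => exact fun _ => ⟨0, by simp [cubic]⟩
    | insert m s hm ih =>
      intro hs
      obtain ⟨c, hc⟩ := ih ((Finset.subset_insert _ _).trans hs)
      have hd : m.degree = 3 := by
        by_contra hne
        exact (mem_support_iff.mp (hs (Finset.mem_insert_self _ _))) (hp.coeff_eq_zero hne)
      obtain ⟨c', hc'⟩ := key m hd (coeff m p)
      refine ⟨c' + c, ?_⟩
      rw [Finset.sum_insert hm, hc, hc']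
      simp only [cubic, Pi.add_apply, map_add]
      ring
  exact this _ subset_rfl

/-- A cubic form which vanishes everywhere is zero. -/
theorem cubic_coeff_eq_zero {c : Fin 10 → ℂ} (h : cubic c = 0) : ∀ i, c i = 0 := by
  have e : ∀ x y z : ℂ, c 0 * x ^ 3 + c 1 * x ^ 2 * y + c 2 * x ^ 2 * z + c 3 * x * y ^ 2
      + c 4 * x * y * z + c 5 * x * z ^ 2 + c 6 * y ^ 3 + c 7 * y ^ 2 * z + c 8 * y * z ^ 2
      + c 9 * z ^ 3 = 0 := by
    intro x y z
    have := congrArg (eval ![x, y, z]) h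
    simpa [cubic] using this
  have h0 := e 1 0 0
  have h6 := e 0 1 0
  have h9 := e 0 0 1
  have a1 := e 1 1 0
  have a2 := e 1 (-1) 0
  have b1 := e 1 0 1
  have b2 := e 1 0 (-1)
  have c1 := e 0 1 1
  have c2 := e 0 1 (-1)
  have d := e 1 1 1
  norm_num at h0 h6 h9 a1 a2 b1 b2 c1 c2 d
  have g1 : c 1 = 0 := by linear_combination (a1 - a2) / 2 - h6
  have g3 : c 3 = 0 := by linear_combination (a1 + a2) / 2 - h0
  have g2 : c 2 = 0 := by linear_combination (b1 - b2) / 2 - h9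
  have g5 : c 5 = 0 := by linear_combination (b1 + b2) / 2 - h0
  have g7 : c 7 = 0 := by linear_combination (c1 - c2) / 2 - h9
  have g8 : c 8 = 0 := by linear_combination (c1 + c2) / 2 - h6
  have g4 : c 4 = 0 := by
    linear_combination d - h0 - h6 - h9 - g1 - g2 - g3 - g5 - g7 - g8
  intro i
  fin_cases i <;> assumption

/-- The form `U (Y dZ - Z dY) + V (Z dX - X dZ) + W (X dY - Y dX)`, where `U` is a binary
quadratic form in `Y`, `Z` and `V`, `W` are ternary quadratic forms. -/
def quadForm (u : Fin 3 → ℂ) (v w : Fin 6 → ℂ) : PolyForm :=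
  let U : MvPolynomial (Fin 3) ℂ := C (u 0) * X 1 ^ 2 + C (u 1) * X 1 * X 2 + C (u 2) * X 2 ^ 2
  let Q (q : Fin 6 → ℂ) : MvPolynomial (Fin 3) ℂ := C (q 0) * X 0 ^ 2 + C (q 1) * X 0 * X 1
    + C (q 2) * X 0 * X 2 + C (q 3) * X 1 ^ 2 + C (q 4) * X 1 * X 2 + C (q 5) * X 2 ^ 2
  ![Q v * X 2 - Q w * X 1, Q w * X 0 - U * X 2, U * X 1 - Q v * X 0]

/-- Euler's identity makes ω a combination of the three forms Y dZ - Z dY, Z dX - X dZ, X dY - Y dX.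
Their relation with coefficients X, Y, Z permits removing X from the first coefficient, which leaves
3 + 6 + 6 = 15 free parameters. -/
theorem exists_eq_quadForm {ω : PolyForm} (h : ω ∈ Form 2) : ∃ u v w, ω = quadForm u v w := by
  obtain ⟨hh, he⟩ := h
  obtain ⟨b, hb⟩ := exists_eq_cubic (hh 1)
  obtain ⟨c, hc⟩ := exists_eq_cubic (hh 2)
  rw [Fin.sum_univ_three] at he
  -- On the line X = 0 Euler's identity involves only the last two coefficients. It is a binary
  -- quartic, and its five coefficients are recovered from five values.
  have e : ∀ y z : ℂ, (b 6 * y ^ 3 + b 7 * y ^ 2 * z + b 8 * y * z ^ 2 + b 9 * z ^ 3) * y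
      + (c 6 * y ^ 3 + c 7 * y ^ 2 * z + c 8 * y * z ^ 2 + c 9 * z ^ 3) * z = 0 := by
    intro y z
    have := congrArg (eval ![0, y, z]) he
    simpa [cubic, hb, hc] using this
  have h0 := e 1 0
  have h1 := e 0 1
  have h2 := e 1 1
  have h3 := e 1 (-1)
  have h4 := e 1 2
  norm_num at h0 h1 h2 h3 h4
  have k1 : b 8 + c 7 = 0 := by linear_combination (h2 + h3) / 2 - h0 - h1
  have k2 : b 9 + c 8 = 0 := by
    linear_combination (h4 - h0 - 16 * h1 - 4 * k1) / 6 - (h2 - h3) / 6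
  have k3 : b 7 + c 6 = 0 := by linear_combination (h2 - h3) / 2 - k2
  have hb' : b = ![b 0, b 1, b 2, b 3, b 4, b 5, 0, - c 6, - c 7, - c 8] := by
    funext i
    fin_cases i <;> simp [h0]
    · linear_combination k3
    · linear_combination k1
    · linear_combination k2
  have hc' : c = ![c 0, c 1, c 2, c 3, c 4, c 5, c 6, c 7, c 8, 0] := by
    funext i
    fin_cases i <;> simp [h1]
  have key : ω 1 = quadForm ![c 6, c 7, c 8] ![- c 0, - c 1, - c 2, - c 3, - c 4, - c 5]
        ![b 0, b 1, b 2, b 3, b 4, b 5] 1 ∧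
      ω 2 = quadForm ![c 6, c 7, c 8] ![- c 0, - c 1, - c 2, - c 3, - c 4, - c 5]
        ![b 0, b 1, b 2, b 3, b 4, b 5] 2 := by
    constructor
    · rw [hb, hb']
      simp [quadForm, cubic]
      ring
    · rw [hc, hc']
      simp [quadForm, cubic]
      ring
  refine ⟨![c 6, c 7, c 8], ![- c 0, - c 1, - c 2, - c 3, - c 4, - c 5],
    ![b 0, b 1, b 2, b 3, b 4, b 5], funext fun i => ?_⟩
  fin_cases i
  -- The coefficient of dX is determined by the other two: Euler's identity gives its product with
  -- X.
  · refine mul_right_cancel₀ (X_ne_zero (0 : Fin 3)) ?_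
    rw [key.1, key.2] at he
    simp only [quadForm] at he ⊢
    simp at he
    simp only [Fin.zero_eta, Fin.isValue, Matrix.cons_val, map_neg]
    linear_combination he
  · exact key.1
  · exact key.2

theorem quadForm_coeff_eq_zero {u : Fin 3 → ℂ} {v w : Fin 6 → ℂ} (h : quadForm u v w = 0) :
    (∀ i, u i = 0) ∧ (∀ i, v i = 0) ∧ ∀ i, w i = 0 := by
  have h1 := congrFun h 1
  have h2 := congrFun h 2
  have e1 : quadForm u v w 1
      = cubic ![w 0, w 1, w 2, w 3, w 4, w 5, 0, - u 0, - u 1, - u 2] := by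
    simp [quadForm, cubic]
    ring
  have e2 : quadForm u v w 2
      = cubic ![- v 0, - v 1, - v 2, - v 3, - v 4, - v 5, u 0, u 1, u 2, 0] := by
    simp [quadForm, cubic]
    ring
  have c1 := cubic_coeff_eq_zero (e1.symm.trans h1)
  have c2 := cubic_coeff_eq_zero (e2.symm.trans h2)
  refine ⟨fun i => ?_, fun i => ?_, fun i => ?_⟩
  · fin_cases i
    · exact c2 6
    · exact c2 7
    · exact c2 8
  · fin_cases i
    · exact neg_eq_zero.mp (c2 0)
    · exact neg_eq_zero.mp (c2 1)
    · exact neg_eq_zero.mp (c2 2)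
    · exact neg_eq_zero.mp (c2 3)
    · exact neg_eq_zero.mp (c2 4)
    · exact neg_eq_zero.mp (c2 5)
  · fin_cases i
    · exact c1 0
    · exact c1 1
    · exact c1 2
    · exact c1 3
    · exact c1 4
    · exact c1 5

/-- This turns L_B ω = 0 into fifteen scalar equations, bilinear in B and in the coordinates of ω.
All computations of annihilators below start from them. -/
theorem lieDer_quadForm (B : Matrix (Fin 3) (Fin 3) ℂ) (u : Fin 3 → ℂ) (v w : Fin 6 → ℂ) :
    lieDer B (quadForm u v w) = quadForm
      ![- B 0 2 * w 3 + B 2 2 * u 0 - B 0 1 * v 3 + 3 * B 1 1 * u 0 + B 2 1 * u 1,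
        - B 0 2 * w 4 + 2 * B 1 2 * u 0 + 2 * B 2 2 * u 1 - B 0 1 * v 4 + 2 * B 1 1 * u 1 + 2 * B 2 1 * u 2,
        - B 0 2 * w 5 + B 1 2 * u 1 + 3 * B 2 2 * u 2 - B 0 1 * v 5 + B 1 1 * u 2]
      ![- B 1 2 * w 0 + B 2 2 * v 0 + 3 * B 0 0 * v 0 + B 1 0 * v 1 + B 2 0 * v 2,
        B 0 2 * w 0 - B 1 2 * w 1 + B 2 2 * v 1 + 2 * B 0 0 * v 1 + 3 * B 0 1 * v 0 + 2 * B 1 0 * v 3 + B 1 1 * v 1 + B 2 0 * v 4 + B 2 1 * v 2,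
        2 * B 0 2 * v 0 - B 1 2 * w 2 + 2 * B 2 2 * v 2 + 2 * B 0 0 * v 2 + B 1 0 * v 4 + B 1 2 * v 1 + 2 * B 2 0 * v 5,
        B 0 2 * w 1 - B 1 2 * w 3 + B 2 2 * v 3 + B 0 0 * v 3 + 2 * B 0 1 * v 1 - 3 * B 1 0 * u 0 + 2 * B 1 1 * v 3 - B 2 0 * u 1 + B 2 1 * v 4,
        B 0 2 * v 1 + B 0 2 * w 2 - B 1 2 * w 4 + 2 * B 2 2 * v 4 + B 0 0 * v 4 + 2 * B 0 1 * v 2 - 2 * B 1 0 * u 1 + B 1 1 * v 4 + 2 * B 1 2 * v 3 - 2 * B 2 0 * u 2 + 2 * B 2 1 * v 5,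
        B 0 2 * v 2 - B 1 2 * w 5 + 3 * B 2 2 * v 5 + B 0 0 * v 5 - B 1 0 * u 2 + B 1 2 * v 4]
      ![B 1 1 * w 0 - B 2 1 * v 0 + 3 * B 0 0 * w 0 + B 1 0 * w 1 + B 2 0 * w 2,
        2 * B 0 1 * w 0 + 2 * B 1 1 * w 1 - B 2 1 * v 1 + 2 * B 0 0 * w 1 + 2 * B 1 0 * w 3 + B 2 0 * w 4 + B 2 1 * w 2,
        B 0 1 * v 0 + B 1 1 * w 2 - B 2 1 * v 2 + 2 * B 0 0 * w 2 + 3 * B 0 2 * w 0 + B 1 0 * w 4 + B 1 2 * w 1 + 2 * B 2 0 * w 5 + B 2 2 * w 2,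
        B 0 1 * w 1 + 3 * B 1 1 * w 3 - B 2 1 * v 3 + B 0 0 * w 3 - B 2 0 * u 0 + B 2 1 * w 4,
        B 0 1 * v 1 + B 0 1 * w 2 + 2 * B 1 1 * w 4 - B 2 1 * v 4 + B 0 0 * w 4 + 2 * B 0 2 * w 1 - 2 * B 1 0 * u 0 + 2 * B 1 2 * w 3 - 2 * B 2 0 * u 1 + 2 * B 2 1 * w 5 + B 2 2 * w 4,
        B 0 1 * v 2 + B 1 1 * w 5 - B 2 1 * v 5 + B 0 0 * w 5 + 2 * B 0 2 * w 2 - B 1 0 * u 1 + B 1 2 * w 4 - 3 * B 2 0 * u 2 + 2 * B 2 2 * w 5] := by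
  have hC : ∀ c : ℂ, linDer B (C c) = 0 := fun c => (linDer B).map_algebraMap c
  have h2 : (C 2 : MvPolynomial (Fin 3) ℂ) = 2 := map_ofNat C 2
  have h3 : (C 3 : MvPolynomial (Fin 3) ℂ) = 3 := map_ofNat C 3
  funext j
  fin_cases j
  all_goals
    simp [lieDer, quadForm, h2, h3, Fin.sum_univ_three, Derivation.leibniz, Derivation.leibniz_pow,
      linDer_X, hC]
    ring

/-! ### The annihilator of a form in `𝔤𝔩(3, ℂ)` -/

/-- The relation P A = B P says that P carries the linear field of A to that of B, so substitution
by P intertwines the two derivations. By the Leibniz rule it suffices to check the variables. -/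
theorem linDer_subst {A B P : Matrix (Fin 3) (Fin 3) ℂ} (h : P * A = B * P)
    (p : MvPolynomial (Fin 3) ℂ) : linDer A (subst P p) = subst P (linDer B p) := by
  induction p using MvPolynomial.induction_on with
  | C a =>
    rw [subst_C, show linDer A (C a) = 0 from (linDer A).map_algebraMap a,
      show linDer B (C a) = 0 from (linDer B).map_algebraMap a, map_zero]
  | add p q hp hq => simp only [map_add, hp, hq]
  | mul_X p k hp =>
    have hX : linDer A (subst P (X k)) = subst P (linDer B (X k)) := by
      have e : ∀ l, ∑ m, P k m * A m l = ∑ m, B k m * P m l := fun l => by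
        simpa [Matrix.mul_apply] using congrFun (congrFun h k) l
      have e' : ∀ l, ∑ m, C (P k m) * C (A m l) = (∑ m, C (B k m) * C (P m l) :
          MvPolynomial (Fin 3) ℂ) := fun l => by
        simpa using congrArg (C : ℂ → MvPolynomial (Fin 3) ℂ) (e l)
      have e0 := e' 0
      have e1 := e' 1
      have e2 := e' 2
      simp only [Fin.sum_univ_three] at e0 e1 e2
      simp only [subst_X, linDer_X, map_add, linDer_C_mul, map_mul, subst_C, Fin.sum_univ_three]
      linear_combination X 0 * e0 + X 1 * e1 + X 2 * e2
    rw [map_mul, Derivation.leibniz, hp, hX, Derivation.leibniz]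
    simp only [smul_eq_mul, map_add, map_mul]

theorem lieDer_pull {A B P : Matrix (Fin 3) (Fin 3) ℂ} (h : P * A = B * P) (ω : PolyForm) :
    lieDer A (pull P ω) = pull P (lieDer B ω) := by
  have e : ∀ i j, (∑ m, C (P i m) * C (A m j) : MvPolynomial (Fin 3) ℂ)
      = ∑ m, C (B i m) * C (P m j) := fun i j => by
    simpa [Matrix.mul_apply] using
      congrArg (C : ℂ → MvPolynomial (Fin 3) ℂ) (congrFun (congrFun h i) j)
  funext j
  have e0 := e 0 j
  have e1 := e 1 j
  have e2 := e 2 j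
  simp only [lieDer, pull, linDer_C_mul, linDer_subst h, map_add, map_mul, subst_C,
    Fin.sum_univ_three] at e0 e1 e2 ⊢
  linear_combination subst P (ω 0) * e0 + subst P (ω 1) * e1 + subst P (ω 2) * e2

theorem lieDer_add_left (A B : Matrix (Fin 3) (Fin 3) ℂ) (ω : PolyForm) :
    lieDer (A + B) ω = lieDer A ω + lieDer B ω := by
  funext j
  simp [lieDer, linDer_add, add_mul, Finset.sum_add_distrib]
  ring

theorem lieDer_smul_left (c : ℂ) (A : Matrix (Fin 3) (Fin 3) ℂ) (ω : PolyForm) :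
    lieDer (c • A) ω = c • lieDer A ω := by
  funext j
  simp [lieDer, linDer_smul, Finset.smul_sum, smul_eq_C_mul, mul_assoc]

theorem lieDer_zero_right (A : Matrix (Fin 3) (Fin 3) ℂ) : lieDer A 0 = 0 := by
  funext j
  simp [lieDer]

/-- The annihilator of a form in `𝔤𝔩(3, ℂ)`. -/
def annihilator (ω : PolyForm) : Submodule ℂ (Matrix (Fin 3) (Fin 3) ℂ) where
  carrier := {B | lieDer B ω = 0}
  zero_mem' := by simpa using lieDer_smul_left 0 0 ω
  add_mem' {A B} hA hB := by
    change lieDer (A + B) ω = 0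
    rw [lieDer_add_left, hA, hB, add_zero]
  smul_mem' c A hA := by
    change lieDer (c • A) ω = 0
    rw [lieDer_smul_left, hA, smul_zero]

theorem mem_annihilator {ω : PolyForm} {B : Matrix (Fin 3) (Fin 3) ℂ} :
    B ∈ annihilator ω ↔ lieDer B ω = 0 := Iff.rfl

theorem commutator_mem_annihilator {ω : PolyForm} {A B : Matrix (Fin 3) (Fin 3) ℂ}
    (hA : A ∈ annihilator ω) (hB : B ∈ annihilator ω) : A * B - B * A ∈ annihilator ω := by
  rw [mem_annihilator] at *
  rw [← Ring.lie_def, lieDer_lie, hA, hB, lieDer_zero_right, lieDer_zero_right, sub_zero]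

theorem mem_annihilator_pull {ω : PolyForm} {A B P : Matrix (Fin 3) (Fin 3) ℂ}
    (h : P * A = B * P) (hB : B ∈ annihilator ω) : A ∈ annihilator (pull P ω) := by
  rw [mem_annihilator] at *
  rw [lieDer_pull h, hB]
  funext j
  simp [pull]

theorem lieDer_one {ω : PolyForm} (h : ω ∈ Form 2) : lieDer 1 ω = (4 : ℂ) • ω := by
  obtain ⟨u, v, w, rfl⟩ := exists_eq_quadForm h
  rw [lieDer_quadForm]
  funext i
  have h4 : (C 4 : MvPolynomial (Fin 3) ℂ) = 4 := map_ofNat C 4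
  have h2 : (C 2 : MvPolynomial (Fin 3) ℂ) = 2 := map_ofNat C 2
  have h3 : (C 3 : MvPolynomial (Fin 3) ℂ) = 3 := map_ofNat C 3
  fin_cases i <;> simp [quadForm, smul_eq_C_mul, h4, h3, h2] <;> ring

/-- The annihilators of equivalent forms have the same dimension. -/
theorem annihilator_pull_finrank_le {ω : PolyForm} {P Q : Matrix (Fin 3) (Fin 3) ℂ}
    (h : P * Q = 1) :
    Module.finrank ℂ (annihilator ω) ≤ Module.finrank ℂ (annihilator (pull P ω)) := by
  have h' : Q * P = 1 := mul_eq_one_comm.mp h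
  let f : annihilator ω →ₗ[ℂ] annihilator (pull P ω) :=
    LinearMap.restrict (LinearMap.mulLeft ℂ Q ∘ₗ LinearMap.mulRight ℂ P) fun B hB =>
      mem_annihilator_pull (B := B) (by
        simp only [LinearMap.comp_apply, LinearMap.mulLeft_apply, LinearMap.mulRight_apply]
        rw [← mul_assoc, h, one_mul]) hB
  refine LinearMap.finrank_le_finrank_of_injective (f := f) ?_
  intro A B hAB
  have e : Q * (A.1 * P) = Q * (B.1 * P) := congrArg Subtype.val hAB
  refine Subtype.ext ?_
  calc A.1 = P * (Q * (A.1 * P)) * Q := by rw [← mul_assoc P, h, one_mul, mul_assoc, h, mul_one]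
    _ = B.1 := by rw [e, ← mul_assoc P, h, one_mul, mul_assoc, h, mul_one]

/-- If L_A ω = c ω and tr A = 0, then A - c/4 kills ω and A is its trace-free part. So the isotropy
algebra embeds in the image of the annihilator under the projection to trace-free matrices. -/
theorem finrank_isoAlgebra_le (ω : Form 2) (h : NoCommonFactor (ω : PolyForm)) :
    Module.finrank ℂ (isoAlgebra (Foliation.mk ω h))
      ≤ Module.finrank ℂ (annihilator (ω : PolyForm)) := by
  let φ : Matrix (Fin 3) (Fin 3) ℂ →ₗ[ℂ] Matrix (Fin 3) (Fin 3) ℂ :=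
    LinearMap.id - ((3 : ℂ)⁻¹ • Matrix.traceLinearMap (Fin 3) ℂ ℂ).smulRight 1
  have hφ : ∀ B, φ B = B - ((3 : ℂ)⁻¹ * B.trace) • 1 := fun B => rfl
  let S : Submodule ℂ (Matrix (Fin 3) (Fin 3) ℂ) := (annihilator (ω : PolyForm)).map φ
  have h1 : Module.finrank ℂ S ≤ Module.finrank ℂ (annihilator (ω : PolyForm)) :=
    Submodule.finrank_map_le φ _
  refine le_trans ?_ h1
  let g : isoAlgebra (Foliation.mk ω h) →ₗ[ℂ] S :=
    { toFun := fun A => ⟨A.1.1, by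
        obtain ⟨c, hc⟩ := (isSymmetry_iff ω h A.1.1).mp A.2
        refine ⟨A.1.1 - (c / 4) • 1, ?_, ?_⟩
        · change lieDer _ _ = 0
          rw [sub_eq_add_neg, ← neg_smul, lieDer_add_left, lieDer_smul_left, lieDer_one ω.2, hc,
            smul_smul, ← add_smul]
          simp
        · have ht : A.1.1.trace = 0 := A.1.2
          rw [hφ, Matrix.trace_sub, ht, Matrix.trace_smul, Matrix.trace_one]
          rw [sub_sub, ← add_smul]
          convert sub_zero _
          simp
          ring⟩
      map_add' := fun _ _ => rfl
      map_smul' := fun _ _ => rfl }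
  refine LinearMap.finrank_le_finrank_of_injective (f := g) ?_
  intro A B hAB
  exact Subtype.ext (Subtype.ext (congrArg (fun s : S => s.1) hAB))

/-! ### Orbits -/

theorem mk_smul_mk {N : ℕ} (g : GL (Fin 3) ℂ) (ω : Form N) (h : NoCommonFactor (ω : PolyForm))
    (h' : NoCommonFactor ((g • ω : Form N) : PolyForm)) :
    (Matrix.ProjGenLinGroup.mk g : PGL(3, ℂ)) • Foliation.mk ω h = Foliation.mk (g • ω) h' := by
  change g • Foliation.mk ω h = _
  rw [Foliation.eq_iff, Foliation.smul_val]
  change g • Projectivization.mk ℂ ω _ = Projectivization.mk ℂ (g • ω) _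
  rw [Projectivization.smul_mk]

theorem Foliation.mk_eq_mk_iff {N : ℕ} {ω η : Form N} (h : NoCommonFactor (ω : PolyForm))
    (h' : NoCommonFactor (η : PolyForm)) :
    Foliation.mk ω h = Foliation.mk η h' ↔ ∃ c : ℂ, c • (η : PolyForm) = ω := by
  rw [Foliation.eq_iff]
  change Projectivization.mk ℂ ω _ = Projectivization.mk ℂ η _ ↔ _
  rw [Projectivization.mk_eq_mk_iff']
  simp only [Subtype.ext_iff, Submodule.coe_smul]

theorem mem_orbit_of_pull {N : ℕ} {ω η : Form N} (h : NoCommonFactor (ω : PolyForm))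
    (h' : NoCommonFactor (η : PolyForm)) {P Q : Matrix (Fin 3) (Fin 3) ℂ} (hPQ : P * Q = 1)
    (e : (η : PolyForm) = pull P ω) : Foliation.mk η h' ∈ Orbit (Foliation.mk ω h) := by
  -- The group acts by push-forward, so the element realizing the pull-back by P has matrix Q, the
  -- inverse of P.
  let g : GL (Fin 3) ℂ := ⟨Q, P, mul_eq_one_comm.mp hPQ, hPQ⟩
  have hg : g • ω = η := Subtype.ext e.symm
  refine ⟨Matrix.ProjGenLinGroup.mk g, ?_⟩
  subst hg
  exact mk_smul_mk g ω h h'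

theorem exists_pull_of_mem_orbit {N : ℕ} {ω η : Form N} (h : NoCommonFactor (ω : PolyForm))
    (h' : NoCommonFactor (η : PolyForm)) (e : Foliation.mk η h' ∈ Orbit (Foliation.mk ω h)) :
    ∃ (P Q : Matrix (Fin 3) (Fin 3) ℂ) (c : ℂ), P * Q = 1 ∧ c ≠ 0 ∧
      (η : PolyForm) = c • pull P ω := by
  obtain ⟨g, hg⟩ := e
  induction g using Matrix.ProjGenLinGroup.induction_on with
  | mk g =>
    have h1 : NoCommonFactor ((g • ω : Form N) : PolyForm) :=
      noCommonFactor_pull (Units.inv_mul g) h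
    dsimp only at hg
    rw [mk_smul_mk g ω h h1, eq_comm, Foliation.mk_eq_mk_iff] at hg
    obtain ⟨c, hc⟩ := hg
    refine ⟨(g⁻¹).val, g.val, c, Units.inv_mul g, ?_, hc.symm⟩
    rintro rfl
    rw [zero_smul] at hc
    exact not_isUnit_zero (h' 0 fun i => by rw [← hc]; simp)

/-! ### Linear algebra of commuting and of nilpotent matrices -/

/-- If [B, C] = l C, then [B, C^n] = n l C^n. Were all powers of C nonzero, ad B would have
infinitely many eigenvalues. -/
theorem isNilpotent_of_commutator_eq_smul {B C : Matrix (Fin 3) (Fin 3) ℂ} {l : ℂ} (hl : l ≠ 0)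
    (h : B * C - C * B = l • C) : IsNilpotent C := by
  by_contra hC
  have hpow : ∀ n : ℕ, B * C ^ n - C ^ n * B = (n * l) • C ^ n := by
    intro n
    induction n with
    | zero => simp
    | succ n ih =>
      have : B * C ^ (n + 1) - C ^ (n + 1) * B
          = (B * C ^ n - C ^ n * B) * C + C ^ n * (B * C - C * B) := by
        rw [pow_succ]
        noncomm_ring
      rw [this, ih, h, pow_succ, smul_mul_assoc, mul_smul_comm, ← add_smul]
      push_cast
      ring_nf
  let f : Module.End ℂ (Matrix (Fin 3) (Fin 3) ℂ) := LinearMap.mulLeft ℂ B - LinearMap.mulRight ℂ B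
  refine Set.infinite_of_injective_forall_mem (f := fun n : ℕ => (n : ℂ) * l)
    (s := {μ | f.HasEigenvalue μ}) ?_ ?_ f.finite_hasEigenvalue
  · intro m n hmn
    exact_mod_cast mul_right_cancel₀ hl hmn
  · intro n
    refine Module.End.hasEigenvalue_of_hasEigenvector (x := C ^ n) ⟨?_, fun h0 => hC ⟨n, h0⟩⟩
    rw [Module.End.mem_eigenspace_iff]
    exact hpow n

/-- A space of matrices of dimension at least two which is closed under commutators contains
a nonzero nilpotent matrix or two independent commuting matrices. -/
theorem exists_nilpotent_or_commuting {K : Submodule ℂ (Matrix (Fin 3) (Fin 3) ℂ)}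
    (hK : ∀ A ∈ K, ∀ B ∈ K, A * B - B * A ∈ K) (h2 : 2 ≤ Module.finrank ℂ K) :
    (∃ N ∈ K, N ≠ 0 ∧ IsNilpotent N) ∨
      ∃ B ∈ K, ∃ C ∈ K, B * C = C * B ∧ LinearIndependent ℂ ![B, C] := by
  have : Nontrivial K := Module.nontrivial_of_finrank_pos (R := ℂ) (by omega)
  obtain ⟨b, hb⟩ := exists_ne (0 : K)
  let f : Module.End ℂ K := LinearMap.restrict
    (LinearMap.mulLeft ℂ b.1 - LinearMap.mulRight ℂ b.1) fun A hA => hK b.1 b.2 A hA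
  let S : Submodule ℂ K := Submodule.span ℂ {b}
  have hfb : f b = 0 := Subtype.ext (sub_self _)
  have hS : S ≤ S.comap f := by
    refine Submodule.span_le.mpr ?_
    intro x hx
    rw [Set.mem_singleton_iff] at hx
    change f x ∈ S
    rw [hx, hfb]
    exact S.zero_mem
  have hQ : Nontrivial (K ⧸ S) := by
    refine Submodule.Quotient.nontrivial_iff.mpr fun hS => ?_
    have := finrank_span_singleton (K := ℂ) hb
    change Module.finrank ℂ S = 1 at this
    rw [hS, finrank_top] at this
    omega
  -- An eigenvector of ad b on the quotient of K by the line of b lifts to c with [b, c] = l c + t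
  -- b. If l = t = 0 the two commute; if l = 0 and t ≠ 0, then b is nilpotent; if l ≠ 0, then c +
  -- (t/l) b is an eigenvector of ad b for l, hence nilpotent.
  obtain ⟨l, hl⟩ := Module.End.exists_eigenvalue (S.mapQ S f hS)
  obtain ⟨q, hq, hq0⟩ := hl.exists_hasEigenvector
  obtain ⟨c, rfl⟩ := S.mkQ_surjective q
  rw [Module.End.mem_eigenspace_iff] at hq
  have hq' : f c - l • c ∈ S := by
    rw [← Submodule.Quotient.mk_eq_zero, ← Submodule.mkQ_apply, map_sub, map_smul, ← hq]
    exact sub_self _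
  have hc : c ∉ S := fun h => hq0 ((Submodule.Quotient.mk_eq_zero S).mpr h)
  obtain ⟨t, ht⟩ := Submodule.mem_span_singleton.mp hq'
  have e : b.1 * c.1 - c.1 * b.1 = l • c.1 + t • b.1 := by
    have := congrArg Subtype.val ht
    change t • b.1 = (b.1 * c.1 - c.1 * b.1) - l • c.1 at this
    rw [this]
    abel
  by_cases hl0 : l = 0
  · rw [hl0, zero_smul, zero_add] at e
    by_cases ht0 : t = 0
    · rw [ht0, zero_smul] at e
      refine Or.inr ⟨b.1, b.2, c.1, c.2, sub_eq_zero.mp e, ?_⟩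
      rw [LinearIndependent.pair_iff' (fun h => hb (Subtype.ext h))]
      exact fun a ha => hc (Submodule.mem_span_singleton.mpr ⟨a, Subtype.ext ha⟩)
    · refine Or.inl ⟨b.1, b.2, fun h => hb (Subtype.ext h),
        isNilpotent_of_commutator_eq_smul (B := c.1) (neg_ne_zero.mpr ht0) ?_⟩
      rw [neg_smul, ← e]
      abel
  · refine Or.inl ⟨c.1 + (t / l) • b.1, K.add_mem c.2 (K.smul_mem _ b.2), fun h => hc ?_,
      isNilpotent_of_commutator_eq_smul (B := b.1) hl0 ?_⟩
    · refine Submodule.mem_span_singleton.mpr ⟨-(t / l), Subtype.ext ?_⟩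
      change -(t / l) • b.1 = c.1
      rw [neg_smul, eq_comm, ← add_eq_zero_iff_eq_neg, h]
    · rw [mul_add, add_mul, mul_smul_comm, smul_mul_assoc, add_sub_add_right_eq_sub, e, smul_add,
        smul_smul, mul_div_cancel₀ _ hl0]

/-- The space is the sum of the joint generalized eigenspaces. If at most two joint weights occur,
some nonzero linear form takes the same value u on them, and the corresponding combination of the
operators has u as only eigenvalue. Otherwise three distinct weights are available. -/
theorem commuting_pair_cases {V : Type*} [AddCommGroup V] [Module ℂ V] [FiniteDimensional ℂ V]
    (f : Fin 2 → Module.End ℂ V) (hf : Commute (f 0) (f 1)) :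
    (∃ x y u : ℂ, (x ≠ 0 ∨ y ≠ 0) ∧ IsNilpotent (x • f 0 + y • f 1 - u • 1)) ∨
      ∃ e : Fin 3 → Fin 2 → ℂ, Function.Injective e ∧
        ∀ i, ⨅ k, (f k).maxGenEigenspace (e i k) ≠ ⊥ := by
  set W : (Fin 2 → ℂ) → Submodule ℂ V := fun χ => ⨅ k, (f k).maxGenEigenspace (χ k) with hW
  have htop : ⨆ χ, W χ = ⊤ := by
    refine Module.End.iSup_iInf_maxGenEigenspace_eq_top_of_iSup_maxGenEigenspace_eq_top_of_commute
      f ?_ fun i => Module.End.iSup_maxGenEigenspace_eq_top _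
    intro i j hij
    fin_cases i <;> fin_cases j <;> first | exact hf | exact hf.symm | exact absurd rfl hij
  by_cases h : ∃ χ₁ χ₂, ∀ χ, W χ ≠ ⊥ → χ = χ₁ ∨ χ = χ₂
  · left
    obtain ⟨χ₁, χ₂, h⟩ := h
    obtain ⟨x, y, hxy, hk⟩ : ∃ x y : ℂ, (x ≠ 0 ∨ y ≠ 0) ∧
        x * χ₁ 0 + y * χ₁ 1 = x * χ₂ 0 + y * χ₂ 1 := by
      by_cases h1 : χ₁ 1 = χ₂ 1
      · exact ⟨0, 1, Or.inr one_ne_zero, by rw [h1]; ring⟩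
      · exact ⟨χ₁ 1 - χ₂ 1, χ₂ 0 - χ₁ 0, Or.inl (sub_ne_zero.mpr h1), by ring⟩
    refine ⟨x, y, x * χ₁ 0 + y * χ₁ 1, hxy, ?_⟩
    set u := x * χ₁ 0 + y * χ₁ 1 with hu
    set n := Module.finrank ℂ V with hn
    refine ⟨n + n, ?_⟩
    have hker : ∀ χ, W χ ≤ LinearMap.ker ((x • f 0 + y • f 1 - u • 1) ^ (n + n)) := by
      intro χ
      by_cases hχ : W χ = ⊥
      · rw [hχ]
        exact bot_le
      have hu' : u = x * χ 0 + y * χ 1 := by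
        rcases h χ hχ with rfl | rfl
        · rfl
        · exact hk
      intro v hv
      have h0 : v ∈ (f 0).maxGenEigenspace (χ 0) := (Submodule.mem_iInf _).mp hv 0
      have h1 : v ∈ (f 1).maxGenEigenspace (χ 1) := (Submodule.mem_iInf _).mp hv 1
      rw [Module.End.maxGenEigenspace_eq_genEigenspace_finrank, Module.End.mem_genEigenspace_nat,
        LinearMap.mem_ker] at h0 h1
      set a := f 0 - χ 0 • (1 : Module.End ℂ V) with ha
      set b := f 1 - χ 1 • (1 : Module.End ℂ V) with hb
      have hab : Commute a b :=
        ((hf.sub_left (((Commute.one_left _).smul_left _))).sub_right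
          (((Commute.one_right _).smul_right _)))
      have he : x • f 0 + y • f 1 - u • 1 = x • a + y • b := by
        rw [ha, hb, hu', smul_sub, smul_sub, smul_smul, smul_smul, add_smul]
        abel
      have hab' : Commute (x • a) (y • b) := (hab.smul_left x).smul_right y
      -- In each term of the binomial expansion one of the two exponents is at least n, and the n-th
      -- power of either operator kills v.
      rw [LinearMap.mem_ker, he, hab'.add_pow', LinearMap.sum_apply]
      refine Finset.sum_eq_zero fun m hm => ?_
      replace hm : m.1 + m.2 = n + n := Finset.HasAntidiagonal.mem_antidiagonal.mp hm
      rw [LinearMap.smul_apply]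
      convert smul_zero _
      rcases le_or_gt n m.2 with hm2 | hm2
      · obtain ⟨k, hk⟩ := Nat.exists_eq_add_of_le hm2
        rw [smul_pow y, hk, add_comm n k, pow_add b, Module.End.mul_apply, LinearMap.smul_apply,
          Module.End.mul_apply, h1, map_zero, smul_zero, map_zero]
      · have hm1 : n ≤ m.1 := by omega
        obtain ⟨k, hk⟩ := Nat.exists_eq_add_of_le hm1
        rw [(hab'.pow_pow _ _).eq, smul_pow x, hk, add_comm n k, pow_add a, Module.End.mul_apply,
          LinearMap.smul_apply, Module.End.mul_apply, h0, map_zero, smul_zero, map_zero]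
    have : LinearMap.ker ((x • f 0 + y • f 1 - u • 1) ^ (n + n)) = ⊤ :=
      top_le_iff.mp (htop ▸ iSup_le hker)
    exact LinearMap.ker_eq_top.mp this
  · right
    push Not at h
    obtain ⟨χ₁, h1, -⟩ := h 0 0
    obtain ⟨χ₂, h2, h21, -⟩ := h χ₁ χ₁
    obtain ⟨χ₃, h3, h31, h32⟩ := h χ₁ χ₂
    refine ⟨![χ₁, χ₂, χ₃], ?_, ?_⟩
    · intro i j hij
      fin_cases i <;> fin_cases j <;> simp_all
    · intro i
      fin_cases i
      · exact h1
      · exact h2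
      · exact h3

/-- Two commuting matrices have a nilpotent combination, up to a scalar matrix, or are
simultaneously diagonalizable. -/
theorem nilpotent_or_diagonalizable {M : Fin 2 → Matrix (Fin 3) (Fin 3) ℂ}
    (hM : M 0 * M 1 = M 1 * M 0) :
    (∃ x y u : ℂ, (x ≠ 0 ∨ y ≠ 0) ∧ IsNilpotent (x • M 0 + y • M 1 - u • 1)) ∨
      ∃ (P Q : Matrix (Fin 3) (Fin 3) ℂ) (d : Fin 2 → Fin 3 → ℂ), P * Q = 1 ∧
        ∀ k, P * Matrix.diagonal (d k) = M k * P := by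
  let f : Fin 2 → Module.End ℂ (Fin 3 → ℂ) := fun k => Matrix.toLinAlgEquiv' (M k)
  have hf : Commute (f 0) (f 1) := by
    change _ * _ = _ * _
    rw [← map_mul, hM, map_mul]
  rcases commuting_pair_cases f hf with ⟨x, y, u, hxy, hn⟩ | ⟨e, he, hW⟩
  · refine Or.inl ⟨x, y, u, hxy, ?_⟩
    have : IsNilpotent (Matrix.toLinAlgEquiv' (x • M 0 + y • M 1 - u • 1)) := by
      simpa only [map_sub, map_add, map_smul, map_one] using hn
    exact (IsNilpotent.map_iff (Matrix.toLinAlgEquiv' (R := ℂ) (n := Fin 3)).injective).mp this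
  · right
    have hmaps : ∀ i k : Fin 2, ∀ μ, Set.MapsTo (f i) ((f k).maxGenEigenspace μ)
        ((f k).maxGenEigenspace μ) := by
      intro i k μ
      refine Module.End.mapsTo_maxGenEigenspace_of_comm ?_ μ
      fin_cases i <;> fin_cases k <;> first | exact hf | exact hf.symm | exact Commute.refl _
    have hind := (Module.End.independent_iInf_maxGenEigenspace_of_forall_mapsTo f
      fun i k μ => hmaps i k μ).comp he
    choose v hv hv0 using fun i => Submodule.exists_mem_ne_zero_of_ne_bot (hW i)
    have hli : LinearIndependent ℂ v :=
      hind.linearIndependent _ hv hv0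
    let P : Matrix (Fin 3) (Fin 3) ℂ := Matrix.of fun a i => v i a
    have hP : IsUnit P := Matrix.linearIndependent_cols_iff_isUnit.mp hli
    obtain ⟨Q, hQ⟩ := hP.exists_right_inv
    -- The three independent nonzero joint eigenspaces fill ℂ³, so each is a line. Expressed in the
    -- basis v, the difference between f k (v i) and its i-th component lies both in the i-th space
    -- and in the sum of the others, so it vanishes.
    have hdiag : ∀ k i, ∃ c : ℂ, f k (v i) = c • v i := by
      intro k i
      set x := f k (v i) with hx
      have hxW : x ∈ ⨅ l, (f l).maxGenEigenspace (e i l) :=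
        (Submodule.mem_iInf _).mpr fun l => hmaps k l _ ((Submodule.mem_iInf _).mp (hv i) l)
      have hsum : x = ∑ j, (Q.mulVec x) j • v j := by
        have : x = P.mulVec (Q.mulVec x) := by rw [Matrix.mulVec_mulVec, hQ, Matrix.one_mulVec]
        funext a
        conv_lhs => rw [this]
        simp [Matrix.mulVec, dotProduct, P, mul_comm]
      refine ⟨Q.mulVec x i, ?_⟩
      rw [← sub_eq_zero]
      refine (Submodule.disjoint_def.mp (hind i)) _
        (Submodule.sub_mem _ hxW (Submodule.smul_mem _ _ (hv i))) ?_
      have hsub : x - (Q.mulVec x) i • v i = ∑ j ∈ Finset.univ.erase i, (Q.mulVec x) j • v j := by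
        rw [sub_eq_iff_eq_add', Finset.add_sum_erase _ (fun j => (Q.mulVec x) j • v j)
          (Finset.mem_univ i)]
        exact hsum
      rw [hsub]
      refine Submodule.sum_mem _ fun j hj => Submodule.smul_mem _ _ ?_
      exact Submodule.mem_iSup_of_mem j (Submodule.mem_iSup_of_mem (Finset.ne_of_mem_erase hj)
        (hv j))
    choose d hd using hdiag
    refine ⟨P, Q, d, hQ, fun k => ?_⟩
    ext a i
    have := congrFun (hd k i) a
    rw [Matrix.mul_diagonal]
    simp only [f, Matrix.toLinAlgEquiv'_apply, Matrix.mulVec, dotProduct, Pi.smul_apply,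
      smul_eq_mul] at this
    rw [Matrix.mul_apply, mul_comm]
    exact this.symm

/-- A nonzero nilpotent matrix has one of two normal forms. -/
theorem nilpotent_normal_form {N : Matrix (Fin 3) (Fin 3) ℂ} (hN : IsNilpotent N) (h0 : N ≠ 0) :
    ∃ P Q : Matrix (Fin 3) (Fin 3) ℂ, P * Q = 1 ∧
      (P * !![0, 0, 0; 0, 0, 0; 1, 0, 0] = N * P ∨
        P * !![0, 0, 0; 1, 0, 0; 0, 1, 0] = N * P) := by
  have h3 : N ^ 3 = 0 := by
    have h := (Matrix.isNilpotent_charpoly_sub_pow_of_isNilpotent hN).eq_zero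
    have h' := Matrix.aeval_self_charpoly N
    rw [sub_eq_zero.mp h] at h'
    simpa using h'
  have hex : ∀ M : Matrix (Fin 3) (Fin 3) ℂ, M ≠ 0 → ∃ v, M.mulVec v ≠ 0 := by
    intro M hM
    by_contra! h
    exact hM (Matrix.ext_of_mulVec_single fun i => by rw [h, Matrix.zero_mulVec])
  have hunit : ∀ v : Fin 3 → Fin 3 → ℂ,
      (∀ x y z : ℂ, x • v 0 + y • v 1 + z • v 2 = 0 → x = 0 ∧ y = 0 ∧ z = 0) →
      ∃ Q, (Matrix.of fun i j => v j i) * Q = 1 := by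
    intro v hv
    have hli : LinearIndependent ℂ v := by
      refine Fintype.linearIndependent_iff.mpr fun g hg => ?_
      rw [Fin.sum_univ_three] at hg
      obtain ⟨h0, h1, h2⟩ := hv _ _ _ hg
      intro i
      fin_cases i <;> assumption
    have hP : IsUnit (Matrix.of fun i j => v j i) :=
      Matrix.linearIndependent_cols_iff_isUnit.mp hli
    exact hP.exists_right_inv
  by_cases h2 : N ^ 2 = 0
  · have hNN : ∀ v, N.mulVec (N.mulVec v) = 0 := fun v => by
      rw [Matrix.mulVec_mulVec, ← pow_two, h2, Matrix.zero_mulVec]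
    obtain ⟨a, ha⟩ := hex N h0
    -- As N² = 0, the rank of N is at most its nullity, so the kernel has dimension at least 2 and
    -- is not exhausted by the line of N a. The basis a, b, N a gives the first normal form.
    obtain ⟨b, hb, hbi⟩ : ∃ b, N.mulVec b = 0 ∧ ∀ c : ℂ, c • N.mulVec a ≠ b := by
      by_contra! h
      have h1 : LinearMap.ker N.mulVecLin ≤ Submodule.span ℂ {N.mulVec a} := fun b hb =>
        Submodule.mem_span_singleton.mpr (h b hb)
      have h2 := Submodule.finrank_mono h1
      have h4 : LinearMap.range N.mulVecLin ≤ LinearMap.ker N.mulVecLin := by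
        rintro _ ⟨v, rfl⟩
        exact hNN v
      have h5 := Submodule.finrank_mono h4
      have h6 := N.mulVecLin.finrank_range_add_finrank_ker
      rw [finrank_span_singleton ha] at h2
      rw [Module.finrank_fin_fun] at h6
      omega
    obtain ⟨Q, hQ⟩ := hunit ![a, b, N.mulVec a] fun x y z h => by
      simp only [Matrix.cons_val] at h
      have hx : x = 0 := by
        have := congrArg N.mulVec h
        rw [Matrix.mulVec_add, Matrix.mulVec_add, Matrix.mulVec_smul, Matrix.mulVec_smul,
          Matrix.mulVec_smul, hb, hNN, smul_zero, smul_zero, add_zero, add_zero,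
          Matrix.mulVec_zero] at this
        exact (smul_eq_zero.mp this).resolve_right ha
      rw [hx, zero_smul, zero_add] at h
      have hy : y = 0 := by
        by_contra hy
        refine hbi (-(z / y)) ?_
        have : b = y⁻¹ • (y • b) := by rw [smul_smul, inv_mul_cancel₀ hy, one_smul]
        rw [this, eq_neg_of_add_eq_zero_left h, smul_neg, smul_smul, neg_smul, div_eq_inv_mul]
      rw [hy, zero_smul, zero_add] at h
      exact ⟨hx, hy, (smul_eq_zero.mp h).resolve_right ha⟩
    refine ⟨_, Q, hQ, Or.inl ?_⟩
    have hc := hNN a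
    generalize hw : N.mulVec a = w at *
    ext i j
    have e1 := congrFun hw i
    have e2 := congrFun hb i
    have e3 := congrFun hc i
    simp only [Matrix.mulVec, dotProduct, Fin.sum_univ_three, Pi.zero_apply] at e1 e2 e3
    fin_cases j <;> simp [Matrix.mul_apply, Fin.sum_univ_three, e1, e2, e3]
  · obtain ⟨a, ha⟩ := hex _ h2
    have hNNN : N.mulVec (N.mulVec (N.mulVec a)) = 0 := by
      rw [Matrix.mulVec_mulVec, Matrix.mulVec_mulVec]
      rw [pow_succ, pow_two] at h3
      rw [h3, Matrix.zero_mulVec]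
    rw [pow_two, ← Matrix.mulVec_mulVec] at ha
    obtain ⟨Q, hQ⟩ := hunit ![a, N.mulVec a, N.mulVec (N.mulVec a)] fun x y z h => by
      simp only [Matrix.cons_val] at h
      have hN1 := congrArg N.mulVec h
      have hN2 := congrArg N.mulVec hN1
      simp only [Matrix.mulVec_add, Matrix.mulVec_smul, hNNN, Matrix.mulVec_zero, smul_zero,
        add_zero] at hN1 hN2
      have hx := (smul_eq_zero.mp hN2).resolve_right ha
      rw [hx, zero_smul, zero_add] at hN1 h
      have hy := (smul_eq_zero.mp hN1).resolve_right ha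
      rw [hy, zero_smul, zero_add] at h
      exact ⟨hx, hy, (smul_eq_zero.mp h).resolve_right ha⟩
    refine ⟨_, Q, hQ, Or.inr ?_⟩
    generalize hw : N.mulVec a = w at *
    generalize hv : N.mulVec w = v at *
    ext i j
    have e1 := congrFun hw i
    have e2 := congrFun hv i
    have e3 := congrFun hNNN i
    simp only [Matrix.mulVec, dotProduct, Fin.sum_univ_three, Pi.zero_apply] at e1 e2 e3
    fin_cases j <;> simp [Matrix.mul_apply, Fin.sum_univ_three, e1, e2, e3]

/-! ### Forms with a two-dimensional annihilator -/

theorem annihilator_quadForm {B : Matrix (Fin 3) (Fin 3) ℂ} {u : Fin 3 → ℂ} {v w : Fin 6 → ℂ}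
    (h : B ∈ annihilator (quadForm u v w)) :
    - B 0 2 * w 3 + B 2 2 * u 0 - B 0 1 * v 3 + 3 * B 1 1 * u 0 + B 2 1 * u 1 = 0 ∧
    - B 0 2 * w 4 + 2 * B 1 2 * u 0 + 2 * B 2 2 * u 1 - B 0 1 * v 4 + 2 * B 1 1 * u 1 + 2 * B 2 1 * u 2 = 0 ∧
    - B 0 2 * w 5 + B 1 2 * u 1 + 3 * B 2 2 * u 2 - B 0 1 * v 5 + B 1 1 * u 2 = 0 ∧
    - B 1 2 * w 0 + B 2 2 * v 0 + 3 * B 0 0 * v 0 + B 1 0 * v 1 + B 2 0 * v 2 = 0 ∧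
    B 0 2 * w 0 - B 1 2 * w 1 + B 2 2 * v 1 + 2 * B 0 0 * v 1 + 3 * B 0 1 * v 0 + 2 * B 1 0 * v 3 + B 1 1 * v 1 + B 2 0 * v 4 + B 2 1 * v 2 = 0 ∧
    2 * B 0 2 * v 0 - B 1 2 * w 2 + 2 * B 2 2 * v 2 + 2 * B 0 0 * v 2 + B 1 0 * v 4 + B 1 2 * v 1 + 2 * B 2 0 * v 5 = 0 ∧
    B 0 2 * w 1 - B 1 2 * w 3 + B 2 2 * v 3 + B 0 0 * v 3 + 2 * B 0 1 * v 1 - 3 * B 1 0 * u 0 + 2 * B 1 1 * v 3 - B 2 0 * u 1 + B 2 1 * v 4 = 0 ∧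
    B 0 2 * v 1 + B 0 2 * w 2 - B 1 2 * w 4 + 2 * B 2 2 * v 4 + B 0 0 * v 4 + 2 * B 0 1 * v 2 - 2 * B 1 0 * u 1 + B 1 1 * v 4 + 2 * B 1 2 * v 3 - 2 * B 2 0 * u 2 + 2 * B 2 1 * v 5 = 0 ∧
    B 0 2 * v 2 - B 1 2 * w 5 + 3 * B 2 2 * v 5 + B 0 0 * v 5 - B 1 0 * u 2 + B 1 2 * v 4 = 0 ∧
    B 1 1 * w 0 - B 2 1 * v 0 + 3 * B 0 0 * w 0 + B 1 0 * w 1 + B 2 0 * w 2 = 0 ∧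
    2 * B 0 1 * w 0 + 2 * B 1 1 * w 1 - B 2 1 * v 1 + 2 * B 0 0 * w 1 + 2 * B 1 0 * w 3 + B 2 0 * w 4 + B 2 1 * w 2 = 0 ∧
    B 0 1 * v 0 + B 1 1 * w 2 - B 2 1 * v 2 + 2 * B 0 0 * w 2 + 3 * B 0 2 * w 0 + B 1 0 * w 4 + B 1 2 * w 1 + 2 * B 2 0 * w 5 + B 2 2 * w 2 = 0 ∧
    B 0 1 * w 1 + 3 * B 1 1 * w 3 - B 2 1 * v 3 + B 0 0 * w 3 - B 2 0 * u 0 + B 2 1 * w 4 = 0 ∧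
    B 0 1 * v 1 + B 0 1 * w 2 + 2 * B 1 1 * w 4 - B 2 1 * v 4 + B 0 0 * w 4 + 2 * B 0 2 * w 1 - 2 * B 1 0 * u 0 + 2 * B 1 2 * w 3 - 2 * B 2 0 * u 1 + 2 * B 2 1 * w 5 + B 2 2 * w 4 = 0 ∧
    B 0 1 * v 2 + B 1 1 * w 5 - B 2 1 * v 5 + B 0 0 * w 5 + 2 * B 0 2 * w 2 - B 1 0 * u 1 + B 1 2 * w 4 - 3 * B 2 0 * u 2 + 2 * B 2 2 * w 5 = 0 := by
  rw [mem_annihilator, lieDer_quadForm] at h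
  obtain ⟨hu, hv, hw⟩ := quadForm_coeff_eq_zero h
  exact ⟨hu 0, hu 1, hu 2, hv 0, hv 1, hv 2, hv 3, hv 4, hv 5, hw 0, hw 1, hw 2, hw 3, hw 4, hw 5⟩

/-- The scalar part acts on forms by 4c and n acts nilpotently. The fifteen equations are therefore
triangular with 4c on the diagonal, and for c ≠ 0 back substitution kills every coefficient. -/
theorem eq_zero_of_scalar_add {c : ℂ} {u : Fin 3 → ℂ} {v w : Fin 6 → ℂ}
    {n : Matrix (Fin 3) (Fin 3) ℂ}
    (hn : n = 0 ∨ n = !![0, 0, 0; 0, 0, 0; 1, 0, 0] ∨ n = !![0, 0, 0; 1, 0, 0; 0, 1, 0])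
    (h : c • 1 + n ∈ annihilator (quadForm u v w)) (hω : quadForm u v w ≠ 0) : c = 0 := by
  by_contra hc
  obtain ⟨u0, u1, u2, v0, v1, v2, v3, v4, v5, w0, w1, w2, w3, w4, w5⟩ := annihilator_quadForm h
  have hc4 : ∀ {x : ℂ}, 4 * c * x = 0 → x = 0 := fun {x} hx => by simpa [hc] using hx
  have hz : (∀ i, u i = 0) ∧ (∀ i, v i = 0) ∧ ∀ i, w i = 0 := by
    rcases hn with rfl | rfl | rfl <;> simp [-mul_eq_zero, -add_self_eq_zero] at u0 u1 u2 v0 v1 v2 v3 v4 v5 w0 w1 w2 w3 w4 w5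
    · have a0 : u 0 = 0 := hc4 (by linear_combination u0)
      have a1 : u 1 = 0 := hc4 (by linear_combination u1)
      have a2 : u 2 = 0 := hc4 (by linear_combination u2)
      have b0 : v 0 = 0 := hc4 (by linear_combination v0)
      have b1 : v 1 = 0 := hc4 (by linear_combination v1)
      have b2 : v 2 = 0 := hc4 (by linear_combination v2)
      have b3 : v 3 = 0 := hc4 (by linear_combination v3)
      have b4 : v 4 = 0 := hc4 (by linear_combination v4)
      have b5 : v 5 = 0 := hc4 (by linear_combination v5)
      have d0 : w 0 = 0 := hc4 (by linear_combination w0)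
      have d1 : w 1 = 0 := hc4 (by linear_combination w1)
      have d2 : w 2 = 0 := hc4 (by linear_combination w2)
      have d3 : w 3 = 0 := hc4 (by linear_combination w3)
      have d4 : w 4 = 0 := hc4 (by linear_combination w4)
      have d5 : w 5 = 0 := hc4 (by linear_combination w5)
      refine ⟨fun i => ?_, fun i => ?_, fun i => ?_⟩ <;> fin_cases i <;> assumption
    · have a0 : u 0 = 0 := hc4 (by linear_combination u0)
      have a1 : u 1 = 0 := hc4 (by linear_combination u1)
      have a2 : u 2 = 0 := hc4 (by linear_combination u2)
      have b5 : v 5 = 0 := hc4 (by linear_combination v5)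
      have b4 : v 4 = 0 := hc4 (by linear_combination v4 + 2 * a2)
      have b2 : v 2 = 0 := hc4 (by linear_combination v2 - 2 * b5)
      have b3 : v 3 = 0 := hc4 (by linear_combination v3 + a1)
      have b1 : v 1 = 0 := hc4 (by linear_combination v1 - b4)
      have b0 : v 0 = 0 := hc4 (by linear_combination v0 - b2)
      have d5 : w 5 = 0 := hc4 (by linear_combination w5 + 3 * a2)
      have d4 : w 4 = 0 := hc4 (by linear_combination w4 + 2 * a1)
      have d2 : w 2 = 0 := hc4 (by linear_combination w2 - 2 * d5)
      have d3 : w 3 = 0 := hc4 (by linear_combination w3 + a0)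
      have d1 : w 1 = 0 := hc4 (by linear_combination w1 - d4)
      have d0 : w 0 = 0 := hc4 (by linear_combination w0 - d2)
      refine ⟨fun i => ?_, fun i => ?_, fun i => ?_⟩ <;> fin_cases i <;> assumption
    · have a2 : u 2 = 0 := hc4 (by linear_combination u2)
      have a1 : u 1 = 0 := hc4 (by linear_combination u1 - 2 * a2)
      have a0 : u 0 = 0 := hc4 (by linear_combination u0 - a1)
      have b5 : v 5 = 0 := hc4 (by linear_combination v5 + a2)
      have b4 : v 4 = 0 := hc4 (by linear_combination v4 + 2 * a1 - 2 * b5)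
      have b2 : v 2 = 0 := hc4 (by linear_combination v2 - b4)
      have b3 : v 3 = 0 := hc4 (by linear_combination v3 + 3 * a0 - b4)
      have b1 : v 1 = 0 := hc4 (by linear_combination v1 - 2 * b3 - b2)
      have b0 : v 0 = 0 := hc4 (by linear_combination v0 - b1)
      have d5 : w 5 = 0 := hc4 (by linear_combination w5 + a1 + b5)
      have d4 : w 4 = 0 := hc4 (by linear_combination w4 + 2 * a0 + b4 - 2 * d5)
      have d2 : w 2 = 0 := hc4 (by linear_combination w2 - d4 + b2)
      have d3 : w 3 = 0 := hc4 (by linear_combination w3 - d4 + b3)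
      have d1 : w 1 = 0 := hc4 (by linear_combination w1 - 2 * d3 - d2 + b1)
      have d0 : w 0 = 0 := hc4 (by linear_combination w0 - d1 + b0)
      refine ⟨fun i => ?_, fun i => ?_, fun i => ?_⟩ <;> fin_cases i <;> assumption
  obtain ⟨hu, hv, hw⟩ := hz
  exact hω (by funext i; fin_cases i <;> simp [quadForm, hu, hv, hw])

theorem pull_inj {P Q : Matrix (Fin 3) (Fin 3) ℂ} (h : P * Q = 1) {ω : PolyForm}
    (h0 : pull P ω = 0) : ω = 0 := by
  have := pull_pull Q P ω
  rw [h, pull_one, h0] at this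
  rw [← this]
  funext j
  simp [pull]

theorem pull_mul_inv {P Q : Matrix (Fin 3) (Fin 3) ℂ} (h : P * Q = 1) (ω : PolyForm) :
    pull Q (pull P ω) = ω := by
  rw [pull_pull, h, pull_one]

/-- A scalar matrix plus a nilpotent matrix annihilates a form only if the scalar is zero. -/
theorem eq_zero_of_scalar_add_nilpotent {c : ℂ} {ω : PolyForm} (hω : ω ∈ Form 2) (h0 : ω ≠ 0)
    {n : Matrix (Fin 3) (Fin 3) ℂ} (hn : IsNilpotent n) (h : c • 1 + n ∈ annihilator ω) :
    c = 0 := by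
  by_cases hn0 : n = 0
  · obtain ⟨u, v, w, rfl⟩ := exists_eq_quadForm hω
    exact eq_zero_of_scalar_add (Or.inl hn0) h h0
  · obtain ⟨P, Q, hPQ, hP⟩ := nilpotent_normal_form hn hn0
    obtain ⟨u, v, w, e⟩ := exists_eq_quadForm (pull_mem P hω)
    have h0' : quadForm u v w ≠ 0 := fun hz => h0 (pull_inj hPQ (e.trans hz))
    rcases hP with hP | hP
    · refine eq_zero_of_scalar_add (Or.inr (Or.inl rfl)) (e ▸ mem_annihilator_pull ?_ h) h0'
      rw [mul_add, add_mul, hP]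
      simp
    · refine eq_zero_of_scalar_add (Or.inr (Or.inr rfl)) (e ▸ mem_annihilator_pull ?_ h) h0'
      rw [mul_add, add_mul, hP]
      simp

theorem not_isUnit_X (i : Fin 3) : ¬ IsUnit (X i : MvPolynomial (Fin 3) ℂ) :=
  (X_prime (R := ℂ) (i := i)).not_isUnit

/-- The annihilator of a form without common factor does not contain two independent diagonal
matrices. -/
theorem not_diagonal_pair {d : Fin 2 → Fin 3 → ℂ} {ω : PolyForm} (hω : ω ∈ Form 2)
    (h : NoCommonFactor ω) (hd : ∀ k, Matrix.diagonal (d k) ∈ annihilator ω)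
    (hli : ∀ s t : ℂ, s • d 0 + t • d 1 = 0 → s = 0 ∧ t = 0) : False := by
  obtain ⟨u, v, w, rfl⟩ := exists_eq_quadForm hω
  -- The vector (n0, n1, n2) is the cross product of the two diagonals; it spans the weights
  -- orthogonal to both when they are independent.
  set n0 := d 0 1 * d 1 2 - d 0 2 * d 1 1 with hn0
  set n1 := d 0 2 * d 1 0 - d 0 0 * d 1 2 with hn1
  set n2 := d 0 0 * d 1 1 - d 0 1 * d 1 0 with hn2
  -- Here m is the weight of a monomial of the form, with dX, dY, dZ counted like X, Y, Z, so its
  -- total is 4. If its coefficient c is nonzero, then m is orthogonal to both diagonals, hence m σ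
  -- = 4 n with σ the sum of the entries of n.
  have key : ∀ c m0 m1 m2 : ℂ, m0 + m1 + m2 = 4 →
      (∀ k, c * (m0 * d k 0 + m1 * d k 1 + m2 * d k 2) = 0) →
      c = 0 ∨ 4 * n0 = m0 * (n0 + n1 + n2) ∧ 4 * n1 = m1 * (n0 + n1 + n2) ∧
        4 * n2 = m2 * (n0 + n1 + n2) := by
    intro c m0 m1 m2 hm hk
    by_cases hc : c = 0
    · exact Or.inl hc
    have e0 := (mul_eq_zero.mp (hk 0)).resolve_left hc
    have e1 := (mul_eq_zero.mp (hk 1)).resolve_left hc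
    have c0 : m1 * n2 = m2 * n1 := by
      rw [hn1, hn2]
      linear_combination d 1 0 * e0 * (-1) + d 0 0 * e1
    have c1 : m2 * n0 = m0 * n2 := by
      rw [hn0, hn2]
      linear_combination d 1 1 * e0 * (-1) + d 0 1 * e1
    have c2 : m0 * n1 = m1 * n0 := by
      rw [hn0, hn1]
      linear_combination d 1 2 * e0 * (-1) + d 0 2 * e1
    refine Or.inr ⟨?_, ?_, ?_⟩
    · linear_combination - n0 * hm + c1 - c2
    · linear_combination - n1 * hm + c2 - c0
    · linear_combination - n2 * hm + c0 - c1
  have q := fun k => annihilator_quadForm (hd k)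
  have hu0 := key (u 0) 0 3 1 (by norm_num) fun k => by
    have := (q k).1
    simp at this
    linear_combination this
  have hu1 := key (u 1) 0 2 2 (by norm_num) fun k => by
    have := (q k).2.1
    simp at this
    linear_combination this
  have hu2 := key (u 2) 0 1 3 (by norm_num) fun k => by
    have := (q k).2.2.1
    simp at this
    linear_combination this
  have hv0 := key (v 0) 3 0 1 (by norm_num) fun k => by
    have := (q k).2.2.2.1
    simp at this
    linear_combination this
  have hv1 := key (v 1) 2 1 1 (by norm_num) fun k => by
    have := (q k).2.2.2.2.1
    simp at this
    linear_combination this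
  have hv2 := key (v 2) 2 0 2 (by norm_num) fun k => by
    have := (q k).2.2.2.2.2.1
    simp at this
    linear_combination this
  have hv3 := key (v 3) 1 2 1 (by norm_num) fun k => by
    have := (q k).2.2.2.2.2.2.1
    simp at this
    linear_combination this
  have hv4 := key (v 4) 1 1 2 (by norm_num) fun k => by
    have := (q k).2.2.2.2.2.2.2.1
    simp at this
    linear_combination this
  have hv5 := key (v 5) 1 0 3 (by norm_num) fun k => by
    have := (q k).2.2.2.2.2.2.2.2.1
    simp at this
    linear_combination this
  have hw0 := key (w 0) 3 1 0 (by norm_num) fun k => by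
    have := (q k).2.2.2.2.2.2.2.2.2.1
    simp at this
    linear_combination this
  have hw1 := key (w 1) 2 2 0 (by norm_num) fun k => by
    have := (q k).2.2.2.2.2.2.2.2.2.2.1
    simp at this
    linear_combination this
  have hw2 := key (w 2) 2 1 1 (by norm_num) fun k => by
    have := (q k).2.2.2.2.2.2.2.2.2.2.2.1
    simp at this
    linear_combination this
  have hw3 := key (w 3) 1 3 0 (by norm_num) fun k => by
    have := (q k).2.2.2.2.2.2.2.2.2.2.2.2.1
    simp at this
    linear_combination this
  have hw4 := key (w 4) 1 2 1 (by norm_num) fun k => by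
    have := (q k).2.2.2.2.2.2.2.2.2.2.2.2.2.1
    simp at this
    linear_combination this
  have hw5 := key (w 5) 1 1 2 (by norm_num) fun k => by
    have := (q k).2.2.2.2.2.2.2.2.2.2.2.2.2.2
    simp at this
    linear_combination this
  set σ := n0 + n1 + n2 with hσ
  -- If the X-weight is neither 0 nor 1, only terms of X-weight at least 2 survive, and X divides
  -- all coefficients. The same holds for Y and Z.
  have hX : 4 * n0 = 0 ∨ 4 * n0 = σ := by
    by_contra! hne
    obtain ⟨hne0, hne1⟩ := hne
    have r0 : ∀ {c : ℂ} {p q : Prop}, (c = 0 ∨ 4 * n0 = 0 * σ ∧ p ∧ q) → c = 0 :=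
      fun hh => hh.resolve_right fun h1 => hne0 (by rw [h1.1, zero_mul])
    have r1 : ∀ {c : ℂ} {p q : Prop}, (c = 0 ∨ 4 * n0 = 1 * σ ∧ p ∧ q) → c = 0 :=
      fun hh => hh.resolve_right fun h1 => hne1 (by rw [h1.1, one_mul])
    refine not_isUnit_X 0 (h (X 0) fun i => ?_)
    simp only [quadForm, r0 hu0, r0 hu1, r0 hu2, r1 hv3, r1 hv4, r1 hv5, r1 hw3, r1 hw4, r1 hw5]
    refine ⟨![(C (v 0) * X 0 + C (v 1) * X 1 + C (v 2) * X 2) * X 2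
      - (C (w 0) * X 0 + C (w 1) * X 1 + C (w 2) * X 2) * X 1,
      (C (w 0) * X 0 + C (w 1) * X 1 + C (w 2) * X 2) * X 0,
      - (C (v 0) * X 0 + C (v 1) * X 1 + C (v 2) * X 2) * X 0] i, ?_⟩
    fin_cases i <;> simp <;> ring
  have hY : 4 * n1 = 0 ∨ 4 * n1 = σ := by
    by_contra! hne
    obtain ⟨hne0, hne1⟩ := hne
    have r0 : ∀ {c : ℂ} {p q : Prop}, (c = 0 ∨ p ∧ 4 * n1 = 0 * σ ∧ q) → c = 0 :=
      fun hh => hh.resolve_right fun h1 => hne0 (by rw [h1.2.1, zero_mul])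
    have r1 : ∀ {c : ℂ} {p q : Prop}, (c = 0 ∨ p ∧ 4 * n1 = 1 * σ ∧ q) → c = 0 :=
      fun hh => hh.resolve_right fun h1 => hne1 (by rw [h1.2.1, one_mul])
    refine not_isUnit_X 1 (h (X 1) fun i => ?_)
    simp only [quadForm, r1 hu2, r0 hv0, r0 hv2, r0 hv5, r1 hw0, r1 hw2, r1 hw5]
    refine ⟨![(C (v 1) * X 0 + C (v 3) * X 1 + C (v 4) * X 2) * X 2
      - (C (w 1) * X 0 + C (w 3) * X 1 + C (w 4) * X 2) * X 1,
      (C (w 1) * X 0 + C (w 3) * X 1 + C (w 4) * X 2) * X 0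
        - (C (u 0) * X 1 + C (u 1) * X 2) * X 2,
      (C (u 0) * X 1 + C (u 1) * X 2) * X 1
        - (C (v 1) * X 0 + C (v 3) * X 1 + C (v 4) * X 2) * X 0] i, ?_⟩
    fin_cases i <;> simp <;> ring
  have hZ : 4 * n2 = 0 ∨ 4 * n2 = σ := by
    by_contra! hne
    obtain ⟨hne0, hne1⟩ := hne
    have r0 : ∀ {c : ℂ} {p q : Prop}, (c = 0 ∨ p ∧ q ∧ 4 * n2 = 0 * σ) → c = 0 :=
      fun hh => hh.resolve_right fun h1 => hne0 (by rw [h1.2.2, zero_mul])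
    have r1 : ∀ {c : ℂ} {p q : Prop}, (c = 0 ∨ p ∧ q ∧ 4 * n2 = 1 * σ) → c = 0 :=
      fun hh => hh.resolve_right fun h1 => hne1 (by rw [h1.2.2, one_mul])
    refine not_isUnit_X 2 (h (X 2) fun i => ?_)
    simp only [quadForm, r1 hu0, r1 hv0, r1 hv1, r1 hv3, r0 hw0, r0 hw1, r0 hw3]
    refine ⟨![(C (v 2) * X 0 + C (v 4) * X 1 + C (v 5) * X 2) * X 2
      - (C (w 2) * X 0 + C (w 4) * X 1 + C (w 5) * X 2) * X 1,
      (C (w 2) * X 0 + C (w 4) * X 1 + C (w 5) * X 2) * X 0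
        - (C (u 1) * X 1 + C (u 2) * X 2) * X 2,
      (C (u 1) * X 1 + C (u 2) * X 2) * X 1
        - (C (v 2) * X 0 + C (v 4) * X 1 + C (v 5) * X 2) * X 0] i, ?_⟩
    fin_cases i <;> simp <;> ring
  -- Each 4 n_i is 0 or σ, and their sum is 4σ. So 4σ = kσ with k ≤ 3, which forces σ = 0, then n =
  -- 0 and the dependence of the diagonals.
  have hσ0 : σ = 0 := by
    rcases hX with hX | hX <;> rcases hY with hY | hY <;> rcases hZ with hZ | hZ
    · linear_combination hσ + (hX + hY + hZ) / 4
    · linear_combination (4 / 3) * (hσ + (hX + hY + hZ) / 4)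
    · linear_combination (4 / 3) * (hσ + (hX + hY + hZ) / 4)
    · linear_combination 2 * (hσ + (hX + hY + hZ) / 4)
    · linear_combination (4 / 3) * (hσ + (hX + hY + hZ) / 4)
    · linear_combination 2 * (hσ + (hX + hY + hZ) / 4)
    · linear_combination 2 * (hσ + (hX + hY + hZ) / 4)
    · linear_combination 4 * (hσ + (hX + hY + hZ) / 4)
  rw [hσ0, or_self] at hX hY hZ
  have hX' : n0 = 0 := by simpa using hX
  have hY' : n1 = 0 := by simpa using hY
  have hZ' : n2 = 0 := by simpa using hZ
  have hdep : ∀ i, d 1 i = 0 ∧ - d 0 i = 0 := by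
    intro i
    refine hli _ _ (funext fun j => ?_)
    simp only [Pi.add_apply, Pi.smul_apply, smul_eq_mul, Pi.zero_apply]
    fin_cases i <;> fin_cases j <;> simp only [Fin.zero_eta, Fin.mk_one, Fin.reduceFinMk]
    · ring
    · linear_combination - hZ'
    · linear_combination hY'
    · linear_combination hZ'
    · ring
    · linear_combination - hX'
    · linear_combination - hY'
    · linear_combination hX'
    · ring
  have := (hli 1 0 (funext fun i => by simp [neg_eq_zero.mp (hdep i).2])).1
  exact one_ne_zero this

/-! ### Forms annihilated by a nilpotent matrix -/

/-- The form `q (Z dX - X dZ) + s (X dY - Y dX)`, where `q` and `s` are binary quadratic forms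
in `X`, `Y`. -/
def binaryForm (q s : Fin 3 → ℂ) : PolyForm :=
  quadForm 0 ![q 0, q 1, 0, q 2, 0, 0] ![s 0, s 1, 0, s 2, 0, 0]

theorem not_isUnit_of_eval {d : MvPolynomial (Fin 3) ℂ} (x : Fin 3 → ℂ) (h : eval x d = 0) :
    ¬ IsUnit d := fun hd => by
  have := hd.map (eval x)
  rw [h] at this
  exact not_isUnit_zero this

/-- A common root r of q and s would make Y - r X a common factor of the form. -/
theorem binaryForm_no_common_root {q s : Fin 3 → ℂ} (h : NoCommonFactor (binaryForm q s)) (r : ℂ)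
    (hq : q 0 + q 1 * r + q 2 * r ^ 2 = 0) : s 0 + s 1 * r + s 2 * r ^ 2 ≠ 0 := by
  intro hs
  refine not_isUnit_of_eval (d := X 1 - C r * X 0) ![1, r, 0] (by simp) (h _ fun i => ?_)
  have hq' : q 0 = - (q 1 * r + q 2 * r ^ 2) := by linear_combination hq
  have hs' : s 0 = - (s 1 * r + s 2 * r ^ 2) := by linear_combination hs
  have eq : (C (q 0) * X 0 ^ 2 + C (q 1) * X 0 * X 1 + C (q 2) * X 1 ^ 2 :
      MvPolynomial (Fin 3) ℂ)
      = (X 1 - C r * X 0) * (C (q 2) * X 1 + (C (q 1) + C (q 2) * C r) * X 0) := by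
    rw [hq']
    simp only [map_neg, map_add, map_mul, map_pow]
    ring
  have es : (C (s 0) * X 0 ^ 2 + C (s 1) * X 0 * X 1 + C (s 2) * X 1 ^ 2 :
      MvPolynomial (Fin 3) ℂ)
      = (X 1 - C r * X 0) * (C (s 2) * X 1 + (C (s 1) + C (s 2) * C r) * X 0) := by
    rw [hs']
    simp only [map_neg, map_add, map_mul, map_pow]
    ring
  refine ⟨![(C (q 2) * X 1 + (C (q 1) + C (q 2) * C r) * X 0) * X 2
    - (C (s 2) * X 1 + (C (s 1) + C (s 2) * C r) * X 0) * X 1,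
    (C (s 2) * X 1 + (C (s 1) + C (s 2) * C r) * X 0) * X 0,
    - (C (q 2) * X 1 + (C (q 1) + C (q 2) * C r) * X 0) * X 0] i, ?_⟩
  fin_cases i <;> simp [binaryForm, quadForm]
  · linear_combination eq * X 2 - es * X 1
  · linear_combination es * X 0
  · linear_combination eq * (-X 0)

/-- This is the common root at infinity: if Y² is missing from both q and s, then X is a common
factor. -/
theorem binaryForm_ne_zero {q s : Fin 3 → ℂ} (h : NoCommonFactor (binaryForm q s))
    (hq : q 2 = 0) : s 2 ≠ 0 := by
  intro hs
  refine not_isUnit_X 0 (h _ fun i => ?_)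
  refine ⟨![(C (q 0) * X 0 + C (q 1) * X 1) * X 2 - (C (s 0) * X 0 + C (s 1) * X 1) * X 1,
    (C (s 0) * X 0 + C (s 1) * X 1) * X 0, - (C (q 0) * X 0 + C (q 1) * X 1) * X 0] i, ?_⟩
  fin_cases i <;> simp [binaryForm, quadForm, hq, hs] <;> ring

theorem exists_quadratic_root {a b c : ℂ} (hc : c ≠ 0) : ∃ r : ℂ, a + b * r + c * r ^ 2 = 0 := by
  obtain ⟨d, hd⟩ := IsAlgClosed.exists_pow_nat_eq (b ^ 2 - 4 * a * c) (n := 2) (by norm_num)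
  refine ⟨(d - b) / (2 * c), ?_⟩
  field_simp
  linear_combination hd

/-- The matrix is the field X ∂/∂Z. The equations kill the binary part U and every coefficient of V
and W in which Z occurs. -/
theorem exists_eq_binaryForm {ω : PolyForm} (hω : ω ∈ Form 2)
    (h : !![0, 0, 0; 0, 0, 0; 1, 0, 0] ∈ annihilator ω) : ∃ q s, ω = binaryForm q s := by
  obtain ⟨u, v, w, rfl⟩ := exists_eq_quadForm hω
  have e := annihilator_quadForm h
  simp at e
  obtain ⟨hv2, hv4, hv5, hu1, hu2, hw2, hw4, hw5, hu0, -⟩ := e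
  refine ⟨![v 0, v 1, v 3], ![w 0, w 1, w 3], ?_⟩
  rw [binaryForm]
  congr 1
  · funext i
    fin_cases i <;> simp [*]
  · funext i
    fin_cases i <;> simp [*]
  · funext i
    fin_cases i <;> simp [*]

/-- The distinction is by the roots of q. A double root at infinity, the first alternative, needs no
analysis of B. For a finite double root, either s is diagonal in the squares X² and (Y + t X)², or B
is a multiple of the known nilpotent. Two distinct roots always force the latter. -/
theorem binaryForm_cases {q s : Fin 3 → ℂ} (h : NoCommonFactor (binaryForm q s))
    {B : Matrix (Fin 3) (Fin 3) ℂ} (hB : B ∈ annihilator (binaryForm q s)) :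
    (q 1 = 0 ∧ q 2 = 0) ∨
    (∃ t a c : ℂ, q 2 ≠ 0 ∧ q 1 = 2 * q 2 * t ∧ q 0 = q 2 * t ^ 2 ∧ a ≠ 0 ∧ s 0 = a + c * t ^ 2 ∧
      s 1 = 2 * c * t ∧ s 2 = c) ∨
    B = B 2 0 • !![0, 0, 0; 0, 0, 0; 1, 0, 0] := by
  have e := annihilator_quadForm hB
  simp only [Matrix.cons_val, Pi.zero_apply] at e
  obtain ⟨u0, -, -, v0, v1, v2, v3, v4, -, w0, w1, w2, w3, w4, -⟩ := e
  have hroot := binaryForm_no_common_root h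
  have hinf := binaryForm_ne_zero h
  have hfin : B 0 0 = 0 → B 0 1 = 0 → B 0 2 = 0 → B 1 0 = 0 → B 1 1 = 0 → B 1 2 = 0 → B 2 1 = 0 →
      B 2 2 = 0 → B = B 2 0 • !![0, 0, 0; 0, 0, 0; 1, 0, 0] := by
    intros
    ext i j
    fin_cases i <;> fin_cases j <;> simp [*]
  by_cases hΔ : q 1 ^ 2 - 4 * q 0 * q 2 = 0
  · by_cases hq2 : q 2 = 0
    · rw [hq2] at hΔ
      exact Or.inl ⟨by simpa using hΔ, hq2⟩
    right
    obtain ⟨t, ht⟩ : ∃ t, q 1 = 2 * q 2 * t := ⟨q 1 / (2 * q 2), by field_simp⟩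
    have hq0 : q 0 = q 2 * t ^ 2 := by
      refine mul_left_cancel₀ (mul_ne_zero (by norm_num : (4 : ℂ) ≠ 0) hq2) ?_
      rw [ht] at hΔ
      linear_combination - hΔ
    have hS := hroot (-t) (by rw [hq0, ht]; ring)
    set S := s 0 + s 1 * -t + s 2 * (-t) ^ 2 with hSdef
    simp only [ht, hq0] at u0 v0 v1 v2 v3 v4 w0 w1 w2 w3 w4
    have b02 : B 0 2 = 0 := by
      refine (mul_eq_zero.mp (?_ : S * B 0 2 = 0)).resolve_left hS
      have hb12 : B 1 2 = - t * B 0 2 := by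
        refine mul_left_cancel₀ (mul_ne_zero (two_ne_zero' ℂ) hq2) ?_
        linear_combination v4
      rw [hb12] at w2 w4
      rw [hSdef]
      linear_combination (w2 - t * w4 - t ^ 2 * u0) / 3
    have b12 : B 1 2 = 0 := by
      refine (mul_eq_zero.mp (?_ : q 2 * B 1 2 = 0)).resolve_left hq2
      rw [b02] at v4
      linear_combination v4 / 2
    have b01 : B 0 1 = 0 := by
      refine (mul_eq_zero.mp (?_ : q 2 * B 0 1 = 0)).resolve_left hq2
      rw [b02] at u0
      linear_combination - u0
    simp only [b02, b12, b01] at u0 v0 v1 v2 v3 v4 w0 w1 w2 w3 w4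
    have b22 : B 2 2 = - B 0 0 - 2 * B 1 1 := by
      refine mul_left_cancel₀ hq2 ?_
      linear_combination v3
    have b10 : B 1 0 = - t * (B 0 0 - B 1 1) := by
      refine mul_left_cancel₀ (mul_ne_zero (two_ne_zero' ℂ) hq2) ?_
      rw [b22] at v1
      linear_combination v1
    rw [b10] at w0 w1
    -- The three equations are the coefficients of a binary quadratic identity; this combination
    -- evaluates it at the double root -t of q, where the terms in q disappear and s takes the value
    -- S ≠ 0.
    have k0 : (3 * B 0 0 + B 1 1) * S = 0 := by
      rw [hSdef]
      linear_combination w0 - t * w1 + t ^ 2 * w3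
    have b11 : B 1 1 = - 3 * B 0 0 := by
      have := (mul_eq_zero.mp k0).resolve_right hS
      linear_combination this
    by_cases b00 : B 0 0 = 0
    · right
      rw [b00, mul_zero] at b11
      have b21 : B 2 1 = 0 := by
        refine (mul_eq_zero.mp (?_ : q 2 * B 2 1 = 0)).resolve_left hq2
        rw [b11, b00] at w3
        linear_combination - w3
      exact hfin b00 b01 b02 (by rw [b10, b00, b11]; ring) b11 b12 b21 (by rw [b22, b00, b11]; ring)
    · left
      refine ⟨t, S, s 2, hq2, ht, hq0, hS, ?_, ?_, rfl⟩
      all_goals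
        have k1 : s 1 = 2 * s 2 * t := by
          refine mul_left_cancel₀ (mul_ne_zero (by norm_num : (4 : ℂ) ≠ 0) b00) ?_
          rw [b11] at w1 w3
          linear_combination - w1 + 2 * t * w3
      · rw [hSdef, k1]
        ring
      · exact k1
  · right
    right
    -- The equations `v2` and `v4` form a linear system in B 0 2 and B 1 2 whose determinant is, up
    -- to sign, the discriminant of q.
    have b02 : B 0 2 = 0 := by
      refine (mul_eq_zero.mp (?_ : (q 1 ^ 2 - 4 * q 0 * q 2) * B 0 2 = 0)).resolve_left hΔ
      linear_combination q 1 * v4 - 2 * q 2 * v2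
    have b12 : B 1 2 = 0 := by
      refine (mul_eq_zero.mp (?_ : (q 1 ^ 2 - 4 * q 0 * q 2) * B 1 2 = 0)).resolve_left hΔ
      linear_combination q 1 * v2 - 2 * q 0 * v4
    simp only [b02, b12] at u0 v0 v1 v2 v3 v4 w0 w1 w2 w3 w4
    have b01 : B 0 1 = 0 := by
      refine (mul_eq_zero.mp (?_ : (q 1 ^ 2 - 4 * q 0 * q 2) * B 0 1 = 0)).resolve_left hΔ
      linear_combination q 1 * w4 - 4 * q 2 * w2
    simp only [b01] at u0 v0 v1 v2 v3 v4 w0 w1 w2 w3 w4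
    by_cases hq2 : q 2 = 0
    · have hs2 := hinf hq2
      have hq1 : q 1 ≠ 0 := fun h1 => hΔ (by rw [h1, hq2]; ring)
      simp only [hq2] at u0 v0 v1 v2 v3 v4 w0 w1 w2 w3 w4
      have b00 : B 0 0 = - 3 * B 1 1 := by
        refine mul_left_cancel₀ hs2 ?_
        linear_combination w3
      simp only [b00] at u0 v0 v1 v2 v3 v4 w0 w1 w2 w3 w4
      have b22 : B 2 2 = 5 * B 1 1 := by
        refine mul_left_cancel₀ hq1 ?_
        linear_combination v1
      simp only [b22] at u0 v0 v1 v2 v3 v4 w0 w1 w2 w3 w4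
      have hr := hroot (- q 0 / q 1) (by rw [hq2]; field_simp; ring)
      have hr' : s 0 * q 1 ^ 2 - s 1 * q 0 * q 1 + s 2 * q 0 ^ 2 ≠ 0 := fun h0 => hr (by
        field_simp
        linear_combination h0)
      have b11 : B 1 1 = 0 := by
        refine (mul_eq_zero.mp
          (?_ : (s 0 * q 1 ^ 2 - s 1 * q 0 * q 1 + s 2 * q 0 ^ 2) * B 1 1 = 0)).resolve_left hr'
        linear_combination - q 1 ^ 2 / 8 * w0 + (q 0 * q 1 / 8) * w1
          + (q 1 * s 1 / 8 - q 0 * s 2 / 4) * v0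
      simp only [b11] at u0 v0 v1 v2 v3 v4 w0 w1 w2 w3 w4
      have b10 : B 1 0 = 0 := by
        refine (mul_eq_zero.mp (?_ : q 1 * B 1 0 = 0)).resolve_left hq1
        linear_combination v0
      simp only [b10] at u0 v0 v1 v2 v3 v4 w0 w1 w2 w3 w4
      have b21 : B 2 1 = 0 := by
        refine (mul_eq_zero.mp (?_ : q 1 * B 2 1 = 0)).resolve_left hq1
        linear_combination - w1
      exact hfin (by rw [b00, b11]; ring) b01 b02 b10 b11 b12 b21 (by rw [b22, b11]; ring)
    · have b22 : B 2 2 = - B 0 0 - 2 * B 1 1 := by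
        refine mul_left_cancel₀ hq2 ?_
        linear_combination v3
      simp only [b22] at u0 v0 v1 v2 v3 v4 w0 w1 w2 w3 w4
      have b00 : B 0 0 = B 1 1 := by
        refine sub_eq_zero.mp ((mul_eq_zero.mp
          (?_ : (q 1 ^ 2 - 4 * q 0 * q 2) * (B 0 0 - B 1 1) = 0)).resolve_left hΔ)
        linear_combination q 1 * v1 - 2 * q 2 * v0
      simp only [b00] at u0 v0 v1 v2 v3 v4 w0 w1 w2 w3 w4
      have b10 : B 1 0 = 0 := by
        refine (mul_eq_zero.mp (?_ : (q 1 ^ 2 - 4 * q 0 * q 2) * B 1 0 = 0)).resolve_left hΔ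
        linear_combination q 1 * v0 - 2 * q 0 * v1
      simp only [b10] at u0 v0 v1 v2 v3 v4 w0 w1 w2 w3 w4
      have b11 : B 1 1 = 0 := by
        by_contra hb
        obtain ⟨r, hr⟩ := exists_quadratic_root (a := q 0) (b := q 1) hq2
        refine hroot r hr (mul_left_cancel₀ (mul_ne_zero (by norm_num : (4 : ℂ) ≠ 0) hb) ?_)
        -- The equations say 4 B₁₁ s = B₂₁ q as binary forms. At a root r of q this gives s(r) = 0,
        -- a common root.
        linear_combination w0 + r * w1 + r ^ 2 * w3 + B 2 1 * hr
      simp only [b11] at u0 v0 v1 v2 v3 v4 w0 w1 w2 w3 w4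
      have b21 : B 2 1 = 0 := by
        refine (mul_eq_zero.mp (?_ : q 2 * B 2 1 = 0)).resolve_left hq2
        linear_combination - w3
      exact hfin (by rw [b00, b11]) b01 b02 b10 b11 b12 b21 (by rw [b22, b00, b11]; ring)

theorem form₁_eq_binaryForm : form₁ = binaryForm ![1, 0, 0] ![0, 0, 1] := by
  rw [form₁_eq]
  funext i
  fin_cases i <;> simp [binaryForm, quadForm] <;> ring

theorem form₅_eq_quadForm : form₅ = quadForm ![0, 0, 0] ![0, 1, 0, 0, 0, 0]
    ![0, 0, 1, 1, 0, 0] := by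
  rw [form₅_eq]
  funext i
  fin_cases i <;> simp [quadForm] <;> ring

/-- After this substitution q is a multiple of X² and s = a (Y + t X)² - a³ e X². The four
parameters reach any such pair with q ≠ 0 and s 2 ≠ 0. -/
theorem pull_form₁ (a t e g : ℂ) : pull !![a, 0, 0; t, 1, 0; 0, e, g] form₁
    = binaryForm ![a ^ 3 * g, 0, 0] ![a * t ^ 2 - a ^ 3 * e, 2 * a * t, a] := by
  have h2 : (C 2 : MvPolynomial (Fin 3) ℂ) = 2 := map_ofNat C 2
  rw [form₁_eq]
  funext j
  fin_cases j <;>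
    simp [pull, Fin.sum_univ_three, subst_X, binaryForm, quadForm, h2] <;> ring

/-- With X sent to a (Y + t X) and Y to X, the double root of q moves from infinity to -t, and s =
-a X² - a² d (Y + t X)², the shape of the second alternative in `binaryForm_cases`. -/
theorem pull_form₅ (a t d g : ℂ) : pull !![a * t, a, 0; 1, 0, 0; d * t, d, g] form₅
    = binaryForm ![a ^ 2 * g * t ^ 2, 2 * (a ^ 2 * g) * t, a ^ 2 * g]
        ![- a - a ^ 2 * d * t ^ 2, - 2 * (a ^ 2 * d) * t, - (a ^ 2 * d)] := by
  have h2 : (C 2 : MvPolynomial (Fin 3) ℂ) = 2 := map_ofNat C 2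
  rw [form₅_eq]
  funext j
  fin_cases j <;>
    simp [pull, Fin.sum_univ_three, subst_X, binaryForm, quadForm, h2] <;> ring

theorem exists_mul_eq_one_of_det {P : Matrix (Fin 3) (Fin 3) ℂ} (h : P.det ≠ 0) :
    ∃ Q, P * Q = 1 :=
  ⟨P⁻¹, Matrix.mul_nonsing_inv _ (isUnit_iff_ne_zero.mpr h)⟩

theorem binaryForm_classification {q s : Fin 3 → ℂ} (h : NoCommonFactor (binaryForm q s))
    (h2 : 2 ≤ Module.finrank ℂ (annihilator (binaryForm q s))) :
    ∃ P Q, P * Q = 1 ∧ (binaryForm q s = pull P form₁ ∨ binaryForm q s = pull P form₅) := by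
  obtain ⟨B, hB, hB0⟩ : ∃ B ∈ annihilator (binaryForm q s),
      B ≠ B 2 0 • !![0, 0, 0; 0, 0, 0; 1, 0, 0] := by
    by_contra! hall
    have hle : annihilator (binaryForm q s)
        ≤ Submodule.span ℂ {!![0, 0, 0; 0, 0, 0; 1, 0, 0]} := fun B hB =>
      Submodule.mem_span_singleton.mpr ⟨B 2 0, (hall B hB).symm⟩
    have := (Submodule.finrank_mono hle).trans (finrank_span_le_card _)
    simp at this
    omega
  rcases binaryForm_cases h hB with ⟨hq1, hq2⟩ | ⟨t, a, c, hq2, hq1, hq0, ha, hs0, hs1, hs2⟩ | h0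
  · have hs2 := binaryForm_ne_zero h hq2
    have hq0 : q 0 ≠ 0 := fun hq0 => by
      obtain ⟨r, hr⟩ := exists_quadratic_root (a := s 0) (b := s 1) hs2
      exact binaryForm_no_common_root h r (by rw [hq0, hq1, hq2]; ring) hr
    set t := s 1 / (2 * s 2) with ht
    set e := (s 2 * t ^ 2 - s 0) / s 2 ^ 3 with he
    set g := q 0 / s 2 ^ 3 with hg
    obtain ⟨Q, hQ⟩ := exists_mul_eq_one_of_det
      (P := !![s 2, 0, 0; t, 1, 0; 0, e, g]) (by
        simp [Matrix.det_fin_three, hg, hs2, hq0])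
    refine ⟨_, Q, hQ, Or.inl ?_⟩
    rw [pull_form₁]
    congr 1
    · funext i
      fin_cases i <;> simp [hq1, hq2]
      rw [hg]
      field_simp
    · funext i
      fin_cases i <;> simp
      · rw [he]
        field_simp
        ring
      · rw [ht]
        field_simp
  · obtain ⟨Q, hQ⟩ := exists_mul_eq_one_of_det
      (P := !![- a * t, - a, 0; 1, 0, 0; - c / a ^ 2 * t, - c / a ^ 2, q 2 / a ^ 2]) (by
        simp [Matrix.det_fin_three, ha, hq2])
    refine ⟨_, Q, hQ, Or.inr ?_⟩
    rw [pull_form₅]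
    congr 1
    · funext i
      fin_cases i <;> simp [hq1, hq0] <;> field_simp <;> simp
    · funext i
      fin_cases i <;> simp [hs0, hs1, hs2] <;> field_simp
      ring
  · exact absurd h0 hB0

/-- Only v 0, w 0 and w 3 survive: V = v₀ X² and W = v₀ X Y + (w₀ X² - 2 w₃ X Z + w₃ Y²). If w₃ = 0,
X is a common factor; if v₀ = 0, the conic in parentheses is. With both nonzero, the equations leave
B no freedom beyond multiples of the given nilpotent. -/
theorem regular_nilpotent_finrank_le {ω : PolyForm} (hω : ω ∈ Form 2) (h : NoCommonFactor ω)
    (hN : !![0, 0, 0; 1, 0, 0; 0, 1, 0] ∈ annihilator ω) :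
    Module.finrank ℂ (annihilator ω) ≤ 1 := by
  obtain ⟨u, v, w, rfl⟩ := exists_eq_quadForm hω
  obtain ⟨u0, u1, u2, v0, v1, v2, v3, v4, v5, w0, w1, w2, w3, w4, w5⟩ := annihilator_quadForm hN
  simp [-mul_eq_zero, -add_self_eq_zero] at u0 u1 u2 v0 v1 v2 v3 v4 v5 w0 w1 w2 w3 w4 w5
  have a1 : u 1 = 0 := u0
  have a2 : u 2 = 0 := by linear_combination u1 / 2
  have b1 : v 1 = 0 := by linear_combination v0
  have b4 : v 4 = 0 := by linear_combination v2
  have a0 : u 0 = 0 := by linear_combination (b4 - v3) / 3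
  have b5 : v 5 = 0 := by linear_combination v4 / 2 + a1
  have d5 : w 5 = 0 := by linear_combination w4 / 2 + b4 / 2 + a0
  have b3 : v 3 = 0 := by linear_combination (w2 - w3 + v1) / 3
  have d4 : w 4 = 0 := by linear_combination w3 + b3
  have b2 : v 2 = 0 := by linear_combination v1 - 2 * b3
  have d1 : w 1 = v 0 := by linear_combination w0
  have d2 : w 2 = - 2 * w 3 := by linear_combination w1 + b1
  have hβ : w 3 ≠ 0 := fun hβ => by
    refine not_isUnit_X 0 (h _ fun i => ?_)
    refine ⟨![C (v 0) * X 0 * X 2 - (C (w 0) * X 0 + C (v 0) * X 1) * X 1,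
      (C (w 0) * X 0 + C (v 0) * X 1) * X 0, - (C (v 0) * X 0) * X 0] i, ?_⟩
    fin_cases i <;> simp [quadForm, a0, a1, a2, b1, b2, b3, b4, b5, d1, d2, d4, d5, hβ] <;> ring
  have hγ : v 0 ≠ 0 := fun hγ => by
    refine not_isUnit_of_eval
      (d := C (w 0) * X 0 ^ 2 - C (2 * w 3) * X 0 * X 2 + C (w 3) * X 1 ^ 2) 0 (by simp)
      (h _ fun i => ?_)
    refine ⟨![- X 1, X 0, 0] i, ?_⟩
    fin_cases i <;> simp [quadForm, a0, a1, a2, b1, b2, b3, b4, b5, d1, d2, d4, d5, hγ] <;> ring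
  have hle : annihilator (quadForm u v w)
      ≤ Submodule.span ℂ {!![0, 0, 0; 1, 0, 0; 0, 1, 0]} := fun B hB => by
    obtain ⟨q0, q1, q2, q3, q4, q5, q6, q7, q8, q9, q10, q11, q12, q13, q14⟩ :=
      annihilator_quadForm hB
    simp only [a0, a1, b1, b2, b3, b4, b5, d1, d2, d4, d5] at q0 q3 q5 q9 q10 q11 q12 q13
    have c02 : B 0 2 = 0 := mul_right_cancel₀ hβ (by linear_combination - q0)
    have c12 : B 1 2 = 0 := mul_right_cancel₀ hβ (by linear_combination q5 / 2 - v 0 * c02)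
    have c01 : B 0 1 = 0 :=
      mul_right_cancel₀ hβ (by linear_combination - q13 / 2 + v 0 * c02 + w 3 * c12)
    have c22 : B 2 2 = - 3 * B 0 0 :=
      mul_right_cancel₀ hγ (by linear_combination q3 + w 0 * c12)
    have c11 : B 1 1 = B 0 0 := mul_right_cancel₀ hβ (by
      linear_combination - q11 / 2 + v 0 / 2 * c01 + 3 / 2 * w 0 * c02 + v 0 / 2 * c12 - w 3 * c22)
    have c00 : B 0 0 = 0 := mul_right_cancel₀ hβ (by
      linear_combination (q12 - v 0 * c01 - 3 * w 3 * c11) / 4)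
    rw [c00] at c11 c22
    have c10 : B 1 0 = B 2 1 := mul_right_cancel₀ hβ (by
      linear_combination q10 / 2 - w 0 * c01 - v 0 * c11 - v 0 * c00)
    have c20 : B 2 0 = 0 := mul_right_cancel₀ hβ (by
      linear_combination - (q9 - w 0 * c11 - 3 * w 0 * c00 - v 0 * c10) / 2)
    refine Submodule.mem_span_singleton.mpr ⟨B 2 1, ?_⟩
    ext i j
    fin_cases i <;> fin_cases j <;> simp [c00, c01, c02, c10, c11, c12, c20, c22]
  have := (Submodule.finrank_mono hle).trans (finrank_span_le_card _)
  simpa using this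

/-- A quadratic foliation whose symmetries form a space of dimension at least two is equivalent
to one of the two models. -/
theorem classification {ω : PolyForm} (hω : ω ∈ Form 2) (h : NoCommonFactor ω)
    (h2 : 2 ≤ Module.finrank ℂ (annihilator ω)) :
    ∃ P Q, P * Q = 1 ∧ (ω = pull P form₁ ∨ ω = pull P form₅) := by
  have h0 : ω ≠ 0 := by
    rintro rfl
    exact not_isUnit_zero (h 0 fun _ => dvd_rfl)
  have hnil : ∀ N ∈ annihilator ω, N ≠ 0 → IsNilpotent N →
      ∃ P Q, P * Q = 1 ∧ (ω = pull P form₁ ∨ ω = pull P form₅) := by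
    intro N hN hN0 hnN
    obtain ⟨P, Q, hPQ, hP⟩ := nilpotent_normal_form hnN hN0
    have hQP : Q * P = 1 := mul_eq_one_comm.mp hPQ
    have hη := pull_mem P hω
    have hηf := noCommonFactor_pull hPQ h
    have hη2 := h2.trans (annihilator_pull_finrank_le (ω := ω) hPQ)
    rcases hP with hP | hP
    · obtain ⟨q, s, e⟩ := exists_eq_binaryForm hη (mem_annihilator_pull hP hN)
      rw [e] at hηf hη2
      obtain ⟨R, S, hRS, hR⟩ := binaryForm_classification hηf hη2
      refine ⟨R * Q, P * S, ?_, ?_⟩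
      · rw [mul_assoc, ← mul_assoc Q, hQP, one_mul, hRS]
      · have hω' : ω = pull Q (binaryForm q s) := by rw [← e, pull_mul_inv hPQ]
        rw [hω', ← pull_pull, ← pull_pull]
        exact hR.imp (congrArg (pull Q)) (congrArg (pull Q))
    · have := regular_nilpotent_finrank_le hη hηf (mem_annihilator_pull hP hN)
      omega
  rcases exists_nilpotent_or_commuting (K := annihilator ω)
    (fun A hA B hB => commutator_mem_annihilator hA hB) h2 with
    ⟨N, hN, hN0, hnN⟩ | ⟨B, hB, C, hC, hBC, hli⟩
  · exact hnil N hN hN0 hnN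
  rw [LinearIndependent.pair_iff] at hli
  rcases nilpotent_or_diagonalizable (M := ![B, C]) hBC with
    ⟨x, y, c, hxy, hn⟩ | ⟨P, Q, d, hPQ, hd⟩
  · have hA : x • B + y • C ∈ annihilator ω :=
      Submodule.add_mem _ (Submodule.smul_mem _ _ hB) (Submodule.smul_mem _ _ hC)
    simp only [Matrix.cons_val] at hn
    -- The combination kills ω and is c plus a nilpotent matrix, so c vanishes and the combination
    -- itself is nilpotent.
    have hc : c = 0 := eq_zero_of_scalar_add_nilpotent hω h0 hn (by simpa using hA)
    rw [hc, zero_smul, sub_zero] at hn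
    refine hnil _ hA (fun hz => ?_) hn
    obtain ⟨hx, hy⟩ := hli x y hz
    rcases hxy with hx' | hy'
    · exact hx' hx
    · exact hy' hy
  · exfalso
    have hQP : Q * P = 1 := mul_eq_one_comm.mp hPQ
    refine not_diagonal_pair (d := d) (pull_mem P hω) (noCommonFactor_pull hPQ h) ?_ ?_
    · intro k
      refine mem_annihilator_pull (hd k) ?_
      fin_cases k
      · exact hB
      · exact hC
    · intro s t hst
      refine hli s t ?_
      have h1 : P * (s • Matrix.diagonal (d 0) + t • Matrix.diagonal (d 1)) * Q
          = s • B + t • C := by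
        rw [mul_add, mul_smul_comm, mul_smul_comm, hd, hd, add_mul, smul_mul_assoc, smul_mul_assoc,
          mul_assoc, mul_assoc, hPQ, mul_one, mul_one]
        rfl
      rw [← h1, ← Matrix.diagonal_smul, ← Matrix.diagonal_smul, Matrix.diagonal_add]
      have : (fun i => (s • d 0) i + (t • d 1) i) = 0 := hst
      rw [this]
      simp

/-! ### The symmetries of the two models -/

theorem annihilator_form₁ {B : Matrix (Fin 3) (Fin 3) ℂ} (h : B ∈ annihilator form₁) :
    B 0 1 = 0 ∧ B 0 2 = 0 ∧ B 1 0 = 0 ∧ B 1 2 = 0 ∧ B 2 1 = 0 ∧ B 0 0 = -3 * B 1 1 ∧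
      B 2 2 = 9 * B 1 1 := by
  rw [form₁_eq_binaryForm, binaryForm] at h
  obtain ⟨q0, q1, q2, q3, q4, q5, q6, q7, q8, q9, q10, q11, q12, q13, q14⟩ :=
    annihilator_quadForm h
  simp [-mul_eq_zero] at q0 q3 q4 q6 q9 q10 q12
  refine ⟨?_, ?_, ?_, ?_, ?_, ?_, ?_⟩
  · linear_combination q4 / 3
  · linear_combination q0
  · linear_combination q10 / 2
  · linear_combination q6
  · linear_combination q9
  · linear_combination q12
  · linear_combination q3 - 3 * q12

theorem annihilator_form₅ {B : Matrix (Fin 3) (Fin 3) ℂ} (h : B ∈ annihilator form₅) :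
    B 0 1 = 0 ∧ B 0 2 = 0 ∧ B 1 0 = 0 ∧ B 1 2 = 0 ∧ B 2 0 = 0 ∧ B 0 0 = -3 * B 1 1 ∧
      B 2 2 = 5 * B 1 1 := by
  rw [form₅_eq_quadForm] at h
  obtain ⟨q0, q1, q2, q3, q4, q5, q6, q7, q8, q9, q10, q11, q12, q13, q14⟩ :=
    annihilator_quadForm h
  simp [-mul_eq_zero] at q0 q3 q4 q6 q9 q12 q13
  have h12 : B 1 2 = 0 := by linear_combination (q13 - q6) / 3
  refine ⟨?_, ?_, ?_, h12, ?_, ?_, ?_⟩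
  · linear_combination q6 / 2 + h12 / 2
  · linear_combination q0
  · linear_combination q3
  · linear_combination q9
  · linear_combination q12
  · linear_combination q4 - 2 * q12

theorem mem_annihilator_form₁ (s t : ℂ) :
    !![-3 * s, 0, 0; 0, s, 0; t, 0, 9 * s] ∈ annihilator form₁ := by
  have h3 : (C 3 : MvPolynomial (Fin 3) ℂ) = 3 := map_ofNat C 3
  have h9 : (C 9 : MvPolynomial (Fin 3) ℂ) = 9 := map_ofNat C 9
  rw [mem_annihilator, form₁_eq_binaryForm, binaryForm, lieDer_quadForm]
  funext i
  fin_cases i <;> simp [quadForm, h3, h9] <;> ring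

theorem mem_annihilator_form₅ (s t : ℂ) :
    !![-3 * s, 0, 0; 0, s, 0; 0, t, 5 * s] ∈ annihilator form₅ := by
  have h2 : (C 2 : MvPolynomial (Fin 3) ℂ) = 2 := map_ofNat C 2
  have h3 : (C 3 : MvPolynomial (Fin 3) ℂ) = 3 := map_ofNat C 3
  have h5 : (C 5 : MvPolynomial (Fin 3) ℂ) = 5 := map_ofNat C 5
  rw [mem_annihilator, form₅_eq_quadForm, lieDer_quadForm]
  funext i
  fin_cases i <;> simp [quadForm, h2, h3, h5] <;> ring

theorem annihilator_form₁_finrank_le : Module.finrank ℂ (annihilator form₁) ≤ 2 := by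
  refine (LinearMap.finrank_le_finrank_of_injective (f := (LinearMap.pi
    ![Matrix.entryLinearMap ℂ ℂ 1 1, Matrix.entryLinearMap ℂ ℂ 2 0] :
      Matrix (Fin 3) (Fin 3) ℂ →ₗ[ℂ] Fin 2 → ℂ).domRestrict (annihilator form₁)) ?_).trans
    (by simp)
  rw [← LinearMap.ker_eq_bot, LinearMap.ker_eq_bot']
  rintro ⟨B, hB⟩ h
  have h1 : B 1 1 = 0 := congrFun h 0
  have h2 : B 2 0 = 0 := congrFun h 1
  obtain ⟨a1, a2, a3, a4, a5, a6, a7⟩ := annihilator_form₁ hB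
  refine Subtype.ext (Matrix.ext fun i j => ?_)
  fin_cases i <;> fin_cases j <;> simp [*]

theorem annihilator_form₅_finrank_le : Module.finrank ℂ (annihilator form₅) ≤ 2 := by
  refine (LinearMap.finrank_le_finrank_of_injective (f := (LinearMap.pi
    ![Matrix.entryLinearMap ℂ ℂ 1 1, Matrix.entryLinearMap ℂ ℂ 2 1] :
      Matrix (Fin 3) (Fin 3) ℂ →ₗ[ℂ] Fin 2 → ℂ).domRestrict (annihilator form₅)) ?_).trans
    (by simp)
  rw [← LinearMap.ker_eq_bot, LinearMap.ker_eq_bot']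
  rintro ⟨B, hB⟩ h
  have h1 : B 1 1 = 0 := congrFun h 0
  have h2 : B 2 1 = 0 := congrFun h 1
  obtain ⟨a1, a2, a3, a4, a5, a6, a7⟩ := annihilator_form₅ hB
  refine Subtype.ext (Matrix.ext fun i j => ?_)
  fin_cases i <;> fin_cases j <;> simp [*]

/-- An automorphism preserving the foliation normalizes the annihilator, because pull-back by it
only rescales ω. -/
theorem conj_mem_annihilator {ω : PolyForm} (h0 : ω ≠ 0) {P Q B : Matrix (Fin 3) (Fin 3) ℂ} {c : ℂ}
    (hPQ : P * Q = 1) (h : pull P ω = c • ω) (hB : B ∈ annihilator ω) :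
    Q * B * P ∈ annihilator ω := by
  have hc : c ≠ 0 := by
    rintro rfl
    rw [zero_smul] at h
    refine h0 ?_
    rw [← pull_mul_inv hPQ ω, h]
    funext j
    simp [pull]
  have h1 := mem_annihilator_pull (A := Q * B * P) (P := P)
    (by rw [← mul_assoc, ← mul_assoc, hPQ, one_mul]) hB
  rw [h, mem_annihilator, lieDer_smul_right] at h1
  exact (smul_eq_zero.mp h1).resolve_left hc

theorem form₁_ne_zero : form₁ ≠ 0 := by
  rw [form₁_eq]
  intro h
  have := congrArg (eval ![1, 0, 0]) (congrFun h 2)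
  simp at this

theorem form₅_ne_zero : form₅ ≠ 0 := by
  rw [form₅_eq]
  intro h
  have := congrArg (eval ![0, 1, 0]) (congrFun h 0)
  simp at this

/-- The linear automorphisms preserving the first model. -/
theorem shape_of_pull_form₁ {P Q : Matrix (Fin 3) (Fin 3) ℂ} {c : ℂ} (hPQ : P * Q = 1)
    (h : pull P form₁ = c • form₁) :
    P = !![P 0 0, 0, 0; 0, P 1 1, 0; P 2 0, 0, P 2 2] ∧ P 0 0 ≠ 0 ∧ P 1 1 ≠ 0 ∧ P 2 2 ≠ 0 ∧
      P 2 2 * P 0 0 ^ 2 = P 1 1 ^ 3 := by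
  have hd : P.det ≠ 0 := fun h0 => by
    have := congrArg Matrix.det hPQ
    simp [h0] at this
  -- The conjugate of an element of the annihilator has again the explicit shape. Its trace 7s is
  -- unchanged, so the diagonal parameter s is preserved; the nilpotent element and the semisimple
  -- element then give the linear equations on the entries of P.
  have key : ∀ s t, ∃ s' t', P * !![-3 * s', 0, 0; 0, s', 0; t', 0, 9 * s']
      = !![-3 * s, 0, 0; 0, s, 0; t, 0, 9 * s] * P ∧ s' = s := by
    intro s t
    have hm := conj_mem_annihilator form₁_ne_zero hPQ h (mem_annihilator_form₁ s t)
    set N := !![-3 * s, 0, 0; 0, s, 0; t, 0, 9 * s] with hN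
    have htr : (Q * N * P).trace = N.trace := by
      rw [Matrix.trace_mul_comm, ← mul_assoc, hPQ, one_mul]
    have hmul : P * (Q * N * P) = N * P := by rw [← mul_assoc, ← mul_assoc, hPQ, one_mul]
    generalize Q * N * P = M at hm htr hmul
    obtain ⟨a1, a2, a3, a4, a5, a6, a7⟩ := annihilator_form₁ hm
    refine ⟨M 1 1, M 2 0, ?_, ?_⟩
    · rw [← hmul]
      congr 1
      ext i j
      fin_cases i <;> fin_cases j <;> simp [*]
    · simp [hN, Matrix.trace_fin_three] at htr
      linear_combination (htr - a6 - a7) / 7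
  obtain ⟨s, t, e, rfl⟩ := key 0 1
  obtain ⟨s', t', e', rfl⟩ := key 1 0
  have f : ∀ i j, _ := fun i j => congrFun (congrFun e i) j
  have f' : ∀ i j, _ := fun i j => congrFun (congrFun e' i) j
  simp only [Matrix.mul_apply, Fin.sum_univ_three] at f f'
  have a1 := f 2 1
  have a2 := f 2 2
  have a3 := f 1 0
  have a4 := f 2 0
  have b1 := f' 1 0
  have b2 := f' 2 1
  simp [-mul_eq_zero, -zero_eq_mul] at a1 a2 a3 a4 b1 b2
  have p01 : P 0 1 = 0 := by simpa using a1.symm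
  have p02 : P 0 2 = 0 := by simpa using a2.symm
  rw [Matrix.det_fin_three, p01, p02] at hd
  have p00 : P 0 0 ≠ 0 := fun h0 => hd (by rw [h0]; ring)
  have ht : t ≠ 0 := fun h0 => p00 (by rw [← a4, h0, mul_zero])
  have p12 : P 1 2 = 0 := by
    have : P 1 2 * t = 0 := by linear_combination a3
    exact (mul_eq_zero.mp this).resolve_right ht
  rw [p12] at b1 hd
  have p10 : P 1 0 = 0 := by linear_combination - b1 / 4
  have p21 : P 2 1 = 0 := by linear_combination - b2 / 8
  have p11 : P 1 1 ≠ 0 := fun h0 => hd (by rw [h0]; ring)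
  have p22 : P 2 2 ≠ 0 := fun h0 => hd (by rw [h0]; ring)
  refine ⟨?_, p00, p11, p22, ?_⟩
  · ext i j
    fin_cases i <;> fin_cases j <;> simp [p01, p02, p10, p12, p21]
  -- The last relation compares two expressions of the factor c, from the term X Y² dY and from the
  -- term -X³ dZ.
  · rw [form₁_eq] at h
    have h1 := congrArg (eval ![1, 1, 0]) (congrFun h 1)
    have h2 := congrArg (eval ![1, 0, 0]) (congrFun h 2)
    simp [pull, Fin.sum_univ_three, subst_X, p01, p02, p10, p21, p12] at h1 h2
    refine mul_left_cancel₀ p00 ?_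
    linear_combination h2 - h1

/-- The linear automorphisms preserving the second model. -/
theorem shape_of_pull_form₅ {P Q : Matrix (Fin 3) (Fin 3) ℂ} {c : ℂ} (hPQ : P * Q = 1)
    (h : pull P form₅ = c • form₅) :
    P = !![P 0 0, 0, 0; 0, P 1 1, 0; 0, P 2 1, P 2 2] ∧ P 0 0 ≠ 0 ∧ P 1 1 ≠ 0 ∧ P 2 2 ≠ 0 ∧
      P 2 2 * P 0 0 = P 1 1 ^ 2 := by
  have hd : P.det ≠ 0 := fun h0 => by
    have := congrArg Matrix.det hPQ
    simp [h0] at this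
  have key : ∀ s t, ∃ s' t', P * !![-3 * s', 0, 0; 0, s', 0; 0, t', 5 * s']
      = !![-3 * s, 0, 0; 0, s, 0; 0, t, 5 * s] * P ∧ s' = s := by
    intro s t
    have hm := conj_mem_annihilator form₅_ne_zero hPQ h (mem_annihilator_form₅ s t)
    set N := !![-3 * s, 0, 0; 0, s, 0; 0, t, 5 * s] with hN
    have htr : (Q * N * P).trace = N.trace := by
      rw [Matrix.trace_mul_comm, ← mul_assoc, hPQ, one_mul]
    have hmul : P * (Q * N * P) = N * P := by rw [← mul_assoc, ← mul_assoc, hPQ, one_mul]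
    generalize Q * N * P = M at hm htr hmul
    obtain ⟨a1, a2, a3, a4, a5, a6, a7⟩ := annihilator_form₅ hm
    refine ⟨M 1 1, M 2 1, ?_, ?_⟩
    · rw [← hmul]
      congr 1
      ext i j
      fin_cases i <;> fin_cases j <;> simp [*]
    · simp [hN, Matrix.trace_fin_three] at htr
      linear_combination (htr - a6 - a7) / 3
  obtain ⟨s, t, e, rfl⟩ := key 0 1
  obtain ⟨s', t', e', rfl⟩ := key 1 0
  have f : ∀ i j, _ := fun i j => congrFun (congrFun e i) j
  have f' : ∀ i j, _ := fun i j => congrFun (congrFun e' i) j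
  simp only [Matrix.mul_apply, Fin.sum_univ_three] at f f'
  have a1 := f 2 0
  have a2 := f 2 2
  have a3 := f 0 1
  have a4 := f 2 1
  have b1 := f' 0 1
  have b2 := f' 2 0
  simp [-mul_eq_zero, -zero_eq_mul] at a1 a2 a3 a4 b1 b2
  have p10 : P 1 0 = 0 := by simpa using a1.symm
  have p12 : P 1 2 = 0 := by simpa using a2.symm
  rw [Matrix.det_fin_three, p10, p12] at hd
  have p11 : P 1 1 ≠ 0 := fun h0 => hd (by rw [h0]; ring)
  have ht : t ≠ 0 := fun h0 => p11 (by rw [← a4, h0, mul_zero])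
  have p02 : P 0 2 = 0 := by
    have : P 0 2 * t = 0 := by linear_combination a3
    exact (mul_eq_zero.mp this).resolve_right ht
  rw [p02] at b1 hd
  have p01 : P 0 1 = 0 := by linear_combination b1 / 4
  have p20 : P 2 0 = 0 := by linear_combination - b2 / 8
  have p00 : P 0 0 ≠ 0 := fun h0 => hd (by rw [h0]; ring)
  have p22 : P 2 2 ≠ 0 := fun h0 => hd (by rw [h0]; ring)
  refine ⟨?_, p00, p11, p22, ?_⟩
  · ext i j
    fin_cases i <;> fin_cases j <;> simp [p01, p02, p10, p12, p20]
  -- Here c is read off from the terms -Y³ dX and -X² Y dZ.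
  · rw [form₅_eq] at h
    have h1 := congrArg (eval ![0, 1, 0]) (congrFun h 0)
    have h2 := congrArg (eval ![1, 1, 0]) (congrFun h 2)
    simp [pull, Fin.sum_univ_three, subst_X, p01, p02, p10, p20, p12] at h1 h2
    refine mul_left_cancel₀ (mul_ne_zero p00 p11) ?_
    linear_combination h2 - h1

/-! ### The isotropy groups of the two models -/

theorem aut_mem_iso {N : ℕ} {ω : Form N} (h : NoCommonFactor (ω : PolyForm))
    {A : Matrix (Fin 3) (Fin 3) ℂ} (hA : A.det ≠ 0) {c : ℂ} (hc : pull A ω = c • (ω : PolyForm)) :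
    aut A hA ∈ Iso (Foliation.mk ω h) := by
  rw [← inv_mem_iff, aut, ← map_inv]
  exact (mk_smul_eq_iff _ ω h).mpr ⟨c, by rw [inv_inv]; exact hc⟩

theorem exists_pull_eq_of_mem_iso {N : ℕ} {ω : Form N} (h : NoCommonFactor (ω : PolyForm))
    {g : GL (Fin 3) ℂ} (hg : Matrix.ProjGenLinGroup.mk g ∈ Iso (Foliation.mk ω h)) :
    ∃ c : ℂ, pull g.val ω = c • (ω : PolyForm) := by
  rw [← inv_mem_iff, ← map_inv] at hg
  simpa using (mk_smul_eq_iff _ ω h).mp hg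

theorem mk_eq_aut_mul_aut {g : GL (Fin 3) ℂ} {A B : Matrix (Fin 3) (Fin 3) ℂ} (hA : A.det ≠ 0)
    (hB : B.det ≠ 0) :
    (Matrix.ProjGenLinGroup.mk g : PGL(3, ℂ)) = aut A hA * aut B hB ↔
      ∃ c : ℂˣ, c.val • g.val = A * B := by
  rw [aut, aut, ← map_mul, Matrix.ProjGenLinGroup.mk_eq_mk_iff]
  refine exists_congr fun u => ?_
  rw [← Units.val_inj, Units.val_mul, Units.val_mul]
  have : (Matrix.GeneralLinearGroup.scalar (Fin 3) u).val = u.val • (1 : Matrix (Fin 3) (Fin 3) ℂ) :=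
    (Matrix.smul_one_eq_diagonal _).symm
  rw [this, Matrix.mul_smul, mul_one]
  rfl

theorem iso_F₁ : (Iso F₁ : Set PGL(3, ℂ)) =
    {g | ∃ (α : ℂˣ) (β : ℂ), g = diagAut (α ^ 3) (α ^ 2) * shearX β} := by
  ext g
  constructor
  · intro hg
    induction g using Matrix.ProjGenLinGroup.induction_on with
    | mk g =>
      obtain ⟨c, hc⟩ := exists_pull_eq_of_mem_iso form₁_noCommonFactor hg
      obtain ⟨hP, p0, p1, p2, hrel⟩ := shape_of_pull_form₁ (Units.mul_inv g) hc
      -- Normalize the last diagonal entry to 1. With α = P₀₀ / P₁₁ the relation P₂₂ P₀₀² = P₁₁³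
      -- gives α³ = P₀₀ / P₂₂ and α² = P₁₁ / P₂₂.
      refine ⟨Units.mk0 _ (div_ne_zero p0 p1), g.val 2 0 / g.val 2 2,
        (mk_eq_aut_mul_aut _ _).mpr ⟨Units.mk0 _ (inv_ne_zero p2), ?_⟩⟩
      have z01 : g.val 0 1 = 0 := congrFun (congrFun hP 0) 1
      have z02 : g.val 0 2 = 0 := congrFun (congrFun hP 0) 2
      have z10 : g.val 1 0 = 0 := congrFun (congrFun hP 1) 0
      have z12 : g.val 1 2 = 0 := congrFun (congrFun hP 1) 2
      have z21 : g.val 2 1 = 0 := congrFun (congrFun hP 2) 1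
      clear hP hc hg
      generalize g.val = P at *
      ext i j
      fin_cases i <;> fin_cases j <;>
        simp [z01, z02, z10, z12, z21]
      · field_simp
        linear_combination - hrel
      · field_simp
        linear_combination - hrel
      · field_simp
      · exact inv_mul_cancel₀ p2
  · rintro ⟨α, β, rfl⟩
    refine mul_mem (aut_mem_iso form₁_noCommonFactor _ (c := α.val ^ 9) ?_)
      (aut_mem_iso form₁_noCommonFactor _ (c := 1) ?_)
    · change pull _ form₁ = _ • form₁
      rw [form₁_eq]
      funext j
      fin_cases j <;> simp [pull, Fin.sum_univ_three, subst_X, smul_eq_C_mul] <;> ring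
    · change pull _ form₁ = _ • form₁
      rw [form₁_eq]
      funext j
      fin_cases j <;> simp [pull, Fin.sum_univ_three, subst_X]
      ring

theorem iso_F₅ : (Iso F₅ : Set PGL(3, ℂ)) =
    {g | ∃ (α : ℂˣ) (β : ℂ), g = diagAut (α ^ 2) α * shearY β} := by
  ext g
  constructor
  · intro hg
    induction g using Matrix.ProjGenLinGroup.induction_on with
    | mk g =>
      obtain ⟨c, hc⟩ := exists_pull_eq_of_mem_iso form₅_noCommonFactor hg
      obtain ⟨hP, p0, p1, p2, hrel⟩ := shape_of_pull_form₅ (Units.mul_inv g) hc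
      refine ⟨Units.mk0 _ (div_ne_zero p1 p2), g.val 2 1 / g.val 2 2,
        (mk_eq_aut_mul_aut _ _).mpr ⟨Units.mk0 _ (inv_ne_zero p2), ?_⟩⟩
      have z01 : g.val 0 1 = 0 := congrFun (congrFun hP 0) 1
      have z02 : g.val 0 2 = 0 := congrFun (congrFun hP 0) 2
      have z10 : g.val 1 0 = 0 := congrFun (congrFun hP 1) 0
      have z12 : g.val 1 2 = 0 := congrFun (congrFun hP 1) 2
      have z20 : g.val 2 0 = 0 := congrFun (congrFun hP 2) 0
      clear hP hc hg
      generalize g.val = P at *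
      ext i j
      fin_cases i <;> fin_cases j <;>
        simp [z01, z02, z10, z12, z20]
      · field_simp
        linear_combination hrel
      · field_simp
      · field_simp
      · exact inv_mul_cancel₀ p2
  · rintro ⟨α, β, rfl⟩
    refine mul_mem (aut_mem_iso form₅_noCommonFactor _ (c := α.val ^ 5) ?_)
      (aut_mem_iso form₅_noCommonFactor _ (c := 1) ?_)
    · change pull _ form₅ = _ • form₅
      rw [form₅_eq]
      funext j
      fin_cases j <;> simp [pull, Fin.sum_univ_three, subst_X, smul_eq_C_mul] <;> ring
    · change pull _ form₅ = _ • form₅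
      rw [form₅_eq]
      funext j
      fin_cases j <;> simp [pull, Fin.sum_univ_three, subst_X]
      ring

/-- The element α = 2, β = 0 of the first group has eigenvalues 8, 4, 1. In the second group they
are a², a, 1, whose elementary symmetric functions satisfy e₂³ = e₃ e₁³, a relation invariant under
rescaling. -/
theorem iso_not_conj (g : PGL(3, ℂ)) : (Iso F₁).map (MulAut.conj g).toMonoidHom ≠ Iso F₅ := by
  intro h
  induction g using Matrix.ProjGenLinGroup.induction_on with
  | mk g =>
    let α : ℂˣ := Units.mk0 2 two_ne_zero
    have h1 : diagAut (α ^ 3) (α ^ 2) * shearX 0 ∈ (Iso F₁ : Set PGL(3, ℂ)) := by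
      rw [iso_F₁]
      exact ⟨α, 0, rfl⟩
    have h2 := Subgroup.mem_map_of_mem (MulAut.conj (Matrix.ProjGenLinGroup.mk g)).toMonoidHom h1
    rw [h, ← SetLike.mem_coe, iso_F₅] at h2
    obtain ⟨a, b, hab⟩ := h2
    change Matrix.ProjGenLinGroup.mk g * (Matrix.ProjGenLinGroup.mk _ *
      Matrix.ProjGenLinGroup.mk _) * (Matrix.ProjGenLinGroup.mk g)⁻¹ = _ at hab
    rw [← map_inv, ← map_mul, ← map_mul, ← map_mul] at hab
    obtain ⟨c, hc⟩ := (mk_eq_aut_mul_aut _ _).mp hab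
    change c.val • (g.val * (!![(α ^ 3).val, 0, 0; 0, (α ^ 2).val, 0; 0, 0, 1] *
      !![1, 0, 0; 0, 1, 0; 0, 0, 1]) * (g⁻¹).val) = _ at hc
    have hN : !![(α ^ 3).val, 0, 0; 0, (α ^ 2).val, 0; 0, 0, 1] * !![1, 0, 0; 0, 1, 0; 0, 0, 1]
        = (!![8, 0, 0; 0, 4, 0; 0, 0, 1] : Matrix (Fin 3) (Fin 3) ℂ) := by
      ext i j
      fin_cases i <;> fin_cases j <;> simp [α] <;> norm_num
    rw [hN] at hc
    have hM : !![(a ^ 2).val, 0, 0; 0, a.val, 0; 0, 0, 1] * !![1, 0, 0; 0, 1, 0; 0, b, 1]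
        = !![a.val ^ 2, 0, 0; 0, a.val, 0; 0, b, 1] := by
      ext i j
      fin_cases i <;> fin_cases j <;> simp [Matrix.mul_apply, Fin.sum_univ_three]
    rw [hM] at hc
    have hg : (g⁻¹).val * g.val = 1 := Units.inv_mul g
    have hg' : g.val * (g⁻¹).val = 1 := Units.mul_inv g
    have hc0 := c.ne_zero
    have ha0 := a.ne_zero
    generalize g.val = G at hc hg hg'
    generalize (g⁻¹).val = G' at hc hg hg'
    generalize c.val = c at hc hc0
    generalize a.val = a at hc ha0
    have t1 := congrArg Matrix.trace hc
    have t2 := congrArg (fun M => (M * M).trace) hc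
    have t3 := congrArg Matrix.det hc
    have e2 : ∀ N : Matrix (Fin 3) (Fin 3) ℂ, G * N * G' * (G * N * G') = G * (N * N) * G' := by
      intro N
      calc G * N * G' * (G * N * G') = G * N * (G' * G) * N * G' := by simp only [mul_assoc]
        _ = _ := by rw [hg, mul_one, mul_assoc G N N]
    have hd : G.det * G'.det = 1 := by rw [← Matrix.det_mul, hg', Matrix.det_one]
    simp only [Matrix.smul_mul, Matrix.mul_smul, e2] at t2
    rw [Matrix.trace_smul, Matrix.trace_mul_comm, ← mul_assoc, hg, one_mul] at t1
    rw [Matrix.trace_smul, Matrix.trace_smul, Matrix.trace_mul_comm, ← mul_assoc, hg, one_mul] at t2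
    rw [Matrix.det_smul, Matrix.det_mul, Matrix.det_mul, mul_right_comm, hd, one_mul] at t3
    simp [Matrix.trace_fin_three, Matrix.det_fin_three] at t1 t2 t3
    have e1 : a ^ 2 + a + 1 = 13 * c := by linear_combination - t1
    have e2' : a * (a ^ 2 + a + 1) = 44 * c ^ 2 := by
      linear_combination (t2 - (c * 13 + a ^ 2 + a + 1) * t1) / 2
    have e3 : a ^ 3 = 32 * c ^ 3 := by linear_combination - t3
    -- For c (8, 4, 1) the symmetric functions are 13 c, 44 c², 32 c³, and 44³ ≠ 32 · 13³.
    have : c ^ 6 * (44 ^ 3 - 32 * 13 ^ 3) = 0 := by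
      have h6 : (a * (a ^ 2 + a + 1)) ^ 3 = a ^ 3 * (a ^ 2 + a + 1) ^ 3 := by ring
      rw [e2', e1, e3] at h6
      linear_combination h6
    rcases mul_eq_zero.mp this with h | h
    · exact hc0 (pow_eq_zero_iff (by norm_num) |>.mp h)
    · norm_num at h

theorem orbits_ne : Orbit F₁ ≠ Orbit F₅ := by
  intro h
  have h5 : F₅ ∈ Orbit F₁ := by
    rw [h]
    exact MulAction.mem_orbit_self F₅
  obtain ⟨g, hg⟩ := h5
  have h1 := MulAction.stabilizer_smul_eq_stabilizer_map_conj g F₁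
  change g • F₁ = F₅ at hg
  rw [hg] at h1
  exact iso_not_conj g h1.symm

/-! ### The cone over an orbit -/

theorem pull_scalar {N : ℕ} {ω : PolyForm} (hω : ω ∈ Form N) (s : ℂ) :
    pull (Matrix.scalar (Fin 3) s) ω = s ^ (N + 2) • ω := by
  funext j
  simp only [pull, subst_scalar (hω.1 _)]
  simp [Matrix.scalar_apply, Matrix.diagonal_apply, apply_ite, ite_mul, smul_eq_C_mul]
  ring

/-- The scalar matrix s multiplies forms by s ^ (N + 2), so the constant in a projective equality is
absorbed by extracting a root. The cone is thus a single orbit of invertible matrices. -/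
theorem mem_cone_orbit {N : ℕ} {ω : Form N} (h : NoCommonFactor (ω : PolyForm)) {v : Form N} :
    v ∈ cone ((fun G : Foliation N => G.1) '' Orbit (Foliation.mk ω h)) ↔
      ∃ P Q : Matrix (Fin 3) (Fin 3) ℂ, P * Q = 1 ∧ (v : PolyForm) = pull P ω := by
  constructor
  · rintro ⟨hv, G, hG, e⟩
    dsimp only at e
    have hn : NoCommonFactor (v : PolyForm) :=
      (noCommonFactor_rep v hv).mp (e ▸ G.2)
    have hGv : G = Foliation.mk v hn := Subtype.ext e
    rw [hGv] at hG
    obtain ⟨P, Q, c, hPQ, hc, hv'⟩ := exists_pull_of_mem_orbit h hn hG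
    obtain ⟨s, hs⟩ := IsAlgClosed.exists_pow_nat_eq c (n := N + 2) (by omega)
    have hs0 : s ≠ 0 := by
      rintro rfl
      rw [zero_pow (by omega)] at hs
      exact hc hs.symm
    refine ⟨P * Matrix.scalar (Fin 3) s, Matrix.scalar (Fin 3) s⁻¹ * Q, ?_, ?_⟩
    · rw [mul_assoc, ← mul_assoc (Matrix.scalar (Fin 3) s), ← map_mul, mul_inv_cancel₀ hs0,
        map_one, one_mul, hPQ]
    · rw [← pull_pull, pull_scalar (pull_mem P ω.2), hs, hv']
  · rintro ⟨P, Q, hPQ, hv⟩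
    have hn : NoCommonFactor (v : PolyForm) := hv ▸ noCommonFactor_pull hPQ h
    exact ⟨ne_zero_of_noCommonFactor hn, Foliation.mk v hn, mem_orbit_of_pull h hn hPQ hv, rfl⟩

/-! ### Linear functionals of a pull-back, as functions of the matrix -/

/-- The matrix with given entries. -/
def ofEntries (a : Fin 3 × Fin 3 → ℂ) : Matrix (Fin 3) (Fin 3) ℂ := Matrix.of fun i j => a (i, j)

theorem ofEntries_apply (a : Fin 3 × Fin 3 → ℂ) (i j : Fin 3) : ofEntries a i j = a (i, j) := rfl

/-- The factor X l produced by the substitution is absorbed in the functional; this is why the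
inductions on p below let ψ vary. -/
theorem functional_subst_mul_X (ψ : MvPolynomial (Fin 3) ℂ →ₗ[ℂ] ℂ) (A : Matrix (Fin 3) (Fin 3) ℂ)
    (p : MvPolynomial (Fin 3) ℂ) (k : Fin 3) :
    ψ (subst A (p * X k)) = ∑ l, A k l * (ψ ∘ₗ LinearMap.mulRight ℂ (X l)) (subst A p) := by
  rw [map_mul, subst_X, Finset.mul_sum, map_sum]
  refine Finset.sum_congr rfl fun l _ => ?_
  rw [LinearMap.comp_apply, LinearMap.mulRight_apply, ← smul_eq_mul (A k l), ← map_smul,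
    smul_eq_C_mul]
  congr 1
  ring

/-- The form `p dX`, `p dY` or `p dZ`. -/
def singleForm (j : Fin 3) : MvPolynomial (Fin 3) ℂ →ₗ[ℂ] PolyForm :=
  LinearMap.single ℂ (fun _ => MvPolynomial (Fin 3) ℂ) j

theorem singleForm_apply (j k : Fin 3) (p : MvPolynomial (Fin 3) ℂ) :
    singleForm j p k = if k = j then p else 0 := by
  simp [singleForm, Pi.single_apply]

theorem functional_pull (ψ : PolyForm →ₗ[ℂ] ℂ) (A : Matrix (Fin 3) (Fin 3) ℂ) (ω : PolyForm) :
    ψ (pull A ω) = ∑ j, ∑ i, A i j * (ψ ∘ₗ singleForm j) (subst A (ω i)) := by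
  have e : pull A ω = ∑ j, ∑ i, A i j • singleForm j (subst A (ω i)) := by
    funext k
    simp only [pull, Finset.sum_apply, Pi.smul_apply, singleForm_apply, smul_eq_C_mul]
    rw [Finset.sum_comm]
    simp
  rw [e]
  simp only [map_sum, map_smul, smul_eq_mul, LinearMap.comp_apply]

theorem exists_functional_subst (p : MvPolynomial (Fin 3) ℂ) (ψ : MvPolynomial (Fin 3) ℂ →ₗ[ℂ] ℂ) :
    ∃ G : MvPolynomial (Fin 3 × Fin 3) ℂ, ∀ a, ψ (subst (ofEntries a) p) = eval a G := by
  induction p using MvPolynomial.induction_on generalizing ψ with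
  | C c => exact ⟨C (ψ (C c)), fun a => by rw [subst_C, eval_C]⟩
  | add p q hp hq =>
    obtain ⟨G, hG⟩ := hp ψ
    obtain ⟨H, hH⟩ := hq ψ
    exact ⟨G + H, fun a => by rw [map_add, map_add, map_add, hG, hH]⟩
  | mul_X p k hp =>
    choose G hG using fun l => hp (ψ ∘ₗ LinearMap.mulRight ℂ (X l))
    refine ⟨∑ l, X (k, l) * G l, fun a => ?_⟩
    rw [functional_subst_mul_X]
    simp [hG, ofEntries_apply]

theorem exists_functional_pull (ω : PolyForm) (ψ : PolyForm →ₗ[ℂ] ℂ) :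
    ∃ G : MvPolynomial (Fin 3 × Fin 3) ℂ, ∀ a, ψ (pull (ofEntries a) ω) = eval a G := by
  choose G hG using fun j i => exists_functional_subst (ω i) (ψ ∘ₗ singleForm j)
  refine ⟨∑ j, ∑ i, X (i, j) * G j i, fun a => ?_⟩
  rw [functional_pull]
  simp only [hG, ofEntries_apply, map_sum, map_mul, eval_X]

/-- The matrix as a linear function of its entries. -/
def ofEntriesₗ : (Fin 3 × Fin 3 → ℂ) →ₗ[ℂ] Matrix (Fin 3) (Fin 3) ℂ where
  toFun := ofEntries
  map_add' _ _ := rfl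
  map_smul' _ _ := rfl

/-- The entries of the identity matrix. -/
def oneEntries : Fin 3 × Fin 3 → ℂ := fun x => (1 : Matrix (Fin 3) (Fin 3) ℂ) x.1 x.2

theorem ofEntries_oneEntries : ofEntries oneEntries = 1 := rfl

/-- `linDer` as a linear function of the matrix. -/
def linDerₗ (p : MvPolynomial (Fin 3) ℂ) :
    Matrix (Fin 3) (Fin 3) ℂ →ₗ[ℂ] MvPolynomial (Fin 3) ℂ where
  toFun B := linDer B p
  map_add' A B := by rw [linDer_add, Derivation.add_apply]
  map_smul' c A := by rw [linDer_smul, Derivation.smul_apply]; rfl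

/-- `lieDer` as a linear function of the matrix. -/
def lieDerₗ (ω : PolyForm) : Matrix (Fin 3) (Fin 3) ℂ →ₗ[ℂ] PolyForm where
  toFun B := lieDer B ω
  map_add' A B := lieDer_add_left A B ω
  map_smul' c A := lieDer_smul_left c A ω

theorem ofEntriesₗ_apply (a : Fin 3 × Fin 3 → ℂ) : ofEntriesₗ a = ofEntries a := rfl

theorem linDerₗ_apply (p : MvPolynomial (Fin 3) ℂ) (B : Matrix (Fin 3) (Fin 3) ℂ) :
    linDerₗ p B = linDer B p := rfl

/-- The differential at the identity of substitution is the derivation `linDer`. Composition with a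
functional keeps the target finite-dimensional, and strictness is what the open mapping argument
requires. -/
theorem hasStrictFDerivAt_functional_subst (p : MvPolynomial (Fin 3) ℂ)
    (ψ : MvPolynomial (Fin 3) ℂ →ₗ[ℂ] ℂ) :
    HasStrictFDerivAt (𝕜 := ℂ) (fun a => ψ (subst (ofEntries a) p))
      (LinearMap.toContinuousLinearMap (ψ ∘ₗ linDerₗ p ∘ₗ ofEntriesₗ)) oneEntries := by
  induction p using MvPolynomial.induction_on generalizing ψ with
  | C c =>
    simp only [subst_C]
    refine (hasStrictFDerivAt_const _ _).congr_fderiv ?_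
    ext b
    simp [linDerₗ, show ∀ B, linDer B (C c) = 0 from fun B => (linDer B).map_algebraMap c]
  | add p q hp hq =>
    simp only [map_add]
    refine ((hp ψ).add (hq ψ)).congr_fderiv ?_
    ext b
    simp [linDerₗ]
  | mul_X p k hp =>
    simp only [functional_subst_mul_X]
    refine (HasStrictFDerivAt.fun_sum fun l _ =>
      (hasStrictFDerivAt_apply (𝕜 := ℂ) (k, l) oneEntries).mul
        (hp (ψ ∘ₗ LinearMap.mulRight ℂ (X l)))).congr_fderiv ?_
    ext b
    have e : linDer (ofEntries b) (p * X k) = ∑ l, (oneEntries (k, l) •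
        (linDer (ofEntries b) p * X l) + b (k, l) • (p * X l)) := by
      simp only [Finset.sum_add_distrib, oneEntries, Matrix.one_apply, ite_smul, one_smul,
        zero_smul, Finset.sum_ite_eq, Finset.mem_univ, if_true]
      rw [Derivation.leibniz, linDer_X, smul_eq_mul, smul_eq_mul, Finset.mul_sum, add_comm]
      congr 1
      · ring
      · refine Finset.sum_congr rfl fun l _ => ?_
        rw [ofEntries_apply, smul_eq_C_mul]
        ring
    refine Eq.trans ?_ (congrArg ψ e).symm
    simp [linDerₗ_apply, ofEntriesₗ_apply, ofEntries_oneEntries, subst_one, mul_comm]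

theorem hasStrictFDerivAt_functional_pull (ω : PolyForm) (ψ : PolyForm →ₗ[ℂ] ℂ) :
    HasStrictFDerivAt (𝕜 := ℂ) (fun a => ψ (pull (ofEntries a) ω))
      (LinearMap.toContinuousLinearMap (ψ ∘ₗ lieDerₗ ω ∘ₗ ofEntriesₗ)) oneEntries := by
  simp only [functional_pull]
  refine (HasStrictFDerivAt.fun_sum fun j _ => HasStrictFDerivAt.fun_sum fun i _ =>
      (hasStrictFDerivAt_apply (𝕜 := ℂ) (i, j) oneEntries).mul
        (hasStrictFDerivAt_functional_subst (ω i)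
          (ψ ∘ₗ singleForm j))).congr_fderiv ?_
  ext b
  have e : lieDer (ofEntries b) ω = ∑ j, ∑ i, (oneEntries (i, j) •
      singleForm j (linDer (ofEntries b) (ω i)) + b (i, j) • singleForm j (ω i)) := by
    funext k
    simp only [Finset.sum_apply, Pi.add_apply, Pi.smul_apply, singleForm_apply, lieDer]
    rw [Finset.sum_comm]
    simp [Finset.sum_add_distrib, oneEntries, Matrix.one_apply, smul_eq_C_mul, ofEntries_apply,
      add_comm]
  refine Eq.trans ?_ (congrArg ψ e).symm
  simp [linDerₗ_apply, ofEntriesₗ_apply, ofEntries_oneEntries, subst_one, mul_comm]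

/-! ### The dimension of the orbits -/

/-- A polynomial which vanishes on a neighbourhood of a point is zero. -/
theorem eq_zero_of_eventually_eval_eq_zero {r : ℕ} {x : Fin r → ℂ} {Q : MvPolynomial (Fin r) ℂ}
    (h : ∀ᶠ y in nhds x, eval y Q = 0) : Q = 0 := by
  obtain ⟨ε, hε, hb⟩ := Metric.eventually_nhds_iff_ball.mp h
  refine MvPolynomial.funext_set (fun i => Metric.ball (x i) ε)
    (fun i => infinite_of_mem_nhds (x i) (Metric.ball_mem_nhds _ hε)) fun y hy => ?_
  rw [map_zero]
  refine hb y ?_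
  rw [ball_pi _ hε]
  exact hy

/-- The pull-back of a form by the matrix with given entries. -/
def pullEntries {N : ℕ} (ω : Form N) (a : Fin 3 × Fin 3 → ℂ) : Form N :=
  ⟨pull (ofEntries a) ω, pull_mem _ ω.2⟩

/-- The rank of B ↦ L_B ω is 9 minus the dimension of the annihilator. That many linear coordinates
give a submersion at the identity, so they take all values in an open set and satisfy no polynomial
relation on the cone. -/
theorem le_trdeg_coordRing_orbit {N : ℕ} {ω : Form N} (h : NoCommonFactor (ω : PolyForm)) :
    ((9 - Module.finrank ℂ (annihilator (ω : PolyForm)) : ℕ) : Cardinal) ≤ Algebra.trdeg ℂ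
      (coordRing ((fun G : Foliation N => G.1) '' Orbit (Foliation.mk ω h))) := by
  set S := (fun G : Foliation N => G.1) '' Orbit (Foliation.mk ω h) with hS
  set R := LinearMap.range (lieDerₗ ω) with hR
  have hr : 9 - Module.finrank ℂ (annihilator (ω : PolyForm)) = Module.finrank ℂ R := by
    have h1 := LinearMap.finrank_range_add_finrank_ker (lieDerₗ ω)
    have h2 : LinearMap.ker (lieDerₗ (ω : PolyForm)) = annihilator (ω : PolyForm) := rfl
    have h3 : Module.finrank ℂ (Matrix (Fin 3) (Fin 3) ℂ) = 9 := by
      simp [Module.finrank_matrix]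
    rw [h2, h3, ← hR] at h1
    omega
  rw [hr]
  -- Coordinates on the tangent space R of the cone at ω, extended linearly to all forms.
  obtain ⟨Ψ, hΨ⟩ := LinearMap.exists_extend (p := R)
    (Module.finBasis ℂ R).equivFun.toLinearMap
  have hstrict : HasStrictFDerivAt (𝕜 := ℂ) (fun a => Ψ (pull (ofEntries a) ω))
      (LinearMap.toContinuousLinearMap (Ψ ∘ₗ lieDerₗ ω ∘ₗ ofEntriesₗ)) oneEntries := by
    refine hasStrictFDerivAt_pi'.mpr fun i => ?_
    exact hasStrictFDerivAt_functional_pull ω (LinearMap.proj i ∘ₗ Ψ)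
  have hsurj : (LinearMap.toContinuousLinearMap (Ψ ∘ₗ lieDerₗ ω ∘ₗ ofEntriesₗ)).range = ⊤ := by
    rw [LinearMap.range_eq_top]
    intro y
    obtain ⟨B, hB⟩ := ((Module.finBasis ℂ R).equivFun.symm y).2
    refine ⟨fun ij => B ij.1 ij.2, ?_⟩
    change Ψ (lieDerₗ ω B) = y
    rw [hB]
    have := DFunLike.congr_fun hΨ ((Module.finBasis ℂ R).equivFun.symm y)
    exact this.trans (LinearEquiv.apply_symm_apply _ _)
  have hmap := hstrict.map_nhds_eq_of_surj hsurj
  let x : Fin (Module.finrank ℂ R) → coordRing S := fun i =>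
    ⟨fun v => Ψ v.1 i, Algebra.subset_adjoin ⟨LinearMap.proj i ∘ₗ Ψ ∘ₗ (Form N).subtype, rfl⟩⟩
  have hx : AlgebraicIndependent ℂ x := by
    rw [algebraicIndependent_iff]
    intro Q hQ
    refine eq_zero_of_eventually_eval_eq_zero (x := Ψ (pull (ofEntries oneEntries) ω)) ?_
    rw [← hmap, Filter.eventually_map]
    -- Matrices close to the identity are invertible, so the corresponding pull-backs are points of
    -- the cone, where the relation can be evaluated.
    have hdet : ∀ᶠ a in nhds oneEntries, (ofEntries a).det ≠ 0 := by
      refine ContinuousAt.eventually_ne ?_ ?_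
      · simp only [Matrix.det_fin_three, ofEntries_apply]
        fun_prop
      · rw [ofEntries_oneEntries, Matrix.det_one]
        exact one_ne_zero
    filter_upwards [hdet] with a ha
    obtain ⟨B, hB⟩ := exists_mul_eq_one_of_det ha
    have hv : pullEntries ω a ∈ cone S :=
      (mem_cone_orbit h).mpr ⟨_, B, hB, rfl⟩
    have e := congrArg ((Pi.evalAlgHom ℂ (fun _ : cone S => ℂ) ⟨_, hv⟩).comp (coordRing S).val) hQ
    rw [comp_aeval_apply, map_zero] at e
    exact e
  simpa using hx.lift_cardinalMk_le_trdeg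

/-! ### The upper bound for the transcendence degree -/

theorem exists_polynomial_of_mem_coordRing {N : ℕ} {ω : Form N}
    {S : Set (ℙ ℂ (Form N))} {g : cone S → ℂ} (hg : g ∈ coordRing S) :
    ∃ G : MvPolynomial (Fin 3 × Fin 3) ℂ, ∀ a,
      ∀ hv : pullEntries ω a ∈ cone S, g ⟨_, hv⟩ = eval a G := by
  induction hg using Algebra.adjoin_induction with
  | mem g hg =>
    obtain ⟨ψ, rfl⟩ := hg
    obtain ⟨Ψ, hΨ⟩ := LinearMap.exists_extend ψ
    obtain ⟨G, hG⟩ := exists_functional_pull ω Ψ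
    refine ⟨G, fun a hv => ?_⟩
    rw [← hG, ← hΨ]
    rfl
  | algebraMap c => exact ⟨C c, fun a hv => by rw [eval_C]; rfl⟩
  | add f g _ _ hf hg =>
    obtain ⟨F, hF⟩ := hf
    obtain ⟨G, hG⟩ := hg
    exact ⟨F + G, fun a hv => by rw [map_add, ← hF a hv, ← hG a hv]; rfl⟩
  | mul f g _ _ hf hg =>
    obtain ⟨F, hF⟩ := hf
    obtain ⟨G, hG⟩ := hg
    exact ⟨F * G, fun a hv => by rw [map_mul, ← hF a hv, ← hG a hv]; rfl⟩

/-- The entries of the matrices of the form `!![c 0, c 1, c 2; 1, c 3, c 4; 0, c 5, c 6]`. -/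
def normalEntries : Fin 3 × Fin 3 → MvPolynomial (Fin 7) ℂ :=
  fun x => !![X 0, X 1, X 2; 1, X 3, X 4; 0, X 5, X 6] x.1 x.2

/-- A function on the cone pulls back to a polynomial G in the nine entries. Since the stabilizer
brings a general matrix to normal form without changing the point of the cone, vanishing on normal
forms makes G vanish on a dense open set, hence everywhere. -/
theorem eq_zero_of_forall_normalEntries {N : ℕ} {ω : Form N} (h : NoCommonFactor (ω : PolyForm))
    (H : ∀ A : Matrix (Fin 3) (Fin 3) ℂ, A 0 0 ≠ 0 → A 1 0 ≠ 0 → ∃ M : Matrix (Fin 3) (Fin 3) ℂ,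
      pull M ω = ω ∧ (M * A) 1 0 = 1 ∧ (M * A) 2 0 = 0)
    {g : cone ((fun G : Foliation N => G.1) '' Orbit (Foliation.mk ω h)) → ℂ}
    (hg : g ∈ coordRing ((fun G : Foliation N => G.1) '' Orbit (Foliation.mk ω h)))
    (h0 : ∀ c hc, g ⟨pullEntries ω fun x => eval c (normalEntries x), hc⟩ = 0) : g = 0 := by
  obtain ⟨G, hG⟩ := exists_polynomial_of_mem_coordRing (ω := ω) hg
  -- The extra factor is zero outside the open set of matrices to which the reduction applies. It is
  -- a nonzero polynomial, so it can be cancelled.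
  have hzero : G * (X (0, 0) * X (1, 0) *
      (Matrix.of fun i j => (X (i, j) : MvPolynomial (Fin 3 × Fin 3) ℂ)).det) = 0 := by
    refine MvPolynomial.funext fun a => ?_
    have hdet : eval a (Matrix.of fun i j => (X (i, j) : MvPolynomial (Fin 3 × Fin 3) ℂ)).det
        = (ofEntries a).det := by
      simp [Matrix.det_fin_three, ofEntries_apply]
    rw [map_mul, map_mul, map_mul, hdet, eval_X, eval_X, map_zero]
    by_cases h00 : a (0, 0) = 0
    · rw [h00]; ring
    by_cases h10 : a (1, 0) = 0
    · rw [h10]; ring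
    by_cases hd : (ofEntries a).det = 0
    · rw [hd]; ring
    obtain ⟨A', hA'⟩ := exists_mul_eq_one_of_det hd
    obtain ⟨M, hpull, e1, e2⟩ := H (ofEntries a) h00 h10
    have hTc : ∃ c, ofEntries (fun x => eval c (normalEntries x)) = M * ofEntries a := by
      generalize M * ofEntries a = B at e1 e2
      refine ⟨![B 0 0, B 0 1, B 0 2, B 1 1, B 1 2, B 2 1, B 2 2], ?_⟩
      ext i j
      fin_cases i <;> fin_cases j <;> simp [ofEntries_apply, normalEntries, e1, e2]
    obtain ⟨c, hc⟩ := hTc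
    have hpt : pullEntries ω (fun x => eval c (normalEntries x)) = pullEntries ω a :=
      Subtype.ext (by
        change pull (ofEntries fun x => eval c (normalEntries x)) ω = pull (ofEntries a) ω
        rw [hc, ← pull_pull, hpull])
    have hmem := (mem_cone_orbit h (v := pullEntries ω a)).mpr ⟨_, A', hA', rfl⟩
    have hga : g ⟨pullEntries ω a, hmem⟩ = 0 := by
      have := h0 c (by rw [hpt]; exact hmem)
      simpa only [hpt] using this
    rw [← hG a hmem, hga, zero_mul]
  have hG0 : G = 0 := by
    refine (mul_eq_zero.mp hzero).resolve_right (mul_ne_zero (mul_ne_zero (X_ne_zero _)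
      (X_ne_zero _)) fun hd => ?_)
    have := congrArg (eval oneEntries) hd
    simp [Matrix.det_fin_three, oneEntries] at this
  funext v
  obtain ⟨P, Q, hPQ, hv⟩ := (mem_cone_orbit h).mp v.2
  have hvp : v.1 = pullEntries ω fun ij => P ij.1 ij.2 := Subtype.ext hv
  have := hG (fun ij => P ij.1 ij.2) (by rw [← hvp]; exact v.2)
  rw [hG0, map_zero] at this
  rw [← Subtype.coe_eta v v.2]
  simpa only [hvp, Pi.zero_apply] using this

/-- Restriction to the seven-parameter normal forms embeds the coordinate ring in a quotient of a
polynomial ring in seven variables. -/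
theorem trdeg_coordRing_orbit_le {N : ℕ} {ω : Form N} (h : NoCommonFactor (ω : PolyForm))
    (H : ∀ A : Matrix (Fin 3) (Fin 3) ℂ, A 0 0 ≠ 0 → A 1 0 ≠ 0 → ∃ M : Matrix (Fin 3) (Fin 3) ℂ,
      pull M ω = ω ∧ (M * A) 1 0 = 1 ∧ (M * A) 2 0 = 0) :
    Algebra.trdeg ℂ (coordRing ((fun G : Foliation N => G.1) '' Orbit (Foliation.mk ω h)))
      ≤ 7 := by
  have hz := fun g => eq_zero_of_forall_normalEntries (g := g) h H
  generalize (fun G : Foliation N => G.1) '' Orbit (Foliation.mk ω h) = S at hz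
  let U := {c : Fin 7 → ℂ // (pullEntries ω fun x => eval c (normalEntries x)) ∈ cone S}
  let ρ : (cone S → ℂ) →ₐ[ℂ] (U → ℂ) :=
    AlgHom.pi fun c : U => Pi.evalAlgHom ℂ (fun _ : cone S => ℂ) ⟨_, c.2⟩
  let σ : MvPolynomial (Fin 7) ℂ →ₐ[ℂ] (U → ℂ) := AlgHom.pi fun c : U => aeval c.1
  have hρ : ∀ g : coordRing S, (ρ.comp (coordRing S).val) g ∈ σ.range := by
    rintro ⟨g, hg⟩
    obtain ⟨G, hG⟩ := exists_polynomial_of_mem_coordRing (ω := ω) hg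
    refine ⟨aeval normalEntries G, funext fun c => ?_⟩
    refine Eq.trans ?_ (hG _ c.2).symm
    change aeval c.1 (aeval normalEntries G) = _
    rw [comp_aeval_apply]
    rfl
  have hinj : Function.Injective ((ρ.comp (coordRing S).val).codRestrict σ.range hρ) := by
    rw [injective_iff_map_eq_zero]
    rintro ⟨g, hg⟩ h0
    exact Subtype.ext (hz g hg fun c hc => congrFun (congrArg Subtype.val h0) ⟨c, hc⟩)
  calc Algebra.trdeg ℂ (coordRing S) ≤ Algebra.trdeg ℂ σ.range :=
        trdeg_le_of_injective _ hinj
    _ ≤ Algebra.trdeg ℂ (MvPolynomial (Fin 7) ℂ) :=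
        trdeg_le_of_surjective σ.rangeRestrict σ.rangeRestrict_surjective
    _ = 7 := by rw [MvPolynomial.trdeg_of_isDomain]; simp

theorem trdeg_coordRing_orbit_F₁_le :
    Algebra.trdeg ℂ (coordRing ((fun G : Foliation 2 => G.1) '' Orbit F₁)) ≤ 7 := by
  refine trdeg_coordRing_orbit_le form₁_noCommonFactor fun A h0 h1 => ?_
  set b := (A 1 0)⁻¹ with hb
  have hb0 : b ≠ 0 := inv_ne_zero h1
  -- The matrix with diagonal b⁻³, b, b⁹ fixes `form₁` exactly, not only up to a constant. Here b
  -- makes the entry (1, 0) equal to 1, and t is chosen so that t A₀₀ + b⁹ A₂₀ = 0.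
  set t := - b ^ 9 * A 2 0 / A 0 0 with ht
  refine ⟨!![b⁻¹ ^ 3, 0, 0; 0, b, 0; t, 0, b ^ 9], ?_, ?_, ?_⟩
  · change pull _ form₁ = form₁
    have hb3 : (C b⁻¹ * C b : MvPolynomial (Fin 3) ℂ) = 1 := by
      rw [← C_mul, inv_mul_cancel₀ hb0, C_1]
    rw [form₁_eq]
    clear_value b t
    generalize b⁻¹ = b' at *
    have k {n : ℕ} : (C b' * C b : MvPolynomial (Fin 3) ℂ) ^ n = 1 := by rw [hb3, one_pow]
    funext j
    fin_cases j <;> simp [pull, Fin.sum_univ_three, subst_X]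
    · linear_combination X 0 ^ 2 * X 2 * k (n := 9) - X 1 ^ 3 * k (n := 3)
    · linear_combination X 0 * X 1 ^ 2 * k (n := 3)
    · linear_combination X 0 ^ 3 * k (n := 9)
  · simp [Matrix.mul_apply, Fin.sum_univ_three, hb, h1]
  · simp [Matrix.mul_apply, Fin.sum_univ_three, ht, h0]

theorem trdeg_coordRing_orbit_F₅_le :
    Algebra.trdeg ℂ (coordRing ((fun G : Foliation 2 => G.1) '' Orbit F₅)) ≤ 7 := by
  refine trdeg_coordRing_orbit_le form₅_noCommonFactor fun A h0 h1 => ?_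
  set b := (A 1 0)⁻¹ with hb
  have hb0 : b ≠ 0 := inv_ne_zero h1
  -- The shear now adds a multiple of the second row, so t A₁₀ + b⁵ A₂₀ = 0.
  set t := - b ^ 5 * A 2 0 / A 1 0 with ht
  refine ⟨!![b⁻¹ ^ 3, 0, 0; 0, b, 0; 0, t, b ^ 5], ?_, ?_, ?_⟩
  · change pull _ form₅ = form₅
    have hb3 : (C b⁻¹ * C b : MvPolynomial (Fin 3) ℂ) = 1 := by
      rw [← C_mul, inv_mul_cancel₀ hb0, C_1]
    rw [form₅_eq]
    clear_value b t
    generalize b⁻¹ = b' at *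
    have k {n : ℕ} : (C b' * C b : MvPolynomial (Fin 3) ℂ) ^ n = 1 := by rw [hb3, one_pow]
    funext j
    fin_cases j <;> simp [pull, Fin.sum_univ_three, subst_X]
    · linear_combination X 1 ^ 3 * k (n := 3)
    · linear_combination X 0 ^ 2 * X 2 * k (n := 6) + X 0 * X 1 ^ 2 * k (n := 3)
    · linear_combination X 0 ^ 2 * X 1 * k (n := 6)
  · simp [Matrix.mul_apply, Fin.sum_univ_three, hb, h1]
  · simp [Matrix.mul_apply, Fin.sum_univ_three, ht, h1]

theorem mem_orbit_of_two_le_finrank {ω : Form 2} (h : NoCommonFactor (ω : PolyForm))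
    (h2 : 2 ≤ Module.finrank ℂ (annihilator (ω : PolyForm))) :
    Foliation.mk ω h ∈ Orbit F₁ ∨ Foliation.mk ω h ∈ Orbit F₅ := by
  obtain ⟨P, Q, hPQ, e | e⟩ := classification ω.2 h h2
  · exact .inl (mem_orbit_of_pull _ _ hPQ e)
  · exact .inr (mem_orbit_of_pull _ _ hPQ e)

theorem orbitHasDim_F₁ : OrbitHasDim F₁ 6 := by
  refine le_antisymm (trdeg_coordRing_orbit_F₁_le.trans (by norm_num)) ?_
  refine le_trans ?_ (le_trdeg_coordRing_orbit form₁_noCommonFactor)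
  have := annihilator_form₁_finrank_le
  change ((6 : ℕ) : Cardinal) + 1 ≤ _
  exact_mod_cast (by omega : 6 + 1 ≤ 9 - Module.finrank ℂ (annihilator form₁))

theorem orbitHasDim_F₅ : OrbitHasDim F₅ 6 := by
  refine le_antisymm (trdeg_coordRing_orbit_F₅_le.trans (by norm_num)) ?_
  refine le_trans ?_ (le_trdeg_coordRing_orbit form₅_noCommonFactor)
  have := annihilator_form₅_finrank_le
  change ((6 : ℕ) : Cardinal) + 1 ≤ _
  exact_mod_cast (by omega : 6 + 1 ≤ 9 - Module.finrank ℂ (annihilator form₅))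

/-- Dimension 6 means transcendence degree 7 for the cone. The lower bound 9 - dim (annihilator) ≤ 7
then gives an annihilator of dimension at least 2, and the classification applies. -/
theorem orbitHasDim_six_iff (F : Foliation 2) :
    OrbitHasDim F 6 ↔ Orbit F = Orbit F₁ ∨ Orbit F = Orbit F₅ := by
  constructor
  · intro hF
    obtain ⟨ω, h, rfl⟩ := F.exists_eq_mk
    have h1 := le_trdeg_coordRing_orbit h
    rw [show Algebra.trdeg ℂ _ = _ from hF] at h1
    have h2 : 9 - Module.finrank ℂ (annihilator (ω : PolyForm)) ≤ 6 + 1 := by exact_mod_cast h1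
    exact (mem_orbit_of_two_le_finrank h (by omega)).imp MulAction.orbit_eq_iff.mpr
      MulAction.orbit_eq_iff.mpr
  · rintro (h | h)
    · rw [OrbitHasDim, h]
      exact orbitHasDim_F₁
    · rw [OrbitHasDim, h]
      exact orbitHasDim_F₅

/-! ### Closedness of the two orbits -/

/-- Linear functionals on forms are continuous. -/
theorem continuous_functional {N : ℕ} (φ : PolyForm →ₗ[ℂ] ℂ) :
    Continuous fun ω : Form N => φ ω := by
  -- Homogeneity leaves finitely many monomials, so φ is a finite linear combination of
  -- coefficients, and these are continuous by definition of the topology.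
  have e : ∀ ω : Form N, φ ω = ∑ j, ∑ m ∈ Finset.finsuppAntidiag Finset.univ (N + 1),
      coeff m ((ω : PolyForm) j) * φ (singleForm j (monomial m 1)) := by
    intro ω
    have e1 : (ω : PolyForm) = ∑ j, ∑ m ∈ Finset.finsuppAntidiag Finset.univ (N + 1),
        coeff m ((ω : PolyForm) j) • singleForm j (monomial m 1) := by
      funext k
      simp only [Finset.sum_apply, Pi.smul_apply, singleForm_apply]
      rw [Finset.sum_eq_single k (by
        intro j _ hj
        simp [hj.symm]) (by simp)]
      simp only [if_true, smul_monomial, smul_eq_mul, mul_one]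
      conv_lhs => rw [as_sum ((ω : PolyForm) k)]
      refine Finset.sum_subset ?_ ?_
      · intro m hm
        have hd : m.degree = N + 1 := by
          by_contra hne
          exact (mem_support_iff.mp hm) ((ω.2.1 k).coeff_eq_zero hne)
        rw [Finset.mem_finsuppAntidiag]
        rw [Finsupp.degree_eq_sum] at hd
        exact ⟨hd, Finset.subset_univ _⟩
      · intro m _ hm
        rw [notMem_support_iff.mp hm, map_zero]
    conv_lhs => rw [e1]
    simp only [map_sum, map_smul, smul_eq_mul]
  simp only [e]
  refine continuous_finsetSum _ fun j _ => continuous_finsetSum _ fun m _ => ?_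
  have hc : Continuous fun (ω : Form N) (i : Fin 3) (m : Fin 3 →₀ ℕ) => coeff m ((ω : PolyForm) i) :=
    continuous_induced_dom
  exact ((continuous_apply m).comp ((continuous_apply j).comp hc)).mul continuous_const

/-- `lieDer` as a linear function of the form. -/
def lieDerRight (B : Matrix (Fin 3) (Fin 3) ℂ) : PolyForm →ₗ[ℂ] PolyForm where
  toFun := lieDer B
  map_add' ω η := by
    funext j
    simp [lieDer, mul_add, Finset.sum_add_distrib]
    ring
  map_smul' c ω := lieDer_smul_right B c ω

theorem lieDer_eq_sum (B : Matrix (Fin 3) (Fin 3) ℂ) (ω : PolyForm) :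
    lieDer B ω = ∑ i, ∑ j, B i j • lieDerRight (Matrix.single i j 1) ω := by
  have h := congrArg (lieDerₗ ω) (Matrix.matrix_eq_sum_single B)
  simp only [map_sum] at h
  refine Eq.trans h (Finset.sum_congr rfl fun i _ => Finset.sum_congr rfl fun j _ => ?_)
  rw [← mul_one (B i j), ← smul_eq_mul, ← Matrix.smul_single, map_smul, smul_eq_mul, mul_one]
  rfl

/-- The hermitian space of matrices, as a space of vectors. -/
abbrev MatrixSpace : Type := EuclideanSpace ℂ (Fin 3 × Fin 3)

/-- The matrix with given vector of entries. -/
def toMatrix : MatrixSpace ≃ₗ[ℂ] Matrix (Fin 3) (Fin 3) ℂ where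
  toFun a := Matrix.of fun i j => a (i, j)
  invFun B := WithLp.toLp 2 fun x => B x.1 x.2
  map_add' _ _ := rfl
  map_smul' _ _ := rfl
  left_inv _ := rfl
  right_inv _ := rfl

theorem toMatrix_apply (a : MatrixSpace) (i j : Fin 3) : toMatrix a i j = a (i, j) := rfl

theorem continuous_functional_lieDer {N : ℕ} (φ : PolyForm →ₗ[ℂ] ℂ) :
    Continuous fun x : MatrixSpace × Form N => φ (lieDer (toMatrix x.1) x.2) := by
  simp only [lieDer_eq_sum, map_sum, map_smul, smul_eq_mul, toMatrix_apply]
  refine continuous_finsetSum _ fun i _ => continuous_finsetSum _ fun j _ => ?_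
  refine Continuous.mul (by fun_prop) ?_
  exact (continuous_functional (φ ∘ₗ lieDerRight (Matrix.single i j 1))).comp continuous_snd

theorem continuous_eval_lieDer {N : ℕ} (v : Fin 3 → ℂ) (j : Fin 3) :
    Continuous fun x : MatrixSpace × Form N => eval v (lieDer (toMatrix x.1) x.2 j) := by
  simpa [aeval_eq_eval] using
    continuous_functional_lieDer (N := N) ((aeval v).toLinearMap ∘ₗ LinearMap.proj j)

/-! ### A closed condition separating the two orbits -/

/-- An invariant quadratic form on `𝔤𝔩(3, ℂ)`. -/
def traceForm (p q : ℂ) (B : Matrix (Fin 3) (Fin 3) ℂ) : ℂ :=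
  p * (B * B).trace - q * B.trace ^ 2

theorem traceForm_conj (p q : ℂ) {P Q : Matrix (Fin 3) (Fin 3) ℂ} (h : P * Q = 1)
    (B : Matrix (Fin 3) (Fin 3) ℂ) : traceForm p q (P * B * Q) = traceForm p q B := by
  have h' : Q * P = 1 := mul_eq_one_comm.mp h
  have e : P * B * Q * (P * B * Q) = P * (B * B) * Q := by
    calc P * B * Q * (P * B * Q) = P * B * (Q * P) * B * Q := by simp only [mul_assoc]
      _ = _ := by rw [h', mul_one, mul_assoc P B B]
  rw [traceForm, e, Matrix.trace_mul_comm, ← mul_assoc, h', one_mul, Matrix.trace_mul_comm (P * B),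
    ← mul_assoc, h', one_mul, traceForm]

theorem continuous_traceForm (p q : ℂ) : Continuous fun a => traceForm p q (toMatrix a) := by
  simp only [traceForm, Matrix.trace_fin_three, Matrix.mul_apply, Fin.sum_univ_three,
    toMatrix_apply]
  fun_prop

/-- The forms annihilated by a two-dimensional space of matrices which is isotropic for
`traceForm p q`. -/
def isotropicLocus (p q : ℂ) : Set (Form 2) :=
  {ω | ∃ e : Fin 2 → MatrixSpace, Orthonormal ℂ e ∧
    (∀ i, lieDer (toMatrix (e i)) ω = 0) ∧ ∀ x y : ℂ, traceForm p q (toMatrix (x • e 0 + y • e 1)) = 0}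

theorem isCompact_orthonormal : IsCompact {e : Fin 2 → MatrixSpace | Orthonormal ℂ e} := by
  refine Metric.isCompact_of_isClosed_isBounded ?_ ?_
  · have : {e : Fin 2 → MatrixSpace | Orthonormal ℂ e}
        = ⋂ i, ⋂ j, {e | inner ℂ (e i) (e j) = if i = j then 1 else 0} := by
      ext e
      simp [orthonormal_iff_ite]
    rw [this]
    refine isClosed_iInter fun i => isClosed_iInter fun j => isClosed_eq ?_ continuous_const
    fun_prop
  · refine (Metric.isBounded_closedBall (x := 0) (r := 1)).subset fun e he => ?_
    rw [mem_closedBall_zero_iff, pi_norm_le_iff_of_nonneg zero_le_one]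
    exact fun i => (he.1 i).le

/-- The locus is the projection of a closed incidence set along the compact space of orthonormal
pairs. Orthonormality prevents the plane of matrices from degenerating in a limit. -/
theorem isClosed_isotropicLocus (p q : ℂ) : IsClosed (isotropicLocus p q) := by
  let K := {e : Fin 2 → MatrixSpace // Orthonormal ℂ e}
  have : CompactSpace K := isCompact_iff_compactSpace.mp isCompact_orthonormal
  let Z : Set (K × Form 2) := {z | (∀ i, lieDer (toMatrix (z.1.1 i)) z.2 = 0) ∧
    ∀ x y : ℂ, traceForm p q (toMatrix (x • z.1.1 0 + y • z.1.1 1)) = 0}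
  have hc : ∀ i, Continuous fun z : K × Form 2 => z.1.1 i := fun i =>
    (continuous_apply i).comp (continuous_subtype_val.comp continuous_fst)
  have hZ : IsClosed Z := by
    have : Z = (⋂ i, ⋂ j, ⋂ v, {z | eval v (lieDer (toMatrix (z.1.1 i)) z.2 j) = 0}) ∩
        ⋂ x : ℂ, ⋂ y : ℂ, {z | traceForm p q (toMatrix (x • z.1.1 0 + y • z.1.1 1)) = 0} := by
      ext z
      simp only [Z, Set.mem_inter_iff, Set.mem_iInter, Set.mem_ofPred_eq]
      refine and_congr_left' (forall_congr' fun i => ⟨fun h j v => by rw [h]; simp, fun h => ?_⟩)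
      funext j
      exact MvPolynomial.funext fun v => by rw [h j v]; simp
    rw [this]
    refine IsClosed.inter (isClosed_iInter fun i => isClosed_iInter fun j => isClosed_iInter fun v =>
      isClosed_eq ?_ continuous_const) (isClosed_iInter fun x => isClosed_iInter fun y =>
      isClosed_eq ((continuous_traceForm p q).comp ?_) continuous_const)
    · exact (continuous_eval_lieDer v j).comp (f := fun z : K × Form 2 => (z.1.1 i, z.2))
        ((hc i).prodMk continuous_snd)
    · exact ((hc 0).const_smul x).add ((hc 1).const_smul y)
  have : isotropicLocus p q = Prod.snd '' Z := by
    ext ω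
    constructor
    · rintro ⟨e, he, h⟩
      exact ⟨(⟨e, he⟩, ω), h, rfl⟩
    · rintro ⟨⟨⟨e, he⟩, ω⟩, h, rfl⟩
      exact ⟨e, he, h⟩
  rw [this]
  exact isClosedMap_snd_of_compactSpace _ hZ

theorem smul_mem_isotropicLocus {p q : ℂ} {ω : Form 2} {c : ℂ} (h : ω ∈ isotropicLocus p q) :
    c • ω ∈ isotropicLocus p q := by
  obtain ⟨e, he, h1, h2⟩ := h
  refine ⟨e, he, fun i => ?_, h2⟩
  rw [Submodule.coe_smul, lieDer_smul_right, h1, smul_zero]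

/-- A set of foliations defined by a closed cone of forms is closed. -/
theorem isClosed_of_cone {N : ℕ} {T : Set (Form N)} (hT : IsClosed T)
    (hsmul : ∀ (c : ℂ) (ω : Form N), ω ∈ T → c • ω ∈ T) {S : Set (Foliation N)}
    (hS : ∀ (ω : Form N) (h : NoCommonFactor (ω : PolyForm)), Foliation.mk ω h ∈ S ↔ ω ∈ T) :
    IsClosed S := by
  have h1 : IsClosed {x : ℙ ℂ (Form N) | x.rep ∈ T} := by
    -- Membership is tested on an arbitrary representative of the class; invariance of T under
    -- scaling, used with a constant and with its inverse, makes the choice irrelevant.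
    refine isClosed_coinduced.mpr ?_
    have : Projectivization.mk' ℂ ⁻¹' {x : ℙ ℂ (Form N) | x.rep ∈ T}
        = (Subtype.val ⁻¹' T : Set {v : Form N // v ≠ 0}) := by
      ext ⟨v, hv⟩
      obtain ⟨a, ha⟩ := Projectivization.exists_smul_eq_mk_rep ℂ v hv
      change (Projectivization.mk ℂ v hv).rep ∈ T ↔ v ∈ T
      rw [← ha]
      refine ⟨fun h => ?_, hsmul a.val v⟩
      have := hsmul (a⁻¹ : ℂˣ).val _ h
      change (a⁻¹ : ℂˣ) • a • v ∈ T at this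
      rwa [inv_smul_smul] at this
    rw [this]
    exact hT.preimage continuous_subtype_val
  have h2 : S = Subtype.val ⁻¹' {x : ℙ ℂ (Form N) | x.rep ∈ T} := by
    ext ⟨x, hx⟩
    have : (⟨x, hx⟩ : Foliation N) = Foliation.mk x.rep hx := Subtype.ext x.mk_rep.symm
    exact (iff_of_eq (congrArg (· ∈ S) this)).trans (hS _ hx)
  rw [h2]
  exact h1.preimage continuous_subtype_val

theorem annihilator_pull_conj {ω : PolyForm} {P Q B : Matrix (Fin 3) (Fin 3) ℂ} (hPQ : P * Q = 1)
    (hB : B ∈ annihilator (pull P ω)) : P * B * Q ∈ annihilator ω := by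
  have := mem_annihilator_pull (A := P * B * Q) (P := Q)
    (by rw [← mul_assoc, ← mul_assoc, mul_eq_one_comm.mp hPQ, one_mul]) hB
  rwa [pull_mul_inv hPQ] at this

/-- Two members of an orthonormal basis of the annihilator serve as the pair. The inner product is
not invariant under conjugation but the trace form is, so isotropy is transported from η. -/
theorem mem_isotropicLocus_of_pull {p q : ℂ} {ω : Form 2} {η : PolyForm}
    (h2 : 2 ≤ Module.finrank ℂ (annihilator η)) (h : ∀ B ∈ annihilator η, traceForm p q B = 0)
    {P Q : Matrix (Fin 3) (Fin 3) ℂ} (hPQ : P * Q = 1) (hω : (ω : PolyForm) = pull P η) :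
    ω ∈ isotropicLocus p q := by
  let K : Submodule ℂ MatrixSpace :=
    (annihilator (ω : PolyForm)).comap (toMatrix : MatrixSpace →ₗ[ℂ] Matrix (Fin 3) (Fin 3) ℂ)
  have hK : 2 ≤ Module.finrank ℂ K := by
    rw [(toMatrix.ofSubmodule' (annihilator (ω : PolyForm))).finrank_eq, hω]
    exact h2.trans (annihilator_pull_finrank_le hPQ)
  let b := stdOrthonormalBasis ℂ K
  have hmem : ∀ a ∈ K, traceForm p q (toMatrix a) = 0 := by
    intro a ha
    rw [← traceForm_conj p q hPQ]
    refine h _ (annihilator_pull_conj hPQ ?_)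
    rw [← hω]
    exact ha
  refine ⟨fun i => (b (Fin.castLE hK i)).1, ?_, fun i => (b (Fin.castLE hK i)).2, fun x y => ?_⟩
  · exact (b.orthonormal.comp _ (Fin.castLE_injective hK)).comp_linearIsometry K.subtypeₗᵢ
  · exact hmem _ (K.add_mem (K.smul_mem _ (b _).2) (K.smul_mem _ (b _).2))

theorem two_le_finrank_of_mem_isotropicLocus {p q : ℂ} {ω : Form 2}
    (h : ω ∈ isotropicLocus p q) : 2 ≤ Module.finrank ℂ (annihilator (ω : PolyForm)) := by
  obtain ⟨e, he, h1, -⟩ := h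
  have hli := (he.linearIndependent.map' toMatrix.toLinearMap toMatrix.ker)
  have hli' : LinearIndependent ℂ fun i => (⟨toMatrix (e i), h1 i⟩ : annihilator (ω : PolyForm)) :=
    LinearIndependent.of_comp (annihilator (ω : PolyForm)).subtype hli
  simpa using hli'.fintype_card_le_finrank

/-- An isotropic plane for ω would give, after conjugation, two independent isotropic elements in
the annihilator of η. -/
theorem not_mem_isotropicLocus_of_pull {p q : ℂ} {ω : Form 2} {η : PolyForm}
    (h : ∀ B ∈ annihilator η, ∀ C ∈ annihilator η, traceForm p q B = 0 → traceForm p q C = 0 →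
      ∃ x y : ℂ, (x, y) ≠ 0 ∧ x • B + y • C = 0)
    {P Q : Matrix (Fin 3) (Fin 3) ℂ} (hPQ : P * Q = 1) (hω : (ω : PolyForm) = pull P η) :
    ω ∉ isotropicLocus p q := by
  rintro ⟨e, he, h1, h2⟩
  have ha : ∀ i, P * toMatrix (e i) * Q ∈ annihilator η := fun i =>
    annihilator_pull_conj hPQ (by rw [← hω]; exact h1 i)
  obtain ⟨x, y, hxy, h0⟩ := h _ (ha 0) _ (ha 1)
    (by rw [traceForm_conj p q hPQ]; simpa using h2 1 0)
    (by rw [traceForm_conj p q hPQ]; simpa using h2 0 1)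
  have h3 : x • toMatrix (e 0) + y • toMatrix (e 1) = 0 := by
    have h' : Q * P = 1 := mul_eq_one_comm.mp hPQ
    have hc : ∀ B, Q * (P * B * Q) * P = B := fun B => by
      rw [mul_assoc P, ← mul_assoc Q, h', one_mul, mul_assoc, h', mul_one]
    have := congrArg (fun B => Q * B * P) h0
    simpa only [mul_add, add_mul, Matrix.mul_smul, Matrix.smul_mul, hc, mul_zero, zero_mul] using this
  rw [← map_smul, ← map_smul, ← map_add, LinearEquiv.map_eq_zero_iff] at h3
  have hli := LinearIndependent.pair_iff.mp
    (show LinearIndependent ℂ ![e 0, e 1] by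
      have : ![e 0, e 1] = e := by
        funext i
        fin_cases i <;> rfl
      rw [this]
      exact he.linearIndependent) x y h3
  exact hxy (Prod.ext hli.1 hli.2)

theorem mem_isotropicLocus_of_mem_orbit {p q : ℂ} {η ω : Form 2} (hη : NoCommonFactor (η : PolyForm))
    (h2 : 2 ≤ Module.finrank ℂ (annihilator (η : PolyForm)))
    (h : ∀ B ∈ annihilator (η : PolyForm), traceForm p q B = 0)
    (hω : NoCommonFactor (ω : PolyForm)) (ho : Foliation.mk ω hω ∈ Orbit (Foliation.mk η hη)) :
    ω ∈ isotropicLocus p q := by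
  obtain ⟨P, Q, c, hPQ, -, e⟩ := exists_pull_of_mem_orbit hη hω ho
  have : ω = c • ⟨pull P η, pull_mem P η.2⟩ := Subtype.ext e
  rw [this]
  exact smul_mem_isotropicLocus (mem_isotropicLocus_of_pull h2 h hPQ rfl)

/-- The two bounds on the transcendence degree give 9 - dim (annihilator) ≤ 7. -/
theorem two_le_finrank_annihilator_form₁ : 2 ≤ Module.finrank ℂ (annihilator form₁) := by
  have h := (le_trdeg_coordRing_orbit form₁_noCommonFactor).trans trdeg_coordRing_orbit_F₁_le
  have : 9 - Module.finrank ℂ (annihilator form₁) ≤ 7 := by exact_mod_cast h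
  omega

theorem two_le_finrank_annihilator_form₅ : 2 ≤ Module.finrank ℂ (annihilator form₅) := by
  have h := (le_trdeg_coordRing_orbit form₅_noCommonFactor).trans trdeg_coordRing_orbit_F₅_le
  have : 9 - Module.finrank ℂ (annihilator form₅) ≤ 7 := by exact_mod_cast h
  omega

/-- The eigenvalues are proportional to -3, 1, 9, with sum 7 and sum of squares 91. -/
theorem traceForm_of_mem_annihilator_form₁ (p q : ℂ) {B : Matrix (Fin 3) (Fin 3) ℂ}
    (hB : B ∈ annihilator form₁) : traceForm p q B = (91 * p - 49 * q) * B 1 1 ^ 2 := by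
  obtain ⟨a1, a2, a3, a4, a5, a6, a7⟩ := annihilator_form₁ hB
  simp only [traceForm, Matrix.trace_fin_three, Matrix.mul_apply, Fin.sum_univ_three, a1, a2, a3,
    a4, a5, a6, a7]
  ring

/-- The eigenvalues are proportional to -3, 1, 5, with sum 3 and sum of squares 35. -/
theorem traceForm_of_mem_annihilator_form₅ (p q : ℂ) {B : Matrix (Fin 3) (Fin 3) ℂ}
    (hB : B ∈ annihilator form₅) : traceForm p q B = (35 * p - 9 * q) * B 1 1 ^ 2 := by
  obtain ⟨a1, a2, a3, a4, a5, a6, a7⟩ := annihilator_form₅ hB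
  simp only [traceForm, Matrix.trace_fin_three, Matrix.mul_apply, Fin.sum_univ_three, a1, a2, a3,
    a4, a5, a6, a7]
  ring

/-- Two multiples of the same matrix are linearly dependent. -/
theorem exists_relation_of_smul {V : Type*} [AddCommGroup V] [Module ℂ V] (v : V) (s t : ℂ) :
    ∃ x y : ℂ, (x, y) ≠ 0 ∧ x • s • v + y • t • v = 0 := by
  by_cases hs : s = 0
  · exact ⟨1, 0, by simp, by simp [hs]⟩
  · refine ⟨t, -s, fun h => hs (neg_eq_zero.mp (congrArg Prod.snd h)), ?_⟩
    module

theorem isClosed_orbit_F₁ : IsClosed (Orbit F₁) := by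
  -- The constants satisfy 91 · 7 = 49 · 13, so the trace form vanishes on the annihilator of
  -- `form₁`. On that of `form₅` it is 128 B₁₁², whose zeros form only a line.
  refine isClosed_of_cone (isClosed_isotropicLocus 7 13) (fun _ _ => smul_mem_isotropicLocus)
    fun ω h => ⟨?_, fun hω => ?_⟩
  · refine mem_isotropicLocus_of_mem_orbit (η := ⟨form₁, form₁_mem⟩) form₁_noCommonFactor
      two_le_finrank_annihilator_form₁
      (fun B hB => ?_) h
    rw [traceForm_of_mem_annihilator_form₁ _ _ hB]
    norm_num
  · obtain ⟨P, Q, hPQ, e | e⟩ := classification ω.2 h (two_le_finrank_of_mem_isotropicLocus hω)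
    · exact mem_orbit_of_pull _ _ hPQ e
    · refine absurd hω (not_mem_isotropicLocus_of_pull (fun B hB C hC hB0 hC0 => ?_) hPQ e)
      have key : ∀ B ∈ annihilator form₅, traceForm 7 13 B = 0 →
          B = B 2 1 • (Matrix.single 2 1 1 : Matrix (Fin 3) (Fin 3) ℂ) := by
        intro B hB h0
        rw [traceForm_of_mem_annihilator_form₅ _ _ hB] at h0
        have h11 : B 1 1 = 0 := by
          refine pow_eq_zero_iff two_ne_zero |>.mp ((mul_eq_zero.mp h0).resolve_left ?_)
          norm_num
        obtain ⟨a1, a2, a3, a4, a5, a6, a7⟩ := annihilator_form₅ hB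
        ext i j
        fin_cases i <;> fin_cases j <;> simp [h11, a1, a2, a3, a4, a5, a6, a7]
      rw [key B hB hB0, key C hC hC0]
      exact exists_relation_of_smul _ _ _

theorem isClosed_orbit_F₅ : IsClosed (Orbit F₅) := by
  -- Now 35 · 9 = 9 · 35 gives vanishing on the annihilator of `form₅`, while on that of `form₁` the
  -- form is -896 B₁₁².
  refine isClosed_of_cone (isClosed_isotropicLocus 9 35) (fun _ _ => smul_mem_isotropicLocus)
    fun ω h => ⟨?_, fun hω => ?_⟩
  · refine mem_isotropicLocus_of_mem_orbit (η := ⟨form₅, form₅_mem⟩) form₅_noCommonFactor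
      two_le_finrank_annihilator_form₅
      (fun B hB => ?_) h
    rw [traceForm_of_mem_annihilator_form₅ _ _ hB]
    norm_num
  · obtain ⟨P, Q, hPQ, e | e⟩ := classification ω.2 h (two_le_finrank_of_mem_isotropicLocus hω)
    · refine absurd hω (not_mem_isotropicLocus_of_pull (fun B hB C hC hB0 hC0 => ?_) hPQ e)
      have key : ∀ B ∈ annihilator form₁, traceForm 9 35 B = 0 →
          B = B 2 0 • (Matrix.single 2 0 1 : Matrix (Fin 3) (Fin 3) ℂ) := by
        intro B hB h0
        rw [traceForm_of_mem_annihilator_form₁ _ _ hB] at h0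
        have h11 : B 1 1 = 0 := by
          refine pow_eq_zero_iff two_ne_zero |>.mp ((mul_eq_zero.mp h0).resolve_left ?_)
          norm_num
        obtain ⟨a1, a2, a3, a4, a5, a6, a7⟩ := annihilator_form₁ hB
        ext i j
        fin_cases i <;> fin_cases j <;> simp [h11, a1, a2, a3, a4, a5, a6, a7]
      rw [key B hB hB0, key C hC hC0]
      exact exists_relation_of_smul _ _ _
    · exact mem_orbit_of_pull _ _ hPQ e

end

end P2Foliation

theorem mainTheorem6 :
    (∀ F : P2Foliation.Foliation 2, Module.finrank ℂ (P2Foliation.isoAlgebra F) = 2 →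
      F ∈ P2Foliation.Orbit P2Foliation.F₁ ∨ F ∈ P2Foliation.Orbit P2Foliation.F₅) ∧
    (∀ F : P2Foliation.Foliation 2, P2Foliation.OrbitHasDim F 6 ↔
      P2Foliation.Orbit F = P2Foliation.Orbit P2Foliation.F₁ ∨
        P2Foliation.Orbit F = P2Foliation.Orbit P2Foliation.F₅) ∧
    P2Foliation.Orbit P2Foliation.F₁ ≠ P2Foliation.Orbit P2Foliation.F₅ ∧
    IsClosed (P2Foliation.Orbit P2Foliation.F₁) ∧
    IsClosed (P2Foliation.Orbit P2Foliation.F₅) ∧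
    (P2Foliation.Iso P2Foliation.F₁ : Set PGL(3, ℂ)) =
      {g | ∃ (α : ℂˣ) (β : ℂ),
        g = P2Foliation.diagAut (α ^ 3) (α ^ 2) * P2Foliation.shearX β} ∧
    (P2Foliation.Iso P2Foliation.F₅ : Set PGL(3, ℂ)) =
      {g | ∃ (α : ℂˣ) (β : ℂ),
        g = P2Foliation.diagAut (α ^ 2) α * P2Foliation.shearY β} ∧
    (∀ g : PGL(3, ℂ), (P2Foliation.Iso P2Foliation.F₁).map (MulAut.conj g).toMonoidHom ≠
      P2Foliation.Iso P2Foliation.F₅) := by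
  refine ⟨fun F hF => ?_, P2Foliation.orbitHasDim_six_iff, P2Foliation.orbits_ne,
    P2Foliation.isClosed_orbit_F₁, P2Foliation.isClosed_orbit_F₅, P2Foliation.iso_F₁,
    P2Foliation.iso_F₅, P2Foliation.iso_not_conj⟩
  obtain ⟨ω, h, rfl⟩ := F.exists_eq_mk
  exact P2Foliation.mem_orbit_of_two_le_finrank h
    (hF.symm.le.trans (P2Foliation.finrank_isoAlgebra_le ω h))
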